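/- \textbf{Notation.} $\mathcal H^k$ is the (normalized) $k$-dimensional Hausdorff measure in $\mathbb R^3$, $G(3,2)$ is the Grassmannian of $2$-planes in $\mathbb R^3$, $G_2(\mathbb R^3)=\mathbb R^3\times G(3,2)$, and a plane $P\in G(3,2)$ is identified with the matrix $(P_{jk})\in\mathbb R^{3\times 3}$ of the orthogonal projection onto it. A $2$-varifold $V$ in $\mathbb R^3$ (a Radon measure on $G_2(\mathbb R^3)$) is a \emph{curvature varifold with boundary} (Mantegazza) with respect to $A=(A_{ijk})\in L^1_{loc}(G_2(\mathbb R^3),\mathbb R^{3^3};V)$ and an $\mathbb R^3$-valued Radon measure $\partial V=(\partial_1V,\partial_2V,\partial_3V)$ on $G_2(\mathbb R^3)$ if, summing over repeated indices, $$\int P_{ij}D_j\varphi(x,P)+D^*_{jk}\varphi(x,P)A_{ijk}(x,P)+\varphi(x,P)A_{jij}(x,P)\,dV(x,P)=-\int\varphi(x,P)\,d(\partial_iV)(x,P)$$ for $i=1,2,3$ and all $\varphi\in C^1_c(G_2(\mathbb R^3))$; here $\varphi$ is written as the restriction of a function in $C_c^1(\mathbb R^3\times\mathbb R^{3\times3})$,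 and $D_j$, $D^*_{jk}$ are the partial derivatives in $x_j$ and in the matrix entry $P_{jk}$. \textbf{Construction.} Let $\Phi:\mathbb R\to\mathbb R$ be smooth with $0\le\Phi\le1$, $\Phi(0)=1$, $\operatorname{supp}\Phi\subset(-1,1)$, $\Phi(-t)=\Phi(t)$, $\Phi'(t)\le0$ for $t\ge0$, $\sup|\Phi'|\le4$ and $\int_{\mathbb R}\Phi=1$. For $x_1>0$ put $g(x_1,x_2)=\frac1{\sqrt3}\int_{-x_2}^{x_2}\Phi(t/x_1)\,dt$, and let $\Sigma_1=\{(x_1,x_2,g(x_1,x_2)):x_1>0\}$. Let $\rho$ be the rotation of $\mathbb R^3$ by $2\pi/3$ around the $x_2$-axis (from $e_1$ towards $e_3$) and let $\Sigma_2$ be the image of $\Sigma_1$ under $(x_1,x_2,x_3)\mapsto(x_1,-x_2,x_3)$; put $\Sigma_{i+2}=\rho(\Sigma_i)$ for $i=1,\dots,4$. Let $\nu_1^\pm=(\frac{\sqrt3}2,0,\pm\frac12)$, $\nu_2^\pm=(\frac{\sqrt3}2,0,\mp\frac12)$ and $\nu_{i+2}^\pm=\rho(\nu_i^\pm)$ for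 $i=1,\dots,4$, and let $L^\pm=\{x\in\mathbb R^3: x_1=x_3=0,\ \pm x_2>0\}$. For $x\in\Sigma_i\cup L^+\cup L^-$ let $T_x\Sigma_i$ be the tangent plane of $\Sigma_i$ at $x$ (at $x\in L^\pm$, which is a boundary point of $\Sigma_i$, this is the plane spanned by $\nu_i^\pm$ and $e_2$), and let $T_{W_i}(x)=(x,T_x\Sigma_i)$. Let $W_i=(T_{W_i})_\sharp(\mathcal H^2\llcorner\Sigma_i)$ be the varifold of density $1$ induced by $\Sigma_i$, and let $Z_1=W_1+W_3+W_5$, $Z_2=W_2+W_4+W_6$. \textbf{Lemma.} For each $i=1,\dots,6$, $W_i$ is a curvature varifold with boundary. More precisely, this holds with respect to the functions $A_{ljk}(x)=T_{lm}(x)\,\partial_mT_{jk}(x)$, where $T(x)$ is the matrix of the orthogonal projection onto $T_x\Sigma_i$ for $x\in\Sigma_i$ (that is, $A_{ljk}(x)$ is the derivative of $T_{jk}$ along $\Sigma_i$ in the direction $T(x)e_l$), and the boundary measure $$\partial W_i=(T_{W_i})_\sharp\bigl(\nu_i^+\,\mathcal H^1\llcorner L^++\nu_i^-\,\mathcal H^1\llcorner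 L^-\bigr).$$ In particular $Z_1$ and $Z_2$ are curvature varifolds with non-zero boundary: each $Z_k$ is a curvature varifold with boundary, and every $\mathbb R^3$-valued Radon measure that is a boundary of $Z_k$ (with respect to some $A$) is non-zero. -/

import Mathlib

open MeasureTheory
open scoped ContDiff

noncomputable section

namespace CurvVar

/-- Euclidean space `ℝⁿ`. -/
abbrev E (n : ℕ) : Type := EuclideanSpace ℝ (Fin n)

/-- The `i`-th vector of the canonical basis of `ℝⁿ`. -/
def stdVec {n : ℕ} (i : Fin n) : E n := EuclideanSpace.single i 1

/-- The space `ℝ^(n²)` of `n × n` matrices, as a finite-dimensional normed space. -/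
abbrev Mat (n : ℕ) : Type := Fin n → Fin n → ℝ

/-! ### The Grassmannian -/

/-- The Grassmannian `G(n, m)` of `m`-dimensional linear subspaces of `ℝⁿ`. -/
@[ext] structure Gr (n m : ℕ) where
  /-- The underlying linear subspace. -/
  plane : Submodule ℝ (E n)
  finrank_plane : Module.finrank ℝ plane = m

/-- The matrix `(P_{jk})` of the orthogonal projection of `ℝⁿ` onto `P`. -/
def Gr.matrix {n m : ℕ} (P : Gr n m) : Mat n :=
  fun j k => (P.plane.starProjection (stdVec k)) j

/-- `G(n, m)` has the topology of a subset of `ℝ^(n²)`, through the orthogonal projections. -/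
instance (n m : ℕ) : TopologicalSpace (Gr n m) :=
  TopologicalSpace.induced Gr.matrix inferInstance

instance (n m : ℕ) : MeasurableSpace (Gr n m) := borel _

instance (n m : ℕ) : BorelSpace (Gr n m) := ⟨rfl⟩

instance (n m : ℕ) : SecondCountableTopology (Gr n m) :=
  TopologicalSpace.secondCountableTopology_induced _ _ Gr.matrix

instance : Nonempty (Gr 3 2) := by
  have : Fact (Module.finrank ℝ (E 3) = 2 + 1) := ⟨by simp⟩
  have h : stdVec (0 : Fin 3) ≠ 0 := by
    intro h
    have := congrArg (fun v : E 3 => v 0) h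
    simp [stdVec] at this
  exact ⟨⟨(ℝ ∙ stdVec (0 : Fin 3))ᗮ, Submodule.finrank_orthogonal_span_singleton h⟩⟩

/-- The Grassmann bundle `G_m(ℝⁿ) = ℝⁿ × G(n, m)`. -/
abbrev GrBundle (n m : ℕ) : Type := E n × Gr n m

/-! ### `ℝⁿ`-valued Radon measures -/

/-- An `ℝⁿ`-valued measure on `X`, possibly of infinite total variation, given coordinatewise: the
`i`-th coordinate is the signed measure `pos i - neg i`. -/
structure RnMeasure (n : ℕ) (X : Type) [MeasurableSpace X] where
  pos : Fin n → Measure X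
  neg : Fin n → Measure X

namespace RnMeasure

variable {n : ℕ} {X Y : Type} [MeasurableSpace X] [MeasurableSpace Y]

/-- Each coordinate is a difference of two locally finite Borel measures. (This is used on `ℝⁿ` and
`G_m(ℝⁿ)`, where locally finite Borel measures are Radon.) -/
def IsRadon [TopologicalSpace X] (β : RnMeasure n X) : Prop :=
  ∀ i, IsLocallyFiniteMeasure (β.pos i) ∧ IsLocallyFiniteMeasure (β.neg i)

/-- The vector measure is zero: each coordinate `pos i - neg i` vanishes. -/
def IsZero (β : RnMeasure n X) : Prop := β.pos = β.neg

/-- The integral of `f` against the `i`-th coordinate. -/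
def integral (β : RnMeasure n X) (i : Fin n) (f : X → ℝ) : ℝ :=
  ∫ x, f x ∂(β.pos i) - ∫ x, f x ∂(β.neg i)

/-- The vector measure `v μ`, for a constant vector `v` and a positive measure `μ`. -/
def constMul (v : E n) (μ : Measure X) : RnMeasure n X where
  pos i := ENNReal.ofReal (v i) • μ
  neg i := ENNReal.ofReal (-v i) • μ

/-- The sum of two vector measures. -/
def add (β γ : RnMeasure n X) : RnMeasure n X where
  pos i := β.pos i + γ.pos i
  neg i := β.neg i + γ.neg i

/-- The pushforward `f_♯ β`. -/
def map (f : X → Y) (β : RnMeasure n X) : RnMeasure n Y where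
  pos i := (β.pos i).map f
  neg i := (β.neg i).map f

end RnMeasure

/-! ### Curvature varifolds with boundary -/

/-- `V`, a Radon measure on `G_m(ℝⁿ)` (that is, an `m`-varifold in `ℝⁿ`), is a curvature varifold
with boundary with respect to the functions `A_{ijk} = A · i j k ∈ L¹_loc(V)` and the `ℝⁿ`-valued
Radon measure `β` on `G_m(ℝⁿ)`, in the sense of Mantegazza:
`∫ P_{ij} D_jφ + D*_{jk}φ A_{ijk} + φ A_{jij} dV = -∫ φ dβ_i` for all `i` and all `φ` of class `C¹`
with compact support.

A test function is written as the restriction to `G_m(ℝⁿ) ⊆ ℝⁿ × ℝ^(n²)` of a `C¹` function `φ` with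
compact support on `ℝⁿ × ℝ^(n²)`; `D_j` and `D*_{jk}` are the partial derivatives in the `j`-th
coordinate of `ℝⁿ` and in the `(j, k)`-entry of the matrix. -/
structure HasCurvatureAndBoundary {n m : ℕ} (V : Measure (GrBundle n m))
    (A : GrBundle n m → Fin n → Fin n → Fin n → ℝ) (β : RnMeasure n (GrBundle n m)) : Prop where
  isVarifold : IsLocallyFiniteMeasure V
  locallyIntegrable : ∀ i j k, LocallyIntegrable (fun p => A p i j k) V
  isRadon : β.IsRadon
  integral_eq : ∀ φ : E n × Mat n → ℝ, ContDiff ℝ 1 φ → HasCompactSupport φ → ∀ i : Fin n,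
    ∫ p : GrBundle n m,
        ((∑ j, p.2.matrix i j * fderiv ℝ φ (p.1, p.2.matrix) (stdVec j, 0))
          + (∑ j, ∑ k, fderiv ℝ φ (p.1, p.2.matrix) (0, Pi.single j (Pi.single k 1)) * A p i j k)
          + φ (p.1, p.2.matrix) * ∑ j, A p j i j) ∂V
      = -β.integral i (fun p => φ (p.1, p.2.matrix))

/-- Curvature varifolds with boundary. -/
def IsCurvatureVarifoldWithBoundary {n m : ℕ} (V : Measure (GrBundle n m)) : Prop :=
  ∃ A β, HasCurvatureAndBoundary V A β

/-! ### Varifolds induced by surfaces -/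

/-- The tangent plane `T_xR ∈ G(n, m)` of `R ⊆ ℝⁿ` at `x`: the span of the vectors tangent to `R`
at `x`, provided it has dimension `m` (and an arbitrary plane otherwise). It is used for embedded
`m`-dimensional surfaces `R`, at points of `R` and at regular boundary points. -/
def tangentPlane {n : ℕ} (m : ℕ) [Nonempty (Gr n m)] (R : Set (E n)) (x : E n) : Gr n m :=
  open scoped Classical in
  if h : Module.finrank ℝ (Submodule.span ℝ (tangentConeAt ℝ R x)) = m
  then ⟨Submodule.span ℝ (tangentConeAt ℝ R x), h⟩
  else Classical.arbitrary _

/-- The tangent map `x ↦ (x, T_xR)`. -/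
def tangentMap {n : ℕ} (m : ℕ) [Nonempty (Gr n m)] (R : Set (E n)) (x : E n) : GrBundle n m :=
  (x, tangentPlane m R x)

/-- The varifold of density `1` induced by an embedded `m`-dimensional surface `R`. Here `μHE[m]` is
the `m`-dimensional Hausdorff measure, normalized to agree with Lebesgue measure on `ℝᵐ`. -/
def inducedVarifold {n : ℕ} (m : ℕ) [Nonempty (Gr n m)] (R : Set (E n)) :
    Measure (GrBundle n m) :=
  Measure.map (tangentMap m R) ((μHE[m] : Measure (E n)).restrict R)

/-- `A_{ijk}(x) = T_{il} ∂_l T_{jk}` at `x ∈ R`, where `T = T(x)` is the matrix of the projection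
onto the tangent plane of `R`: the derivative of `T_{jk}` along `R` in the tangent direction
`T(x) e_i`. As a function on `G_m(ℝⁿ)` it depends on the base point alone; for the varifold induced
by `R` only its values at the points `(x, T_xR)`, `x ∈ R`, matter. -/
def secondFundamentalForm {n : ℕ} (m : ℕ) [Nonempty (Gr n m)] (R : Set (E n))
    (p : GrBundle n m) (i j k : Fin n) : ℝ :=
  fderivWithin ℝ (fun y => (tangentPlane m R y).matrix j k) R p.1
    ((tangentPlane m R p.1).plane.starProjection (stdVec i))

/-! ### The example -/

/-- The properties required of the bump function `Φ`. -/
structure IsBump (Φ : ℝ → ℝ) : Prop where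
  smooth : ContDiff ℝ ∞ Φ
  nonneg : ∀ t, 0 ≤ Φ t
  le_one : ∀ t, Φ t ≤ 1
  apply_zero : Φ 0 = 1
  tsupport_subset : tsupport Φ ⊆ Set.Ioo (-1) 1
  even : ∀ t, Φ (-t) = Φ t
  deriv_nonpos : ∀ t, 0 ≤ t → deriv Φ t ≤ 0
  abs_deriv_le : ∀ t, |deriv Φ t| ≤ 4
  integral_eq_one : ∫ t, Φ t = 1

/-- `g(x₁, x₂) = (1/√3) ∫_{-x₂}^{x₂} Φ(t/x₁) dt`, used for `x₁ > 0`. -/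
def g (Φ : ℝ → ℝ) (x₁ x₂ : ℝ) : ℝ := 1 / √3 * ∫ t in (-x₂)..x₂, Φ (t / x₁)

/-- The rotation by `2π/3` around the `x₂`-axis (from `e₁` towards `e₃`). -/
def rot (x : E 3) : E 3 :=
  !₂[-(1 / 2) * x 0 - √3 / 2 * x 2, x 1, √3 / 2 * x 0 - 1 / 2 * x 2]

/-- The reflection across the `x₁x₃`-plane. -/
def reflect (x : E 3) : E 3 := !₂[x 0, -x 1, x 2]

/-- The surfaces `Σ_i`, `i = 1, …, 6`: `Σ_1` is the graph of `g` over `{x₁ > 0}`, `Σ_2` its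
reflection, and `Σ_{i+2}` is the rotation of `Σ_i`. (The index `0` is not used.) -/
def surface (Φ : ℝ → ℝ) : ℕ → Set (E 3)
  | 0 => ∅
  | 1 => {x | 0 < x 0 ∧ x 2 = g Φ (x 0) (x 1)}
  | 2 => reflect '' {x | 0 < x 0 ∧ x 2 = g Φ (x 0) (x 1)}
  | i + 3 => rot '' surface Φ (i + 1)

/-- The conormals `ν_i^±`, `i = 1, …, 6`, with `s = 1` for `+` and `s = -1` for `-`: `ν_1^± =
(√3/2, 0, ±1/2)`, `ν_2^± = (√3/2, 0, ∓1/2)` and `ν_{i+2}^±` is the rotation of `ν_i^±`. (The index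
`0` is not used.) -/
def conormal (s : ℝ) : ℕ → E 3
  | 0 => 0
  | 1 => !₂[√3 / 2, 0, s / 2]
  | 2 => !₂[√3 / 2, 0, -s / 2]
  | i + 3 => rot (conormal s (i + 1))

/-- The half-lines `L^±` of the `x₂`-axis, with `s = 1` for `+` and `s = -1` for `-`. -/
def halfLine (s : ℝ) : Set (E 3) := {x | x 0 = 0 ∧ x 2 = 0 ∧ 0 < s * x 1}

/-- The varifolds `W_i`. -/
def W (Φ : ℝ → ℝ) (i : ℕ) : Measure (GrBundle 3 2) := inducedVarifold 2 (surface Φ i)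

/-- `(T_{W_i})_♯ (ν_i^+ H¹⌞L^+ + ν_i^- H¹⌞L^-)`. -/
def boundaryW (Φ : ℝ → ℝ) (i : ℕ) : RnMeasure 3 (GrBundle 3 2) :=
  RnMeasure.map (tangentMap 2 (surface Φ i))
    (RnMeasure.add
      (RnMeasure.constMul (conormal 1 i) ((μHE[1] : Measure (E 3)).restrict (halfLine 1)))
      (RnMeasure.constMul (conormal (-1) i) ((μHE[1] : Measure (E 3)).restrict (halfLine (-1)))))

/-- `Z_1 = W_1 + W_3 + W_5`. -/
def Z₁ (Φ : ℝ → ℝ) : Measure (GrBundle 3 2) := W Φ 1 + W Φ 3 + W Φ 5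

/-- `Z_2 = W_2 + W_4 + W_6`. -/
def Z₂ (Φ : ℝ → ℝ) : Measure (GrBundle 3 2) := W Φ 2 + W Φ 4 + W Φ 6

end CurvVar

end

/-! Up to the rotation, each surface is the graph of `height Φ c u v = c * u * primitive Φ (v / u)`
over `u > 0`, with `c = 2 / √3` for odd indices and `c = -(2 / √3)` for even ones (`surface_odd`,
`surface_even`). This function is 1-homogeneous, so its gradient, the unit normal, the tangent plane
and the area element depend on the slope `s = v / u` alone. For `|s| ≥ 1` the bump vanishes and the
graph is flat: near any point of `L^±` it is a piece of the half-plane spanned by `e₂` and the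
conormal. All the curvature sits in the cone `|v| ≤ u`, where it is of size `1 / u`; since the slice
of the cone at `u` has length `2u`, the curvature is locally integrable although it is unbounded at
the origin.

The identity for one sheet is the divergence theorem. In graph coordinates the integrand of
Mantegazza's identity, times the area element, is the planar divergence `∂_u(φ F₀) + ∂_v(φ F₁)`,
where `F_a` is the area element times the coordinates of the projected basis vector `T e_i`
(`area_mul_firstVar`). Integration over the half-plane leaves the limit of `φ F₀` as `u → 0`
(`integral_divergence_halfPlane`), and there `F₀` is the conormal (`fluxCoeff_eq_conormal`). The
area formula, proved for injective `C¹` immersions, turns the induced varifold into a planar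
pushforward (`inducedVarifold_eq`).

The three sheets of `Z_k` lie in disjoint sectors, so their curvature functions glue and their
boundaries add (`IsTame.add`). The three conormals along `L^+` sum to zero in `ℝ³`, so non-vanishing
of the boundary must be seen in the Grassmann bundle: the three planes are distinct, and a test
function concentrated near one of them sees a single conormal. That no other choice of `A` can
absorb this boundary is `integral_boundary_eq_zero`. Subtracting the identities for two choices of
`A` removes all `x`-derivatives of the test function, so it may be multiplied by cutoffs shrinking
to the `x₂`-axis. The varifold does not charge the axis and the known boundary lives on it, so in
the limit that boundary would have to vanish too. -/

noncomputable section

namespace CurvVar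

/-! ### The area formula for embedded parametrized surfaces -/

section AreaFormula

open Set Filter Topology
open scoped NNReal ENNReal

theorem euclideanHausdorffMeasure_image_le_of_dist_le {X Y Z : Type*} [Nonempty X]
    [MetricSpace Y] [MeasurableSpace Y] [BorelSpace Y]
    [MetricSpace Z] [MeasurableSpace Z] [BorelSpace Z]
    {f : X → Y} {h : X → Z} {t : Set X} {C : ℝ≥0} (d : ℕ)
    (hfh : ∀ x ∈ t, ∀ y ∈ t, dist (f x) (f y) ≤ C * dist (h x) (h y)) :
    (μHE[d] : Measure Y) (f '' t) ≤ (C : ℝ≥0∞) ^ d * (μHE[d] : Measure Z) (h '' t) := by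
  have hinv : ∀ z ∈ h '' t, Function.invFunOn h t z ∈ t ∧ h (Function.invFunOn h t z) = z :=
    fun z hz => ⟨Function.invFunOn_mem hz, Function.invFunOn_eq hz⟩
  -- The hypothesis makes `f` constant on the fibres of `h` in `t`, so `f` factors through `h` by
  -- any choice of preimages, and the factor is `C`-Lipschitz.
  have himg : f '' t = (f ∘ Function.invFunOn h t) '' (h '' t) := by
    rw [image_image]
    refine image_congr fun x hx => ?_
    obtain ⟨h1, h2⟩ := hinv (h x) (mem_image_of_mem h hx)
    have := hfh x hx _ h1
    rw [h2, dist_self, mul_zero] at this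
    exact dist_le_zero.1 this
  have hlip : LipschitzOnWith C (f ∘ Function.invFunOn h t) (h '' t) := by
    refine LipschitzOnWith.of_dist_le_mul fun z hz w hw => ?_
    obtain ⟨h1, h2⟩ := hinv z hz
    obtain ⟨h3, h4⟩ := hinv w hw
    have := hfh _ h1 _ h3
    rwa [h2, h4] at this
  have key := hlip.hausdorffMeasure_image_le (d := d) (by positivity)
  rw [himg]
  simp only [Measure.euclideanHausdorffMeasure_def, Measure.smul_apply, ENNReal.smul_def,
    smul_eq_mul]
  rw [mul_left_comm]
  rw [ENNReal.rpow_natCast] at key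
  exact mul_le_mul_right key _

/-- By the Lindelöf property countably many of the local neighbourhoods cover `s`; cutting `t` along
their disjointed sequence uses only countable subadditivity of `m₁` and superadditivity of `m₂` on
disjoint pieces. The set functions are kept abstract so that the two inequalities of the area
formula can both use it, with the roles of measure and integral exchanged. -/
theorem le_of_locally_le {X : Type*} [TopologicalSpace X] [SecondCountableTopology X]
    [MeasurableSpace X] [OpensMeasurableSpace X] {s t : Set X} {m₁ m₂ : Set X → ℝ≥0∞}
    (h₀ : m₁ ∅ = 0) (h₁ : ∀ u : ℕ → Set X, m₁ (⋃ n, u n) ≤ ∑' n, m₁ (u n))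
    (h₂ : ∀ u : ℕ → Set X, (∀ n, MeasurableSet (u n)) → (∀ n, u n ⊆ s) →
      Pairwise (Function.onFun Disjoint u) → ∑' n, m₂ (u n) ≤ m₂ (⋃ n, u n))
    (hloc : ∀ x ∈ s, ∃ v : Set X, IsOpen v ∧ x ∈ v ∧ ∀ u, MeasurableSet u → u ⊆ s → u ⊆ v →
      m₁ u ≤ m₂ u)
    (ht : MeasurableSet t) (hts : t ⊆ s) : m₁ t ≤ m₂ t := by
  choose! v hvo hxv hv using hloc
  obtain ⟨c, hcs, hc, hcov⟩ := TopologicalSpace.countable_cover_nhdsWithin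
    (s := s) (f := v) fun x hx => mem_nhdsWithin_of_mem_nhds ((hvo x hx).mem_nhds (hxv x hx))
  rcases c.eq_empty_or_nonempty with rfl | hne
  · have : t = ∅ := by
      apply subset_empty_iff.1
      simpa using hts.trans hcov
    simp [this, h₀]
  · obtain ⟨e, rfl⟩ := hc.exists_eq_range hne
    have hes : ∀ n, e n ∈ s := fun n => hcs (mem_range_self n)
    have hm : ∀ n, MeasurableSet (disjointed (fun n => v (e n)) n) :=
      fun n => MeasurableSet.disjointed (fun n => (hvo _ (hes n)).measurableSet) n
    have htU : t = ⋃ n, t ∩ disjointed (fun n => v (e n)) n := by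
      rw [← inter_iUnion, iUnion_disjointed, eq_comm, inter_eq_left]
      simpa using hts.trans hcov
    calc m₁ t = m₁ (⋃ n, t ∩ disjointed (fun n => v (e n)) n) := by rw [← htU]
      _ ≤ ∑' n, m₁ (t ∩ disjointed (fun n => v (e n)) n) := h₁ _
      _ ≤ ∑' n, m₂ (t ∩ disjointed (fun n => v (e n)) n) :=
        ENNReal.tsum_le_tsum fun n => hv (e n) (hes n) _ (ht.inter (hm n))
          (inter_subset_left.trans hts) (inter_subset_right.trans (disjointed_subset _ n))
      _ ≤ m₂ (⋃ n, t ∩ disjointed (fun n => v (e n)) n) :=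
        h₂ _ (fun n => ht.inter (hm n)) (fun n => inter_subset_left.trans hts)
          fun i j hij => (disjoint_disjointed (fun n => v (e n)) hij).mono
            inter_subset_right inter_subset_right
      _ = m₂ t := by rw [← htU]

section

variable {U V : Type*} [NormedAddCommGroup U] [InnerProductSpace ℝ U] [FiniteDimensional ℝ U]
  [NormedAddCommGroup V] [InnerProductSpace ℝ V]

open Module

/-- `normDet` is the square root of a Gram determinant, which is polynomial in the values of the map
on an orthonormal basis. -/
theorem continuous_normDet :
    Continuous fun f : U →L[ℝ] V => (f : U →ₗ[ℝ] V).normDet := by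
  have h : (fun f : U →L[ℝ] V => (f : U →ₗ[ℝ] V).normDet) = fun f =>
      √((Matrix.gram ℝ (fun i => f (stdOrthonormalBasis ℝ U i))).det) := by
    funext f
    have := (f : U →ₗ[ℝ] V).normDet_sq_eq_det_gram (stdOrthonormalBasis ℝ U)
    simp only [ContinuousLinearMap.coe_coe, RCLike.ofReal_real_eq_id, id_eq] at this
    rw [← this, Real.sqrt_sq (LinearMap.normDet_nonneg _)]
  rw [h]
  refine Real.continuous_sqrt.comp (Continuous.matrix_det ?_)
  refine continuous_matrix fun i j => ?_
  exact ((ContinuousLinearMap.apply ℝ V _).continuous).inner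
    ((ContinuousLinearMap.apply ℝ V _).continuous)

variable [MeasurableSpace U] [BorelSpace U] [MeasurableSpace V] [BorelSpace V]

/-- Near `x` the map distorts distances by at most a factor `C` relative to its linearization `A`,
for which the formula is exact. This costs `C ^ d`; the last factor `C` pays for replacing the
Jacobian at `x` by the Jacobian at nearby points. -/
theorem exists_isOpen_area_le {f : U → V} {f' : U → U →L[ℝ] V} {s : Set U} (hs : IsOpen s)
    (hf : ∀ x ∈ s, HasStrictFDerivAt f (f' x) x) (hcont : ContinuousOn f' s)
    (himm : ∀ x ∈ s, Function.Injective (f' x)) {C : ℝ≥0} (hC : 1 < C) {x : U} (hx : x ∈ s) :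
    ∃ v : Set U, IsOpen v ∧ x ∈ v ∧ ∀ t, MeasurableSet t → t ⊆ s → t ⊆ v →
      (μHE[finrank ℝ U] : Measure V) (f '' t) ≤
        (C : ℝ≥0∞) ^ (finrank ℝ U + 1) * ∫⁻ y in t, ENNReal.ofReal ((f' y : U →ₗ[ℝ] V).normDet) ∧
      ∫⁻ y in t, ENNReal.ofReal ((f' y : U →ₗ[ℝ] V).normDet) ≤
        (C : ℝ≥0∞) ^ (finrank ℝ U + 1) * (μHE[finrank ℝ U] : Measure V) (f '' t) := by
  set A := f' x with hA
  obtain ⟨K, hK, hAK⟩ := (A : U →ₗ[ℝ] V).exists_antilipschitzWith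
    (LinearMap.ker_eq_bot.2 (himm x hx))
  have hCr : (1 : ℝ) < C := by exact_mod_cast hC
  have hKr : (0 : ℝ) < K := by exact_mod_cast hK
  -- With `K` the antilipschitz constant of `A`, the linearization error is at most `δ * K` times
  -- `dist (A y) (A z)`. The bound `δ * K ≤ 1 - 1 / C` yields comparison with constant `C` in both
  -- directions.
  obtain ⟨δ, hδ, hδ1⟩ : ∃ δ : ℝ≥0, 0 < δ ∧ δ * K * C ≤ (C - 1 : ℝ) := by
    refine ⟨⟨(C - 1) / (K * C), by have := sub_pos.2 hCr; positivity⟩, ?_, ?_⟩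
    · have : (0 : ℝ) < (C - 1) / (K * C) := by have := sub_pos.2 hCr; positivity
      exact_mod_cast this
    · change (C - 1 : ℝ) / (K * C) * K * C ≤ C - 1
      apply le_of_eq
      have : (C : ℝ) ≠ 0 := by linarith
      field_simp
  obtain ⟨v₁, hv₁, hap⟩ := (hf x hx).approximates_deriv_on_nhds (c := δ) (Or.inr hδ)
  have hJpos : 0 < (A : U →ₗ[ℝ] V).normDet := by
    refine lt_of_le_of_ne (LinearMap.normDet_nonneg _) (Ne.symm ?_)
    rw [Ne, LinearMap.normDet_eq_zero_iff_ker_ne_bot, not_not]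
    exact LinearMap.ker_eq_bot.2 (himm x hx)
  have hJc : ContinuousAt (fun y => (f' y : U →ₗ[ℝ] V).normDet) x :=
    continuous_normDet.continuousAt.comp (hcont.continuousAt (hs.mem_nhds hx))
  have hv₂ : {y | (f' y : U →ₗ[ℝ] V).normDet < C * (A : U →ₗ[ℝ] V).normDet ∧
      (A : U →ₗ[ℝ] V).normDet < C * (f' y : U →ₗ[ℝ] V).normDet} ∈ 𝓝 x := by
    refine inter_mem (hJc.eventually_lt continuousAt_const ?_)
      (continuousAt_const.eventually_lt (hJc.const_mul _) ?_)
    · exact lt_mul_of_one_lt_left hJpos hCr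
    · exact lt_mul_of_one_lt_left hJpos hCr
  obtain ⟨v, hvsub, hvo, hxv⟩ := mem_nhds_iff.1 (inter_mem hv₁ hv₂)
  refine ⟨v, hvo, hxv, fun t ht hts htv => ?_⟩
  have hAe : ∀ y z, ‖y - z‖ ≤ K * dist (A y) (A z) := fun y z => by
    have := hAK.le_mul_dist y z
    rwa [dist_eq_norm] at this
  have happ : ∀ y ∈ t, ∀ z ∈ t, ‖f y - f z - A (y - z)‖ ≤ δ * K * dist (A y) (A z) := by
    intro y hy z hz
    refine (hap _ (hvsub (htv hy)).1 _ (hvsub (htv hz)).1).trans ?_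
    rw [mul_assoc]
    exact mul_le_mul_of_nonneg_left (hAe y z) δ.2
  have hC0 : (0 : ℝ) < C := by linarith
  have h1 : ∀ y ∈ t, ∀ z ∈ t, dist (f y) (f z) ≤ C * dist (A y) (A z) := by
    intro y hy z hz
    have h := happ y hy z hz
    have h' : dist (f y) (f z) ≤ ‖f y - f z - A (y - z)‖ + dist (A y) (A z) := by
      rw [dist_eq_norm, dist_eq_norm, ← map_sub]
      simpa using norm_add_le (f y - f z - A (y - z)) (A (y - z))
    have hd : (0 : ℝ) ≤ dist (A y) (A z) := dist_nonneg
    have : (δ * K : ℝ) ≤ C - 1 := by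
      have h0 : (0 : ℝ) ≤ δ * K := by positivity
      nlinarith
    nlinarith
  have h2 : ∀ y ∈ t, ∀ z ∈ t, dist (A y) (A z) ≤ C * dist (f y) (f z) := by
    intro y hy z hz
    have h := happ y hy z hz
    have h' : dist (A y) (A z) ≤ ‖f y - f z - A (y - z)‖ + dist (f y) (f z) := by
      rw [dist_eq_norm, dist_eq_norm, ← map_sub, add_comm]
      simpa using norm_sub_le (f y - f z) (f y - f z - A (y - z))
    have hd : (0 : ℝ) ≤ dist (A y) (A z) := dist_nonneg
    have h3 := mul_le_mul_of_nonneg_right hδ1 hd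
    have h4 : C * dist (A y) (A z) ≤ C * (δ * K * dist (A y) (A z) + dist (f y) (f z)) := by
      gcongr
      linarith
    linarith
  have e1 := euclideanHausdorffMeasure_image_le_of_dist_le (finrank ℝ U) h1
  have e2 := euclideanHausdorffMeasure_image_le_of_dist_le (finrank ℝ U) h2
  have e3 : (μHE[finrank ℝ U] : Measure V) (A '' t) =
      ENNReal.ofReal (A : U →ₗ[ℝ] V).normDet * volume t :=
    (A : U →ₗ[ℝ] V).euclideanHausdorffMeasure_image_eq_normDet_mul_volume t
  have i1 : ENNReal.ofReal (A : U →ₗ[ℝ] V).normDet * volume t ≤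
      C * ∫⁻ y in t, ENNReal.ofReal ((f' y : U →ₗ[ℝ] V).normDet) := by
    rw [← setLIntegral_const, ← lintegral_const_mul' _ _ ENNReal.coe_ne_top]
    refine setLIntegral_mono' ht fun y hy => ?_
    rw [← ENNReal.ofReal_coe_nnreal, ← ENNReal.ofReal_mul hC0.le]
    exact ENNReal.ofReal_le_ofReal (hvsub (htv hy)).2.2.le
  have i2 : ∫⁻ y in t, ENNReal.ofReal ((f' y : U →ₗ[ℝ] V).normDet) ≤
      C * (ENNReal.ofReal (A : U →ₗ[ℝ] V).normDet * volume t) := by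
    rw [← mul_assoc, ← setLIntegral_const]
    refine setLIntegral_mono' ht fun y hy => ?_
    rw [← ENNReal.ofReal_coe_nnreal, ← ENNReal.ofReal_mul hC0.le]
    exact ENNReal.ofReal_le_ofReal (hvsub (htv hy)).2.1.le
  constructor
  · calc _ ≤ _ := e1
      _ ≤ (C : ℝ≥0∞) ^ finrank ℝ U * (C * ∫⁻ y in t, ENNReal.ofReal ((f' y : U →ₗ[ℝ] V).normDet)) := by
        rw [e3]; gcongr
      _ = _ := by ring
  · calc _ ≤ _ := i2
      _ ≤ C * ((C : ℝ≥0∞) ^ finrank ℝ U * (μHE[finrank ℝ U] : Measure V) (f '' t)) := by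
        rw [← e3]; gcongr
      _ = _ := by ring

/-- The area formula: the Hausdorff measure of the image of an injective `C¹` immersion. -/
theorem euclideanHausdorffMeasure_image_eq_lintegral_normDet {f : U → V} {f' : U → U →L[ℝ] V}
    {s t : Set U} (hs : IsOpen s) (hf : ∀ x ∈ s, HasStrictFDerivAt f (f' x) x)
    (hcont : ContinuousOn f' s) (himm : ∀ x ∈ s, Function.Injective (f' x)) (hinj : InjOn f s)
    (ht : MeasurableSet t) (hts : t ⊆ s) :
    (μHE[finrank ℝ U] : Measure V) (f '' t) =
      ∫⁻ y in t, ENNReal.ofReal ((f' y : U →ₗ[ℝ] V).normDet) := by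
  have hfc : ContinuousOn f s := fun x hx => (hf x hx).continuousAt.continuousWithinAt
  have hlim : ∀ a : ℝ≥0∞, Tendsto (fun C : ℝ≥0 => (C : ℝ≥0∞) ^ (finrank ℝ U + 1) * a)
      (𝓝[>] 1) (𝓝 a) := by
    intro a
    have h1 : Tendsto (fun C : ℝ≥0 => (C : ℝ≥0∞) ^ (finrank ℝ U + 1)) (𝓝[>] 1) (𝓝 1) := by
      have : Continuous fun C : ℝ≥0 => (C : ℝ≥0∞) ^ (finrank ℝ U + 1) := by
        have := (ENNReal.continuous_pow (finrank ℝ U + 1)).comp ENNReal.continuous_coe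
        exact this
      have h := (this.tendsto 1).mono_left (nhdsWithin_le_nhds (s := Ioi 1))
      simpa using h
    simpa using ENNReal.Tendsto.mul_const h1 (Or.inl one_ne_zero)
  have hdisj : ∀ u : ℕ → Set U, (∀ n, u n ⊆ s) → Pairwise (Function.onFun Disjoint u) →
      Pairwise (Function.onFun Disjoint fun n => f '' u n) := by
    intro u hus hd i j hij
    refine disjoint_image_image fun x hx y hy hxy => ?_
    have := hinj (hus i hx) (hus j hy) hxy
    exact disjoint_left.1 (hd hij) hx (this ▸ hy)
  have hne : (𝓝[>] (1 : ℝ≥0)).NeBot := nhdsGT_neBot 1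
  -- Each inequality holds up to the factor `C ^ (d + 1)` for every `C > 1`; now let `C` decrease to
  -- `1`.
  apply le_antisymm
  · refine ge_of_tendsto (hlim _) ?_
    filter_upwards [self_mem_nhdsWithin] with C hC
    refine le_of_locally_le (s := s) (m₁ := fun t => (μHE[finrank ℝ U] : Measure V) (f '' t))
      (m₂ := fun t => (C : ℝ≥0∞) ^ (finrank ℝ U + 1) *
        ∫⁻ y in t, ENNReal.ofReal ((f' y : U →ₗ[ℝ] V).normDet)) (by simp) ?_ ?_ ?_ ht hts
    · intro u
      simp only [image_iUnion]
      exact measure_iUnion_le _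
    · intro u hu hus hd
      simp only [lintegral_iUnion hu hd, ENNReal.tsum_mul_left, le_refl]
    · intro x hx
      obtain ⟨v, h1, h2, h3⟩ := exists_isOpen_area_le hs hf hcont himm hC hx
      exact ⟨v, h1, h2, fun u hu hus huv => (h3 u hu hus huv).1⟩
  · refine ge_of_tendsto (hlim _) ?_
    filter_upwards [self_mem_nhdsWithin] with C hC
    refine le_of_locally_le (s := s) (m₁ := fun t =>
        ∫⁻ y in t, ENNReal.ofReal ((f' y : U →ₗ[ℝ] V).normDet))
      (m₂ := fun t => (C : ℝ≥0∞) ^ (finrank ℝ U + 1) *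
        (μHE[finrank ℝ U] : Measure V) (f '' t)) (by simp) ?_ ?_ ?_ ht hts
    · intro u
      exact lintegral_iUnion_le _ _
    · intro u hu hus hd
      simp only [image_iUnion]
      rw [measure_iUnion (hdisj u hus hd)
        fun n => (hu n).image_of_continuousOn_injOn (hfc.mono (hus n)) (hinj.mono (hus n)),
        ENNReal.tsum_mul_left]
    · intro x hx
      obtain ⟨v, h1, h2, h3⟩ := exists_isOpen_area_le hs hf hcont himm hC hx
      exact ⟨v, h1, h2, fun u hu hus huv => (h3 u hu hus huv).2⟩

theorem restrict_image_euclideanHausdorffMeasure_eq_map {f : U → V} {f' : U → U →L[ℝ] V}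
    {s : Set U} (hs : IsOpen s) (hf : ∀ x ∈ s, HasStrictFDerivAt f (f' x) x)
    (hcont : ContinuousOn f' s) (himm : ∀ x ∈ s, Function.Injective (f' x)) (hinj : InjOn f s) :
    (μHE[finrank ℝ U] : Measure V).restrict (f '' s) = Measure.map f
      ((volume.restrict s).withDensity fun y => ENNReal.ofReal ((f' y : U →ₗ[ℝ] V).normDet)) := by
  have hfc : ContinuousOn f s := fun x hx => (hf x hx).continuousAt.continuousWithinAt
  have hfm : AEMeasurable f ((volume.restrict s).withDensity
      fun y => ENNReal.ofReal ((f' y : U →ₗ[ℝ] V).normDet)) :=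
    (hfc.aemeasurable hs.measurableSet).mono_ac (withDensity_absolutelyContinuous _ _)
  ext B hB
  rw [Measure.map_apply_of_aemeasurable hfm hB, withDensity_apply', Measure.restrict_restrict'
    hs.measurableSet, Measure.restrict_apply hB, ← euclideanHausdorffMeasure_image_eq_lintegral_normDet
      hs hf hcont himm hinj _ inter_subset_right, inter_comm,
    ← image_inter_preimage, inter_comm]
  rw [inter_comm]
  have h := hs.measurableSet.subtype_image ((continuousOn_iff_continuous_domRestrict.1 hfc).measurable hB)
  convert h using 1
  ext x
  simp [and_comm]

end

end AreaFormula

end CurvVar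

end

noncomputable section

namespace CurvVar

/-! ### The profile of the surface -/

open Set Filter Topology
open scoped RealInnerProductSpace

/-- The primitive of `Φ` vanishing at `0`. -/
def primitive (Φ : ℝ → ℝ) (s : ℝ) : ℝ := ∫ t in (0)..s, Φ t

/-- The `1`-homogeneous function whose graph is the surface. -/
def height (Φ : ℝ → ℝ) (c u v : ℝ) : ℝ := c * u * primitive Φ (v / u)

/-- The first partial derivative of `height`, as a function of the slope `s = v / u`. -/
def slope₁ (Φ : ℝ → ℝ) (c s : ℝ) : ℝ := c * (primitive Φ s - s * Φ s)

/-- The second partial derivative of `height`, as a function of the slope `s = v / u`. -/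
def slope₂ (Φ : ℝ → ℝ) (c s : ℝ) : ℝ := c * Φ s

/-- The area element of the graph. -/
def area (Φ : ℝ → ℝ) (c s : ℝ) : ℝ := √(1 + slope₁ Φ c s ^ 2 + slope₂ Φ c s ^ 2)

/-- The vector `(-∂₁h, -∂₂h, 1)` normal to the graph. -/
def gradNormal (Φ : ℝ → ℝ) (c s : ℝ) : E 3 := !₂[-slope₁ Φ c s, -slope₂ Φ c s, 1]

/-- The unit normal of the graph. -/
def normal (Φ : ℝ → ℝ) (c s : ℝ) : E 3 := (area Φ c s)⁻¹ • gradNormal Φ c s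

/-- The vector `(-s, 1, 0)`: `u` times the gradient of `v / u`. -/
def slopeGrad (s : ℝ) : E 3 := !₂[-s, 1, 0]

/-- The tangential part of `slopeGrad`. -/
def tangGrad (Φ : ℝ → ℝ) (c s : ℝ) : E 3 :=
  slopeGrad s - ⟪normal Φ c s, slopeGrad s⟫ • normal Φ c s

section Profile

variable {Φ : ℝ → ℝ}

theorem inner_E3 (x y : E 3) : ⟪x, y⟫ = x 0 * y 0 + x 1 * y 1 + x 2 * y 2 := by
  simp [PiLp.inner_apply, Fin.sum_univ_three, mul_comm]

theorem IsBump.continuous (hΦ : IsBump Φ) : Continuous Φ := hΦ.smooth.continuous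

theorem IsBump.continuous_deriv (hΦ : IsBump Φ) : Continuous (deriv Φ) :=
  hΦ.smooth.continuous_deriv (by simp)

theorem IsBump.hasDerivAt (hΦ : IsBump Φ) (s : ℝ) : HasDerivAt Φ (deriv Φ s) s :=
  (hΦ.smooth.differentiable (by simp) s).hasDerivAt

theorem IsBump.notMem_tsupport (hΦ : IsBump Φ) {s : ℝ} (hs : 1 ≤ |s|) : s ∉ tsupport Φ := by
  intro h
  have := hΦ.tsupport_subset h
  rcases le_abs'.1 hs with h' | h'
  · linarith [this.1]
  · linarith [this.2]

theorem IsBump.eq_zero (hΦ : IsBump Φ) {s : ℝ} (hs : 1 ≤ |s|) : Φ s = 0 :=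
  image_eq_zero_of_notMem_tsupport (hΦ.notMem_tsupport hs)

theorem IsBump.deriv_eq_zero (hΦ : IsBump Φ) {s : ℝ} (hs : 1 ≤ |s|) : deriv Φ s = 0 :=
  image_eq_zero_of_notMem_tsupport fun h => hΦ.notMem_tsupport hs (tsupport_deriv_subset h)

theorem IsBump.hasDerivAt_primitive (hΦ : IsBump Φ) (s : ℝ) :
    HasDerivAt (primitive Φ) (Φ s) s :=
  intervalIntegral.integral_hasDerivAt_right (hΦ.continuous.intervalIntegrable _ _)
    (hΦ.continuous.stronglyMeasurableAtFilter _ _) hΦ.continuous.continuousAt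

theorem IsBump.continuous_primitive (hΦ : IsBump Φ) : Continuous (primitive Φ) :=
  continuous_iff_continuousAt.2 fun s => (hΦ.hasDerivAt_primitive s).continuousAt

theorem IsBump.primitive_neg (hΦ : IsBump Φ) (s : ℝ) : primitive Φ (-s) = -primitive Φ s := by
  unfold primitive
  have h := intervalIntegral.integral_comp_neg (a := 0) (b := s) Φ
  rw [neg_zero] at h
  rw [intervalIntegral.integral_symm, ← h]
  simp only [hΦ.even]

theorem IsBump.primitive_eq_half (hΦ : IsBump Φ) {s : ℝ} (hs : 1 ≤ s) :
    primitive Φ s = 1 / 2 := by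
  have hsub : Function.support Φ ⊆ Ioc (-s) s := by
    intro t ht
    have := hΦ.tsupport_subset (subset_tsupport _ ht)
    exact ⟨by linarith [this.1], by linarith [this.2]⟩
  have h1 : ∫ t in (-s)..s, Φ t = 1 := by
    rw [intervalIntegral.integral_eq_integral_of_support_subset hsub, hΦ.integral_eq_one]
  have h2 : (∫ t in (-s)..0, Φ t) + ∫ t in (0)..s, Φ t = ∫ t in (-s)..s, Φ t :=
    intervalIntegral.integral_add_adjacent_intervals (hΦ.continuous.intervalIntegrable _ _)
      (hΦ.continuous.intervalIntegrable _ _)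
  have h3 : primitive Φ (-s) = -∫ t in (-s)..0, Φ t := by
    unfold primitive; rw [intervalIntegral.integral_symm]
  have h4 := hΦ.primitive_neg s
  have h5 : primitive Φ s = ∫ t in (0)..s, Φ t := rfl
  linarith

theorem IsBump.primitive_eq_neg_half (hΦ : IsBump Φ) {s : ℝ} (hs : s ≤ -1) :
    primitive Φ s = -(1 / 2) := by
  have := hΦ.primitive_eq_half (s := -s) (by linarith)
  rw [hΦ.primitive_neg] at this
  linarith

theorem IsBump.abs_primitive_le (hΦ : IsBump Φ) (s : ℝ) : |primitive Φ s| ≤ 1 / 2 := by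
  have hmono : Monotone (primitive Φ) :=
    monotone_of_hasDerivAt_nonneg (fun s => hΦ.hasDerivAt_primitive s) (fun s => hΦ.nonneg s)
  rw [abs_le]
  constructor
  · rw [← hΦ.primitive_eq_neg_half (min_le_right s (-1))]
    exact hmono (min_le_left _ _)
  · rw [← hΦ.primitive_eq_half (le_max_right s 1)]
    exact hmono (le_max_left _ _)

/-- Rescaling by `u` and evenness of `Φ` turn the symmetric integral into twice the primitive; this
is the `2` in `c = 2 / √3`. -/
theorem IsBump.g_eq_height (hΦ : IsBump Φ) {u : ℝ} (hu : 0 < u) (v : ℝ) :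
    g Φ u v = height Φ (2 / √3) u v := by
  have h1 : ∫ t in (-v)..v, Φ (t / u) = u * ∫ t in (-v / u)..(v / u), Φ t := by
    rw [intervalIntegral.integral_comp_div Φ hu.ne', smul_eq_mul]
  have h2 : (∫ t in (-v / u)..0, Φ t) + ∫ t in (0)..(v / u), Φ t =
      ∫ t in (-v / u)..(v / u), Φ t :=
    intervalIntegral.integral_add_adjacent_intervals (hΦ.continuous.intervalIntegrable _ _)
      (hΦ.continuous.intervalIntegrable _ _)
  have h3 : primitive Φ (-(v / u)) = -∫ t in (-v / u)..0, Φ t := by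
    unfold primitive; rw [intervalIntegral.integral_symm, neg_div]
  rw [hΦ.primitive_neg] at h3
  have h5 : primitive Φ (v / u) = ∫ t in (0)..(v / u), Φ t := rfl
  rw [g, height, h1, ← h2, ← h5, ← neg_eq_iff_eq_neg.2 h3]
  ring

theorem height_neg (c u v : ℝ) : height Φ (-c) u v = -height Φ c u v := by
  simp [height]

theorem IsBump.height_neg_right (hΦ : IsBump Φ) (c u v : ℝ) :
    height Φ c u (-v) = -height Φ c u v := by
  simp [height, neg_div, hΦ.primitive_neg]

theorem IsBump.hasDerivAt_slope₁ (hΦ : IsBump Φ) (c s : ℝ) :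
    HasDerivAt (slope₁ Φ c) (-s * (c * deriv Φ s)) s := by
  have := ((hΦ.hasDerivAt_primitive s).sub ((hasDerivAt_id' s).mul (hΦ.hasDerivAt s))).const_mul c
  refine this.congr_deriv ?_
  ring

theorem IsBump.hasDerivAt_slope₂ (hΦ : IsBump Φ) (c s : ℝ) :
    HasDerivAt (slope₂ Φ c) (c * deriv Φ s) s :=
  (hΦ.hasDerivAt s).const_mul c

theorem area_sq (c s : ℝ) : area Φ c s ^ 2 = 1 + slope₁ Φ c s ^ 2 + slope₂ Φ c s ^ 2 :=
  Real.sq_sqrt (by positivity)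

theorem one_le_area (c s : ℝ) : 1 ≤ area Φ c s :=
  Real.one_le_sqrt.2 (by nlinarith [sq_nonneg (slope₁ Φ c s), sq_nonneg (slope₂ Φ c s)])

theorem area_pos (c s : ℝ) : 0 < area Φ c s := zero_lt_one.trans_le (one_le_area c s)

theorem area_smul_normal (c s : ℝ) : area Φ c s • normal Φ c s = gradNormal Φ c s := by
  rw [normal, smul_inv_smul₀ (area_pos c s).ne']

theorem norm_normal (c s : ℝ) : ‖normal Φ c s‖ = 1 := by
  have h : ⟪gradNormal Φ c s, gradNormal Φ c s⟫ = area Φ c s ^ 2 := by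
    rw [inner_E3, area_sq]
    simp [gradNormal]
    ring
  have h2 : ‖gradNormal Φ c s‖ = area Φ c s := by
    rw [real_inner_self_eq_norm_sq] at h
    exact (pow_left_inj₀ (norm_nonneg _) (area_pos c s).le two_ne_zero).1 h
  rw [normal, norm_smul, h2, Real.norm_of_nonneg (inv_nonneg.2 (area_pos c s).le),
    inv_mul_cancel₀ (area_pos c s).ne']

/-- The Hessian of a 1-homogeneous function of two variables has rank one: the terms with `Φ` cancel
in the derivative of `slope₁`, and what remains is proportional to `(-s, 1)`. -/
theorem IsBump.hasDerivAt_gradNormal (hΦ : IsBump Φ) (c s : ℝ) :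
    HasDerivAt (gradNormal Φ c) (-(c * deriv Φ s) • slopeGrad s) s := by
  have h : HasDerivAt (fun s => ![-slope₁ Φ c s, -slope₂ Φ c s, 1])
      ![s * (c * deriv Φ s), -(c * deriv Φ s), 0] s := by
    rw [hasDerivAt_pi]
    intro i
    fin_cases i
    · exact (hΦ.hasDerivAt_slope₁ c s).neg.congr_deriv (by simp)
    · exact (hΦ.hasDerivAt_slope₂ c s).neg
    · exact hasDerivAt_const _ _
  have h2 := ((PiLp.continuousLinearEquiv 2 ℝ (fun _ : Fin 3 => ℝ)).symm :
    (Fin 3 → ℝ) →L[ℝ] E 3).hasFDerivAt.comp_hasDerivAt s h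
  refine h2.congr_deriv ?_
  ext i
  fin_cases i <;> simp [slopeGrad, mul_comm]

theorem IsBump.hasDerivAt_area (hΦ : IsBump Φ) (c s : ℝ) :
    HasDerivAt (area Φ c) (-(c * deriv Φ s) * ⟪normal Φ c s, slopeGrad s⟫) s := by
  have hne : 1 + slope₁ Φ c s ^ 2 + slope₂ Φ c s ^ 2 ≠ 0 := by positivity
  have h := ((((hΦ.hasDerivAt_slope₁ c s).pow 2).const_add 1).add
    ((hΦ.hasDerivAt_slope₂ c s).pow 2)).sqrt hne
  refine h.congr_deriv ?_
  have e : √(1 + slope₁ Φ c s ^ 2 + slope₂ Φ c s ^ 2) = area Φ c s := rfl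
  have hpos := (area_pos (Φ := Φ) c s).ne'
  simp only [Pi.add_apply, Pi.pow_apply] at *
  rw [e, normal, inner_smul_left, inner_E3]
  simp [gradNormal, slopeGrad]
  field_simp
  ring

theorem inner_normal_tangGrad (c s : ℝ) : ⟪normal Φ c s, tangGrad Φ c s⟫ = 0 := by
  rw [tangGrad, inner_sub_right, inner_smul_right, real_inner_self_eq_norm_sq, norm_normal]
  ring

/-- Differentiating the normalization subtracts the normal component of the derivative, so
`slopeGrad` is replaced by its tangential part. -/
theorem IsBump.hasDerivAt_normal (hΦ : IsBump Φ) (c s : ℝ) :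
    HasDerivAt (normal Φ c) (-(c * deriv Φ s / area Φ c s) • tangGrad Φ c s) s := by
  have hpos := (area_pos (Φ := Φ) c s).ne'
  have h := ((hΦ.hasDerivAt_area c s).inv hpos).smul (hΦ.hasDerivAt_gradNormal c s)
  refine h.congr_deriv ?_
  simp only [Pi.inv_apply]
  rw [← area_smul_normal, tangGrad]
  match_scalars <;> field_simp

end Profile

end CurvVar

end

noncomputable section

namespace CurvVar

open Set Filter Topology
open scoped RealInnerProductSpace

/-! ### Tangent planes -/

/-- The plane with unit normal `Q ν`, where `ν` is the normal of the graph at slope `s`. -/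
def normalPlane (Q : E 3 ≃ₗᵢ[ℝ] E 3) (Φ : ℝ → ℝ) (c s : ℝ) : Gr 3 2 :=
  ⟨(ℝ ∙ Q (normal Φ c s))ᗮ, by
    have : Fact (Module.finrank ℝ (E 3) = 2 + 1) := ⟨by simp⟩
    refine Submodule.finrank_orthogonal_span_singleton fun h => ?_
    have h1 : ‖Q (normal Φ c s)‖ = 1 := by rw [Q.norm_map, norm_normal]
    rw [h, norm_zero] at h1
    exact zero_ne_one h1⟩

/-- The graph of `height` over the half-plane `{x₁ > 0}`. -/
def graphSet (Φ : ℝ → ℝ) (c : ℝ) : Set (E 3) := {x | 0 < x 0 ∧ x 2 = height Φ c (x 0) (x 1)}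

/-- The graph parametrization. -/
def graphMap (Φ : ℝ → ℝ) (c : ℝ) (z : ℝ × ℝ) : E 3 := !₂[z.1, z.2, height Φ c z.1 z.2]

theorem tangentPlane_eq_of_span {n m : ℕ} [Nonempty (Gr n m)] {R : Set (E n)} {x : E n}
    {P : Gr n m} (h : Submodule.span ℝ (tangentConeAt ℝ R x) = P.plane) :
    tangentPlane m R x = P := by
  have hd : Module.finrank ℝ (Submodule.span ℝ (tangentConeAt ℝ R x)) = m := by
    rw [h]; exact P.finrank_plane
  rw [tangentPlane, dif_pos hd]
  exact Gr.ext h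

theorem mem_tangentConeAt_of_hasDerivAt {F : Type*} [NormedAddCommGroup F] [NormedSpace ℝ F]
    {R : Set F} {x w : F} {γ : ℝ → F} (hγ : HasDerivAt γ w 0) (h0 : γ 0 = x)
    (hR : ∀ᶠ t in 𝓝[>] 0, γ t ∈ R) : w ∈ tangentConeAt ℝ R x := by
  have hne : (𝓝[>] (0 : ℝ)).NeBot := nhdsGT_neBot 0
  refine mem_tangentConeAt_of_seq (𝓝[>] (0 : ℝ)) (fun t => t⁻¹) (fun t => γ t - x) ?_ ?_ ?_
  · have := (hγ.continuousAt.tendsto.sub_const x).mono_left (nhdsWithin_le_nhds (s := Ioi 0))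
    rwa [h0, sub_self] at this
  · filter_upwards [hR] with t ht
    simpa using ht
  · have := (hasDerivAt_iff_tendsto_slope.1 hγ).mono_left
      (nhdsWithin_mono 0 (fun t (ht : 0 < t) => ht.ne' : Ioi (0 : ℝ) ⊆ {0}ᶜ))
    refine this.congr fun t => ?_
    simp [slope, h0]

/-- Within `R` the function has both `G'` and `0` as derivatives, and derivatives within a set agree
on its tangent cone. -/
theorem apply_eq_zero_of_mem_tangentConeAt {F : Type*} [NormedAddCommGroup F] [NormedSpace ℝ F]
    {R : Set F} {x w : F} {G : F → ℝ} {G' : F →L[ℝ] ℝ} (hG : HasFDerivAt G G' x)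
    (hR : ∀ᶠ y in 𝓝[R] x, G y = 0) (hx : G x = 0) (hw : w ∈ tangentConeAt ℝ R x) : G' w = 0 := by
  have h1 : HasFDerivWithinAt G (0 : F →L[ℝ] ℝ) R x :=
    (hasFDerivWithinAt_const (0 : ℝ) x R).congr_of_eventuallyEq hR hx
  exact hG.hasFDerivWithinAt.unique_on h1 hw

section Planes

variable {Φ : ℝ → ℝ} (Q : E 3 ≃ₗᵢ[ℝ] E 3)

theorem mem_normalPlane_iff {c s : ℝ} {x : E 3} :
    x ∈ (normalPlane Q Φ c s).plane ↔
      Q.symm x 2 = slope₁ Φ c s * Q.symm x 0 + slope₂ Φ c s * Q.symm x 1 := by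
  have hx : x = Q (Q.symm x) := by simp
  rw [normalPlane, Submodule.mem_orthogonal_singleton_iff_inner_right]
  conv_lhs => rw [hx]
  rw [Q.inner_map_map, normal, inner_smul_left, inner_E3]
  have := (area_pos (Φ := Φ) c s).ne'
  simp only [gradNormal, RCLike.conj_to_real, mul_eq_zero, inv_eq_zero, this, false_or]
  simp
  constructor <;> intro h <;> linarith

theorem normalPlane_plane_eq_span {c s : ℝ} {W : Submodule ℝ (E 3)}
    (h0 : ∀ w ∈ W, Q.symm w 2 = slope₁ Φ c s * Q.symm w 0 + slope₂ Φ c s * Q.symm w 1)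
    (h1 : Q !₂[1, 0, slope₁ Φ c s] ∈ W) (h2 : Q !₂[0, 1, slope₂ Φ c s] ∈ W) :
    W = (normalPlane Q Φ c s).plane := by
  refine le_antisymm (fun w hw => (mem_normalPlane_iff Q).2 (h0 w hw)) fun w hw => ?_
  have h := (mem_normalPlane_iff Q).1 hw
  have : w = Q.symm w 0 • Q !₂[1, 0, slope₁ Φ c s] + Q.symm w 1 • Q !₂[0, 1, slope₂ Φ c s] := by
    apply Q.symm.injective
    rw [map_add, map_smul, map_smul, Q.symm_apply_apply, Q.symm_apply_apply]
    ext i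
    fin_cases i
    · simp
    · simp
    · simp [h, mul_comm]
  rw [this]
  exact W.add_mem (W.smul_mem _ h1) (W.smul_mem _ h2)

theorem normalPlane_starProjection (c s : ℝ) (w : E 3) :
    (normalPlane Q Φ c s).plane.starProjection w =
      w - ⟪Q (normal Φ c s), w⟫ • Q (normal Φ c s) := by
  have h : ‖Q (normal Φ c s)‖ = 1 := by rw [Q.norm_map, norm_normal]
  rw [normalPlane, Submodule.starProjection_orthogonal_val,
    Submodule.starProjection_unit_singleton ℝ h]

theorem inner_stdVec (x : E 3) (i : Fin 3) : ⟪x, stdVec i⟫ = x i := by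
  simp [stdVec, EuclideanSpace.inner_single_right]

theorem normalPlane_matrix (c s : ℝ) (j k : Fin 3) :
    (normalPlane Q Φ c s).matrix j k =
      (if j = k then 1 else 0) - Q (normal Φ c s) j * Q (normal Φ c s) k := by
  rw [Gr.matrix, normalPlane_starProjection, inner_stdVec]
  simp [stdVec, mul_comm]

/-- Stated along arbitrary `a` and `b` so that it serves curves in the graph, the planar
parametrization and ambient functions on `ℝ³` alike. -/
theorem IsBump.hasFDerivAt_height (hΦ : IsBump Φ) (c : ℝ) {F : Type*} [NormedAddCommGroup F]
    [NormedSpace ℝ F] {a b : F → ℝ} {a' b' : F →L[ℝ] ℝ} {x : F} (ha : HasFDerivAt a a' x)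
    (hb : HasFDerivAt b b' x) (hx : a x ≠ 0) :
    HasFDerivAt (fun x => height Φ c (a x) (b x))
      (slope₁ Φ c (b x / a x) • a' + slope₂ Φ c (b x / a x) • b') x := by
  have h1 := (hb.mul ((hasDerivAt_inv hx).comp_hasFDerivAt x ha))
  have h2 := (hΦ.hasDerivAt_primitive (b x / a x)).comp_hasFDerivAt_of_eq x h1 (by simp [div_eq_mul_inv])
  have h3 := (ha.const_mul c).mul h2
  have h4 : HasFDerivAt (fun x => height Φ c (a x) (b x)) _ x := h3
  refine h4.congr_fderiv ?_
  ext v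
  simp [slope₁, slope₂, div_eq_mul_inv]
  field_simp
  ring

/-- Curves in the graph above straight lines give every vector of the plane; conversely the defining
function of the graph is constant on it, so its derivative kills the tangent cone. -/
theorem IsBump.span_tangentConeAt_graph (hΦ : IsBump Φ) (c : ℝ) {u : ℝ} (hu : 0 < u) (v : ℝ) :
    Submodule.span ℝ (tangentConeAt ℝ (Q '' graphSet Φ c) (Q (graphMap Φ c (u, v)))) =
      (normalPlane Q Φ c (v / u)).plane := by
  have hmem : ∀ {u v : ℝ}, 0 < u → Q (graphMap Φ c (u, v)) ∈ Q '' graphSet Φ c := by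
    intro u v hu
    exact mem_image_of_mem Q ⟨by simpa [graphMap] using hu, by simp [graphMap]⟩
  have hcurve : ∀ a b : ℝ, Q !₂[a, b, slope₁ Φ c (v / u) * a + slope₂ Φ c (v / u) * b] ∈
      tangentConeAt ℝ (Q '' graphSet Φ c) (Q (graphMap Φ c (u, v))) := by
    intro a b
    refine mem_tangentConeAt_of_hasDerivAt
      (γ := fun t : ℝ => Q (graphMap Φ c (u + t * a, v + t * b))) ?_ (by simp) ?_
    · have ha : HasDerivAt (fun t : ℝ => u + t * a) a 0 := by
        simpa using ((hasDerivAt_id' (0 : ℝ)).mul_const a).const_add u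
      have hb : HasDerivAt (fun t : ℝ => v + t * b) b 0 := by
        simpa using ((hasDerivAt_id' (0 : ℝ)).mul_const b).const_add v
      have hh := (hΦ.hasFDerivAt_height c ha.hasFDerivAt hb.hasFDerivAt (by simpa using hu.ne')).hasDerivAt
      have h3 : HasDerivAt (fun t : ℝ => ![u + t * a, v + t * b, height Φ c (u + t * a) (v + t * b)])
          ![a, b, slope₁ Φ c (v / u) * a + slope₂ Φ c (v / u) * b] 0 := by
        rw [hasDerivAt_pi]
        intro i
        fin_cases i
        · exact ha
        · exact hb
        · exact hh.congr_deriv (by simp)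
      have h4 := ((PiLp.continuousLinearEquiv 2 ℝ (fun _ : Fin 3 => ℝ)).symm :
        (Fin 3 → ℝ) →L[ℝ] E 3).hasFDerivAt.comp_hasDerivAt (0 : ℝ) h3
      exact ((Q : E 3 →L[ℝ] E 3).hasFDerivAt.comp_hasDerivAt (0 : ℝ) h4)
    · have : Tendsto (fun t : ℝ => u + t * a) (𝓝[>] 0) (𝓝 (u + 0 * a)) :=
        ((continuous_const.add (continuous_id.mul continuous_const)).tendsto 0).mono_left
          nhdsWithin_le_nhds
      filter_upwards [this.eventually (lt_mem_nhds (by simpa using hu))] with t ht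
      exact hmem ht
  refine normalPlane_plane_eq_span Q ?_ ?_ ?_
  · suffices h : Submodule.span ℝ (tangentConeAt ℝ (Q '' graphSet Φ c) (Q (graphMap Φ c (u, v)))) ≤
        (normalPlane Q Φ c (v / u)).plane from fun w hw => (mem_normalPlane_iff Q).1 (h hw)
    refine Submodule.span_le.2 fun w hw => (mem_normalPlane_iff Q).2 ?_
    have hx : ∀ i : Fin 3, HasFDerivAt (fun x : E 3 => Q.symm x i)
        ((EuclideanSpace.proj i : E 3 →L[ℝ] ℝ).comp (Q.symm : E 3 →L[ℝ] E 3))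
        (Q (graphMap Φ c (u, v))) :=
      fun i => ((EuclideanSpace.proj i : E 3 →L[ℝ] ℝ).comp (Q.symm : E 3 →L[ℝ] E 3)).hasFDerivAt
    have hG := (hx 2).sub (hΦ.hasFDerivAt_height c (hx 0) (hx 1) (by simpa [graphMap] using hu.ne'))
    have := apply_eq_zero_of_mem_tangentConeAt hG ?_ ?_ hw
    · simp [graphMap] at this
      linarith
    · filter_upwards [self_mem_nhdsWithin] with y hy
      obtain ⟨z, hz, rfl⟩ := hy
      simp [hz.2]
    · simp [graphMap]
  · simpa using Submodule.subset_span (hcurve 1 0)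
  · simpa using Submodule.subset_span (hcurve 0 1)

theorem IsBump.tangentPlane_graph (hΦ : IsBump Φ) (c : ℝ) {u : ℝ} (hu : 0 < u) (v : ℝ) :
    tangentPlane 2 (Q '' graphSet Φ c) (Q (graphMap Φ c (u, v))) =
      normalPlane Q Φ c (v / u) :=
  tangentPlane_eq_of_span (hΦ.span_tangentConeAt_graph Q c hu v)

/-- The sign `s` selects one of the flat wings `u ≤ s * v`, where the primitive has reached its
extreme value `s / 2`. The lemmas that follow record that all geometric quantities are constant
there. -/
theorem IsBump.height_of_le (hΦ : IsBump Φ) (c : ℝ) {s u v : ℝ} (hs : s = 1 ∨ s = -1)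
    (hu : 0 < u) (huv : u ≤ s * v) : height Φ c u v = c * (s / 2) * u := by
  rcases hs with rfl | rfl
  · rw [height, hΦ.primitive_eq_half ((one_le_div hu).2 (by linarith))]; ring
  · rw [height, hΦ.primitive_eq_neg_half ((div_le_iff₀ hu).2 (by linarith))]; ring

theorem IsBump.slope₁_of_le (hΦ : IsBump Φ) (c : ℝ) {s t : ℝ} (hs : s = 1 ∨ s = -1)
    (ht : 1 ≤ s * t) : slope₁ Φ c t = c * (s / 2) := by
  rcases hs with rfl | rfl
  · rw [slope₁, hΦ.primitive_eq_half (by linarith), hΦ.eq_zero (le_abs'.2 (Or.inr (by linarith)))]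
    ring
  · rw [slope₁, hΦ.primitive_eq_neg_half (by linarith),
      hΦ.eq_zero (le_abs'.2 (Or.inl (by linarith)))]
    ring

theorem IsBump.slope₂_of_le (hΦ : IsBump Φ) (c : ℝ) {s t : ℝ} (hs : s = 1 ∨ s = -1)
    (ht : 1 ≤ s * t) : slope₂ Φ c t = 0 := by
  have : 1 ≤ |t| := by
    rcases hs with rfl | rfl
    · exact le_abs'.2 (Or.inr (by linarith))
    · exact le_abs'.2 (Or.inl (by linarith))
  rw [slope₂, hΦ.eq_zero this, mul_zero]

theorem IsBump.normal_of_le (hΦ : IsBump Φ) (c : ℝ) {s t : ℝ} (hs : s = 1 ∨ s = -1)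
    (ht : 1 ≤ s * t) : normal Φ c t = normal Φ c s := by
  have h1 : 1 ≤ s * s := by rcases hs with rfl | rfl <;> norm_num
  simp only [normal, gradNormal, area, hΦ.slope₁_of_le c hs ht, hΦ.slope₁_of_le c hs h1,
    hΦ.slope₂_of_le c hs ht, hΦ.slope₂_of_le c hs h1]

/-- Near a point of `L^±` the graph lies in a flat wing. There the tangent cone lies in a plane and
contains inward directions, and `tangentPlane` takes its linear span. -/
theorem IsBump.tangentPlane_axis (hΦ : IsBump Φ) (c : ℝ) {s v : ℝ} (hs : s = 1 ∨ s = -1)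
    (hv : 0 < s * v) :
    tangentPlane 2 (Q '' graphSet Φ c) (Q !₂[0, v, 0]) = normalPlane Q Φ c s := by
  apply tangentPlane_eq_of_span
  have h1 : 1 ≤ s * s := by rcases hs with rfl | rfl <;> norm_num
  have hcurve : ∀ b : ℝ, Q !₂[1, b, slope₁ Φ c s] ∈
      tangentConeAt ℝ (Q '' graphSet Φ c) (Q !₂[0, v, 0]) := by
    intro b
    refine mem_tangentConeAt_of_hasDerivAt
      (γ := fun t : ℝ => Q !₂[0, v, 0] + t • Q !₂[1, b, slope₁ Φ c s]) ?_ (by simp) ?_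
    · simpa using ((hasDerivAt_id' (0 : ℝ)).smul_const (Q !₂[1, b, slope₁ Φ c s])).const_add
        (Q !₂[0, v, 0])
    · have : Tendsto (fun t : ℝ => s * (v + t * b) - t) (𝓝[>] 0) (𝓝 (s * (v + 0 * b) - 0)) :=
        (Continuous.tendsto (by fun_prop) 0).mono_left nhdsWithin_le_nhds
      filter_upwards [self_mem_nhdsWithin, this.eventually (lt_mem_nhds (by simpa using hv))]
        with t ht hts
      refine ⟨!₂[t, v + t * b, height Φ c t (v + t * b)], ⟨by simpa using ht, by simp⟩, ?_⟩
      rw [← map_smul, ← map_add, hΦ.height_of_le c hs ht (by linarith), hΦ.slope₁_of_le c hs h1]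
      congr 1
      ext i
      fin_cases i <;> simp [mul_comm]
  refine normalPlane_plane_eq_span Q ?_ ?_ ?_
  · suffices h : Submodule.span ℝ (tangentConeAt ℝ (Q '' graphSet Φ c) (Q !₂[0, v, 0])) ≤
        (normalPlane Q Φ c s).plane from fun w hw => (mem_normalPlane_iff Q).1 (h hw)
    refine Submodule.span_le.2 fun w hw => (mem_normalPlane_iff Q).2 ?_
    let p : Fin 3 → E 3 →L[ℝ] ℝ := fun i =>
      (EuclideanSpace.proj i : E 3 →L[ℝ] ℝ).comp (Q.symm : E 3 →L[ℝ] E 3)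
    have hp : ∀ i x, p i x = Q.symm x i := fun i x => rfl
    have hG : HasFDerivAt (fun x => (p 2 - slope₁ Φ c s • p 0) x) (p 2 - slope₁ Φ c s • p 0)
      (Q !₂[0, v, 0]) := ContinuousLinearMap.hasFDerivAt _
    have := apply_eq_zero_of_mem_tangentConeAt hG ?_ ?_ hw
    · simp [hp] at this
      rw [hΦ.slope₂_of_le c hs h1]
      linarith
    · have hlt : Tendsto (fun x => s * p 1 x - p 0 x) (𝓝[Q '' graphSet Φ c] (Q !₂[0, v, 0]))
          (𝓝 (s * p 1 (Q !₂[0, v, 0]) - p 0 (Q !₂[0, v, 0]))) :=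
        (Continuous.tendsto (by fun_prop) _).mono_left nhdsWithin_le_nhds
      filter_upwards [self_mem_nhdsWithin, hlt.eventually (lt_mem_nhds (by simpa [hp] using hv))]
        with y hy hy2
      obtain ⟨z, hz, rfl⟩ := hy
      simp only [hp, Q.symm_apply_apply] at hy2
      simp [hp, hz.2]
      rw [hΦ.height_of_le c hs hz.1 (by linarith), hΦ.slope₁_of_le c hs h1]
      ring
    · simp [hp]
  · exact Submodule.subset_span (hcurve 0)
  -- The direction of the axis is the difference of the two inward directions with `b = 1` and `b =
  -- 0`.
  · have := Submodule.sub_mem _ (Submodule.subset_span (R := ℝ) (hcurve 1))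
      (Submodule.subset_span (hcurve 0))
    convert this using 1
    rw [← map_sub, hΦ.slope₂_of_le c hs h1]
    congr 1
    ext i
    fin_cases i <;> simp

end Planes

end CurvVar

end

noncomputable section

namespace CurvVar

open Set Filter Topology
open scoped RealInnerProductSpace ENNReal

/-! ### The varifold induced by the graph as a planar pushforward -/

/-- The half-plane over which the graph is parametrized. -/
def halfPlane : Set (ℝ × ℝ) := Ioi 0 ×ˢ univ

/-- The area measure of the graph on the half-plane. -/
def graphMeasure (Φ : ℝ → ℝ) (c : ℝ) : Measure (ℝ × ℝ) :=
  (volume.restrict halfPlane).withDensity fun z => ENNReal.ofReal (area Φ c (z.2 / z.1))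

/-- The parametrization of the induced varifold in the Grassmann bundle. -/
def bundleParam (Q : E 3 ≃ₗᵢ[ℝ] E 3) (Φ : ℝ → ℝ) (c : ℝ) (z : ℝ × ℝ) : GrBundle 3 2 :=
  (Q (graphMap Φ c z), normalPlane Q Φ c (z.2 / z.1))

section

variable {Φ : ℝ → ℝ} (Q : E 3 ≃ₗᵢ[ℝ] E 3)

theorem IsBump.continuous_slope₁ (hΦ : IsBump Φ) (c : ℝ) : Continuous (slope₁ Φ c) :=
  continuous_iff_continuousAt.2 fun s => (hΦ.hasDerivAt_slope₁ c s).continuousAt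

theorem IsBump.continuous_slope₂ (hΦ : IsBump Φ) (c : ℝ) : Continuous (slope₂ Φ c) :=
  continuous_iff_continuousAt.2 fun s => (hΦ.hasDerivAt_slope₂ c s).continuousAt

theorem IsBump.continuous_area (hΦ : IsBump Φ) (c : ℝ) : Continuous (area Φ c) :=
  continuous_iff_continuousAt.2 fun s => (hΦ.hasDerivAt_area c s).continuousAt

theorem IsBump.continuous_normal (hΦ : IsBump Φ) (c : ℝ) : Continuous (normal Φ c) :=
  continuous_iff_continuousAt.2 fun s => (hΦ.hasDerivAt_normal c s).continuousAt

theorem continuous_matrix_gr {n m : ℕ} : Continuous (Gr.matrix : Gr n m → Mat n) :=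
  continuous_induced_dom

theorem IsBump.continuous_normalPlane (hΦ : IsBump Φ) (c : ℝ) :
    Continuous (normalPlane Q Φ c) := by
  refine continuous_induced_rng.2 (continuous_pi fun j => continuous_pi fun k => ?_)
  simp only [Function.comp_apply, normalPlane_matrix]
  have h : ∀ i : Fin 3, Continuous fun s => Q (normal Φ c s) i := fun i =>
    ((EuclideanSpace.proj i : E 3 →L[ℝ] ℝ).continuous.comp Q.continuous).comp
      (hΦ.continuous_normal c)
  exact continuous_const.sub ((h j).mul (h k))

theorem IsBump.measurable_height (hΦ : IsBump Φ) (c : ℝ) :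
    Measurable fun z : ℝ × ℝ => height Φ c z.1 z.2 :=
  (measurable_fst.const_mul c).mul
    (hΦ.continuous_primitive.measurable.comp (measurable_snd.div measurable_fst))

theorem graphMap_eq (c : ℝ) (z : ℝ × ℝ) : graphMap Φ c z =
    z.1 • stdVec 0 + z.2 • stdVec 1 + height Φ c z.1 z.2 • stdVec 2 := by
  ext i
  fin_cases i <;> simp [graphMap, stdVec]

theorem IsBump.measurable_graphMap (hΦ : IsBump Φ) (c : ℝ) : Measurable (graphMap Φ c) := by
  have : graphMap Φ c = fun z : ℝ × ℝ =>
    z.1 • stdVec 0 + z.2 • stdVec 1 + height Φ c z.1 z.2 • (stdVec 2 : E 3) := by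
    funext z; exact graphMap_eq c z
  rw [this]
  exact ((measurable_fst.smul_const _).add (measurable_snd.smul_const _)).add
    ((hΦ.measurable_height c).smul_const _)

theorem IsBump.measurable_bundleParam (hΦ : IsBump Φ) (c : ℝ) :
    Measurable (bundleParam Q Φ c) :=
  (Q.continuous.measurable.comp (hΦ.measurable_graphMap c)).prodMk
    ((hΦ.continuous_normalPlane Q c).measurable.comp (measurable_snd.div measurable_fst))

theorem IsBump.measurableSet_graphSet (hΦ : IsBump Φ) (c : ℝ) :
    MeasurableSet (Q '' graphSet Φ c) := by
  have hc : ∀ i : Fin 3, Measurable fun x : E 3 => Q.symm x i := fun i =>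
    ((EuclideanSpace.proj i : E 3 →L[ℝ] ℝ).continuous.comp Q.symm.continuous).measurable
  have : Q '' graphSet Φ c =
      {x | 0 < Q.symm x 0} ∩ {x | Q.symm x 2 = height Φ c (Q.symm x 0) (Q.symm x 1)} := by
    ext x
    constructor
    · rintro ⟨w, hw, rfl⟩
      simpa [graphSet] using hw
    · exact fun hx => ⟨Q.symm x, hx, by simp⟩
  rw [this]
  exact (measurableSet_lt measurable_const (hc 0)).inter (measurableSet_eq_fun (hc 2)
    ((hΦ.measurable_height c).comp ((hc 0).prodMk (hc 1))))

/-! ### The parametrization of the graph and its Jacobian -/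

/-- The derivative of the graph parametrization of the rotated surface. -/
def graphDeriv (Φ : ℝ → ℝ) (c s : ℝ) : E 2 →L[ℝ] E 3 :=
  (EuclideanSpace.proj 0 : E 2 →L[ℝ] ℝ).smulRight (Q !₂[1, 0, slope₁ Φ c s]) +
    (EuclideanSpace.proj 1 : E 2 →L[ℝ] ℝ).smulRight (Q !₂[0, 1, slope₂ Φ c s])

theorem graphDeriv_apply (c s : ℝ) (y : E 2) : graphDeriv Q Φ c s y =
    Q !₂[y 0, y 1, slope₁ Φ c s * y 0 + slope₂ Φ c s * y 1] := by
  simp only [graphDeriv, add_apply, ContinuousLinearMap.smulRight_apply]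
  rw [← map_smul, ← map_smul, ← map_add]
  refine congrArg Q ?_
  ext i
  fin_cases i <;> simp [mul_comm]

theorem vec3_eq (a b t : ℝ) : (!₂[a, b, t] : E 3) = a • stdVec 0 + b • stdVec 1 + t • stdVec 2 := by
  ext i
  fin_cases i <;> simp [stdVec]

theorem IsBump.continuous_graphDeriv (hΦ : IsBump Φ) (c : ℝ) :
    Continuous (graphDeriv Q Φ c) := by
  have h1 := hΦ.continuous_slope₁ c
  have h2 := hΦ.continuous_slope₂ c
  have hv : ∀ (a b : ℝ) {f : ℝ → ℝ}, Continuous f → Continuous fun s => Q !₂[a, b, f s] := by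
    intro a b f hf
    simp only [vec3_eq]
    exact Q.continuous.comp (continuous_const.add (hf.smul continuous_const))
  exact ((ContinuousLinearMap.smulRightL ℝ (E 2) (E 3) _).continuous.comp (hv _ _ h1)).add
    ((ContinuousLinearMap.smulRightL ℝ (E 2) (E 3) _).continuous.comp (hv _ _ h2))

/-- The isometry drops out of the Gram matrix, and `(1 + p²)(1 + q²) - (pq)² = 1 + p² + q²` for the
two slopes `p`, `q`. -/
theorem normDet_graphDeriv (c s : ℝ) :
    (graphDeriv Q Φ c s : E 2 →ₗ[ℝ] E 3).normDet = area Φ c s := by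
  have h := (graphDeriv Q Φ c s : E 2 →ₗ[ℝ] E 3).normDet_sq_eq_det_gram
    (EuclideanSpace.basisFun (Fin 2) ℝ)
  simp only [RCLike.ofReal_real_eq_id, id_eq, Matrix.det_fin_two, Matrix.gram_apply,
    ContinuousLinearMap.coe_coe, graphDeriv_apply, Q.inner_map_map, inner_E3] at h
  refine (pow_left_inj₀ (LinearMap.normDet_nonneg _) (area_pos c s).le two_ne_zero).1 ?_
  rw [h, area_sq]
  simp
  ring

theorem IsBump.hasFDerivAt_graph (hΦ : IsBump Φ) (c : ℝ) {y : E 2} (hy : y 0 ≠ 0) :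
    HasFDerivAt (fun y : E 2 => Q (graphMap Φ c (y 0, y 1))) (graphDeriv Q Φ c (y 1 / y 0)) y := by
  have hp : ∀ i : Fin 2, HasFDerivAt (fun y : E 2 => y i) (EuclideanSpace.proj i : E 2 →L[ℝ] ℝ) y :=
    fun i => (EuclideanSpace.proj i : E 2 →L[ℝ] ℝ).hasFDerivAt
  have h := (((hp 0).smul_const (stdVec 0 : E 3)).add ((hp 1).smul_const (stdVec 1 : E 3))).add
    ((hΦ.hasFDerivAt_height c (hp 0) (hp 1) hy).smul_const (stdVec 2 : E 3))
  have h2 := (Q : E 3 →L[ℝ] E 3).hasFDerivAt.comp y h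
  refine (h2.congr_fderiv ?_).congr_of_eventuallyEq (Eventually.of_forall fun y => ?_)
  · ext1 w
    rw [graphDeriv_apply, vec3_eq]
    simp
  · simp [graphMap_eq]

theorem measurePreserving_coords :
    MeasurePreserving (fun y : E 2 => ((y 0, y 1) : ℝ × ℝ)) volume volume :=
  (volume_preserving_finTwoArrow ℝ).comp
    (EuclideanSpace.volume_preserving_symm_measurableEquiv_toLp (Fin 2))

theorem graphSet_eq_image (c : ℝ) : Q '' graphSet Φ c =
    (fun y : E 2 => Q (graphMap Φ c (y 0, y 1))) '' {y | 0 < y 0} := by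
  ext x
  constructor
  · rintro ⟨w, hw, rfl⟩
    refine ⟨!₂[w 0, w 1], by simpa using hw.1, congrArg Q ?_⟩
    ext i
    fin_cases i
    · simp [graphMap]
    · simp [graphMap]
    · simp [graphMap, hw.2]
  · rintro ⟨y, hy, rfl⟩
    exact mem_image_of_mem Q ⟨by simpa [graphMap] using hy, by simp [graphMap]⟩

theorem IsBump.restrict_graphSet (hΦ : IsBump Φ) (c : ℝ) :
    (μHE[2] : Measure (E 3)).restrict (Q '' graphSet Φ c) =
      (graphMeasure Φ c).map fun z => Q (graphMap Φ c z) := by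
  have hs : IsOpen {y : E 2 | 0 < y 0} :=
    isOpen_lt continuous_const (EuclideanSpace.proj 0 : E 2 →L[ℝ] ℝ).continuous
  have hcd : ∀ y ∈ {y : E 2 | 0 < y 0},
      ContinuousAt (fun y : E 2 => graphDeriv Q Φ c (y 1 / y 0)) y := by
    intro y hy
    refine (hΦ.continuous_graphDeriv Q c).continuousAt.comp (ContinuousAt.div ?_ ?_ hy.ne')
    · exact (EuclideanSpace.proj 1 : E 2 →L[ℝ] ℝ).continuous.continuousAt
    · exact (EuclideanSpace.proj 0 : E 2 →L[ℝ] ℝ).continuous.continuousAt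
  have key := restrict_image_euclideanHausdorffMeasure_eq_map (U := E 2) (V := E 3)
    (f := fun y : E 2 => Q (graphMap Φ c (y 0, y 1)))
    (f' := fun y => graphDeriv Q Φ c (y 1 / y 0)) hs
    (fun y hy => hasStrictFDerivAt_of_hasFDerivAt_of_continuousAt
      ((hs.eventually_mem hy).mono fun z hz => hΦ.hasFDerivAt_graph Q c (ne_of_gt hz)) (hcd y hy))
    (fun y hy => (hcd y hy).continuousWithinAt)
    (fun y hy => by
      intro a b hab
      have h := Q.injective ((graphDeriv_apply Q c _ a).symm.trans
        (hab.trans (graphDeriv_apply Q c _ b)))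
      ext i
      fin_cases i
      · simpa using congrArg (fun x : E 3 => x 0) h
      · simpa using congrArg (fun x : E 3 => x 1) h)
    (by
      intro a ha b hb hab
      have h := Q.injective hab
      ext i
      fin_cases i
      · simpa [graphMap] using congrArg (fun x : E 3 => x 0) h
      · simpa [graphMap] using congrArg (fun x : E 3 => x 1) h)
  rw [← graphSet_eq_image] at key
  simp only [finrank_euclideanSpace_fin, normDet_graphDeriv] at key
  rw [key]
  have hF : Measurable fun z => Q (graphMap Φ c z) :=
    Q.continuous.measurable.comp (hΦ.measurable_graphMap c)
  have hm := measurePreserving_coords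
  have hcomp : (fun y : E 2 => Q (graphMap Φ c (y 0, y 1))) =
      (fun z => Q (graphMap Φ c z)) ∘ fun y : E 2 => ((y 0, y 1) : ℝ × ℝ) := rfl
  rw [hcomp, ← Measure.map_map hF hm.measurable]
  congr 1
  have hH : MeasurableSet halfPlane := measurableSet_Ioi.prod MeasurableSet.univ
  have hpre : {y : E 2 | 0 < y 0} = (fun y : E 2 => ((y 0, y 1) : ℝ × ℝ)) ⁻¹' halfPlane := by
    ext y; simp [halfPlane]
  have hρ : Measurable fun z : ℝ × ℝ => ENNReal.ofReal (area Φ c (z.2 / z.1)) :=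
    ((hΦ.continuous_area c).measurable.comp (measurable_snd.div measurable_fst)).ennreal_ofReal
  ext B hB
  rw [Measure.map_apply hm.measurable hB, withDensity_apply _ (hm.measurable hB), graphMeasure,
    withDensity_apply _ hB, Measure.restrict_restrict hB,
    Measure.restrict_restrict (hm.measurable hB), hpre, ← preimage_inter]
  exact hm.setLIntegral_comp_preimage (hB.inter hH) hρ

/-- On the surface the tangent map agrees with an explicit function of the slope, which is
measurable; the pushforward can therefore be composed with the area formula. -/
theorem IsBump.inducedVarifold_eq (hΦ : IsBump Φ) (c : ℝ) :
    inducedVarifold 2 (Q '' graphSet Φ c) = (graphMeasure Φ c).map (bundleParam Q Φ c) := by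
  have hc : ∀ i : Fin 3, Measurable fun x : E 3 => Q.symm x i := fun i =>
    ((EuclideanSpace.proj i : E 3 →L[ℝ] ℝ).continuous.comp Q.symm.continuous).measurable
  have hae : tangentMap 2 (Q '' graphSet Φ c)
      =ᵐ[(μHE[2] : Measure (E 3)).restrict (Q '' graphSet Φ c)]
      fun x => (x, normalPlane Q Φ c (Q.symm x 1 / Q.symm x 0)) := by
    filter_upwards [ae_restrict_mem (hΦ.measurableSet_graphSet Q c)] with x hx
    rw [graphSet_eq_image] at hx
    obtain ⟨y, hy, rfl⟩ := hx
    have hy' : 0 < y 0 := hy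
    simp [tangentMap, hΦ.tangentPlane_graph Q c hy']
    simp [graphMap]
  have hmeas : Measurable fun x : E 3 =>
      ((x, normalPlane Q Φ c (Q.symm x 1 / Q.symm x 0)) : GrBundle 3 2) :=
    measurable_id.prodMk ((hΦ.continuous_normalPlane Q c).measurable.comp ((hc 1).div (hc 0)))
  rw [inducedVarifold, Measure.map_congr hae, hΦ.restrict_graphSet Q c,
    Measure.map_map hmeas (show Measurable fun z => Q (graphMap Φ c z) from
      Q.continuous.measurable.comp (hΦ.measurable_graphMap c))]
  congr 1
  funext z
  simp [bundleParam, graphMap]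

/-! ### The second fundamental form of the graph -/

/-- The derivative, with respect to the slope, of the projection onto the tangent plane. -/
def planeDeriv (Φ : ℝ → ℝ) (c s : ℝ) (j k : Fin 3) : ℝ :=
  c * deriv Φ s / area Φ c s * (Q (tangGrad Φ c s) j * Q (normal Φ c s) k +
    Q (normal Φ c s) j * Q (tangGrad Φ c s) k)

theorem IsBump.hasDerivAt_normal_apply (hΦ : IsBump Φ) (c s : ℝ) (j : Fin 3) :
    HasDerivAt (fun s => Q (normal Φ c s) j)
      (-(c * deriv Φ s / area Φ c s) * Q (tangGrad Φ c s) j) s := by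
  have h := ((EuclideanSpace.proj j : E 3 →L[ℝ] ℝ).comp (Q : E 3 →L[ℝ] E 3)).hasFDerivAt.comp_hasDerivAt
    s (hΦ.hasDerivAt_normal c s)
  exact h.congr_deriv (by simp)

theorem IsBump.hasDerivAt_normalPlane_matrix (hΦ : IsBump Φ) (c s : ℝ) (j k : Fin 3) :
    HasDerivAt (fun s => (normalPlane Q Φ c s).matrix j k) (planeDeriv Q Φ c s j k) s := by
  simp only [normalPlane_matrix]
  refine (((hΦ.hasDerivAt_normal_apply Q c s j).mul
    (hΦ.hasDerivAt_normal_apply Q c s k)).const_sub _).congr_deriv ?_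
  simp only [planeDeriv]
  ring

/-- Up to the factor `1 / u`, this is the derivative of the slope in the direction `T e_i`; as the
projection is symmetric it may be moved onto `slopeGrad`. -/
theorem inner_slopeGrad_tangent (c s : ℝ) (i : Fin 3) :
    ⟪Q (slopeGrad s), (normalPlane Q Φ c s).plane.starProjection (stdVec i)⟫ =
      Q (tangGrad Φ c s) i := by
  rw [normalPlane_starProjection, inner_sub_right, inner_smul_right, inner_stdVec, inner_stdVec,
    Q.inner_map_map, tangGrad, map_sub, map_smul, real_inner_comm]
  simp
  ring

/-- On the surface the projection matrix equals an ambient differentiable function of the slope, and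
the chain rule gives the derivative of the slope times `planeDeriv`. -/
theorem IsBump.secondFundamentalForm_eq (hΦ : IsBump Φ) (c : ℝ) {u : ℝ} (hu : 0 < u) (v : ℝ)
    {p : GrBundle 3 2} (hp : p.1 = Q (graphMap Φ c (u, v))) (i j k : Fin 3) :
    secondFundamentalForm 2 (Q '' graphSet Φ c) p i j k =
      Q (tangGrad Φ c (v / u)) i / u * planeDeriv Q Φ c (v / u) j k := by
  set R := Q '' graphSet Φ c with hR
  have hx : ∀ i : Fin 3, HasFDerivAt (fun x : E 3 => Q.symm x i)
      ((EuclideanSpace.proj i : E 3 →L[ℝ] ℝ).comp (Q.symm : E 3 →L[ℝ] E 3)) p.1 :=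
    fun i => ((EuclideanSpace.proj i : E 3 →L[ℝ] ℝ).comp (Q.symm : E 3 →L[ℝ] E 3)).hasFDerivAt
  have h0 : Q.symm p.1 0 = u := by simp [hp, graphMap]
  have h1 : Q.symm p.1 1 = v := by simp [hp, graphMap]
  have hdiv := (hx 1).mul ((hasDerivAt_inv (by rw [h0]; exact hu.ne')).comp_hasFDerivAt p.1 (hx 0))
  have hT := (hΦ.hasDerivAt_normalPlane_matrix Q c (v / u) j k).comp_hasFDerivAt_of_eq p.1 hdiv
    (by simp [h0, h1, div_eq_mul_inv])
  have hpar : ∀ y ∈ R, (tangentPlane 2 R y).matrix j k =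
      ((fun s => (normalPlane Q Φ c s).matrix j k) ∘
        fun x : E 3 => Q.symm x 1 * (Inv.inv ∘ fun x : E 3 => Q.symm x 0) x) y := by
    intro y hy
    rw [hR, graphSet_eq_image] at hy
    obtain ⟨w, hw, rfl⟩ := hy
    have hw' : 0 < w 0 := hw
    rw [hR, hΦ.tangentPlane_graph Q c hw']
    simp [graphMap, div_eq_mul_inv]
  have hpR : p.1 ∈ R := by
    rw [hp]
    exact mem_image_of_mem Q ⟨by simpa [graphMap] using hu, by simp [graphMap]⟩
  have hTw : HasFDerivWithinAt (fun y => (tangentPlane 2 R y).matrix j k) _ R p.1 :=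
    (hT.hasFDerivWithinAt (s := R)).congr hpar (hpar _ hpR)
  have hplane : tangentPlane 2 R p.1 = normalPlane Q Φ c (v / u) := by
    rw [hp]; exact hΦ.tangentPlane_graph Q c hu v
  have hspan : Submodule.span ℝ (tangentConeAt ℝ R p.1) = (normalPlane Q Φ c (v / u)).plane := by
    rw [hp]; exact hΦ.span_tangentConeAt_graph Q c hu v
  simp only [secondFundamentalForm]
  simp only [hplane]
  -- A derivative within a surface is not unique on all of `ℝ³`, but two of them agree on the
  -- tangent cone, hence on its span, and `T e_i` lies in that span.
  have huniq := hTw.differentiableWithinAt.hasFDerivWithinAt.unique_on hTw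
  have hmem : (normalPlane Q Φ c (v / u)).plane.starProjection (stdVec i) ∈
      Submodule.span ℝ (tangentConeAt ℝ R p.1) := by
    rw [hspan]; exact Submodule.starProjection_apply_mem _ _
  have := LinearMap.eqOn_span (f := (fderivWithin ℝ (fun y => (tangentPlane 2 R y).matrix j k) R
    p.1 : E 3 →ₗ[ℝ] ℝ)) (g := (_ : E 3 →L[ℝ] ℝ).toLinearMap) huniq hmem
  rw [ContinuousLinearMap.coe_coe] at this
  rw [this, ← inner_slopeGrad_tangent Q c (v / u) i]
  set w := (normalPlane Q Φ c (v / u)).plane.starProjection (stdVec i)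
  have hw : ⟪Q (slopeGrad (v / u)), w⟫ = -(v / u) * Q.symm w 0 + Q.symm w 1 := by
    conv_lhs => rw [← Q.apply_symm_apply w]
    rw [Q.inner_map_map, inner_E3]
    simp [slopeGrad]
  rw [hw]
  simp [h0, h1]
  field_simp

end

end CurvVar

end

noncomputable section

namespace CurvVar

open Set Filter Topology
open scoped ENNReal

/-! ### The divergence theorem on the half-plane -/

theorem volume_restrict_halfPlane :
    (volume : Measure (ℝ × ℝ)).restrict halfPlane = (volume.restrict (Ioi 0)).prod volume := by
  have h : (volume : Measure (ℝ × ℝ)) = (volume : Measure ℝ).prod volume := rfl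
  rw [halfPlane, h, ← Measure.prod_restrict, Measure.restrict_univ]

theorem measurableSet_halfPlane : MeasurableSet halfPlane :=
  measurableSet_Ioi.prod MeasurableSet.univ

theorem integral_Ioi_of_hasDerivAt_of_tendsto_nhdsGT {f f' : ℝ → ℝ} {a l m : ℝ}
    (hderiv : ∀ x ∈ Ioi a, HasDerivAt f (f' x) x) (hint : IntegrableOn f' (Ioi a))
    (ha : Tendsto f (𝓝[>] a) (𝓝 l)) (hm : Tendsto f atTop (𝓝 m)) :
    ∫ x in Ioi a, f' x = m - l := by
  have heq : ∀ x, a < x → Function.update f a l x = f x := fun x hx =>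
    Function.update_of_ne hx.ne' _ _
  -- The value of `f` at `a` is replaced by the one-sided limit, which makes it continuous up to the
  -- endpoint.
  have h := integral_Ioi_of_hasDerivAt_of_tendsto (f := Function.update f a l) (f' := f') (a := a)
    (m := m) ?_ ?_ hint ?_
  · simpa using h
  · refine continuousWithinAt_update_same.2 ?_
    rwa [Ici_sdiff_left]
  · intro x hx
    refine (hderiv x hx).congr_of_eventuallyEq ?_
    filter_upwards [Ioi_mem_nhds hx] with y hy using heq y hy
  · refine hm.congr' ?_
    filter_upwards [eventually_gt_atTop a] with x hx using (heq x hx).symm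

/-- Fubini in both orders and the fundamental theorem on lines: lines parallel to the boundary
contribute nothing, lines crossing it contribute minus the boundary limit. The limit is required
only for `v ≠ 0`, since a single line is null; in the application it jumps at the origin. -/
theorem integral_divergence_halfPlane {G₀ G₁ D₀ D₁ : ℝ × ℝ → ℝ} {ℓ : ℝ → ℝ} {r : ℝ}
    (h₀ : ∀ u, 0 < u → ∀ v, HasDerivAt (fun t => G₀ (t, v)) (D₀ (u, v)) u)
    (h₁ : ∀ u, 0 < u → ∀ v, HasDerivAt (fun t => G₁ (u, t)) (D₁ (u, v)) v)
    (i₀ : IntegrableOn D₀ halfPlane) (i₁ : IntegrableOn D₁ halfPlane)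
    (hlim : ∀ v, v ≠ 0 → Tendsto (fun u => G₀ (u, v)) (𝓝[>] 0) (𝓝 (ℓ v)))
    (hs₀ : ∀ u, r < u → ∀ v, G₀ (u, v) = 0)
    (hs₁ : ∀ u, 0 < u → ∀ v, r < |v| → G₁ (u, v) = 0) :
    ∫ z in halfPlane, (D₀ z + D₁ z) = -∫ v, ℓ v := by
  rw [integral_add i₀ i₁]
  rw [IntegrableOn, volume_restrict_halfPlane] at i₀ i₁
  rw [volume_restrict_halfPlane, integral_prod_symm _ i₀, integral_prod _ i₁]
  have e₁ : ∫ u in Ioi (0 : ℝ), ∫ v, D₁ (u, v) = 0 := by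
    refine integral_eq_zero_of_ae ?_
    filter_upwards [i₁.prod_right_ae, ae_restrict_mem measurableSet_Ioi] with u hu hu0
    have hz : ∀ v, r < |v| → G₁ (u, v) = 0 := hs₁ u hu0
    have := integral_of_hasDerivAt_of_tendsto (m := (0 : ℝ)) (n := 0) (h₁ u hu0) hu ?_ ?_
    · simpa using this
    · refine tendsto_const_nhds.congr' ?_
      filter_upwards [eventually_lt_atBot (-|r|)] with v hv
      exact (hz v ((le_abs_self r).trans_lt (lt_abs.2 (Or.inr (by linarith))))).symm
    · refine tendsto_const_nhds.congr' ?_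
      filter_upwards [eventually_gt_atTop (|r|)] with v hv
      exact (hz v ((le_abs_self r).trans_lt (lt_abs.2 (Or.inl (by linarith))))).symm
  have e₀ : ∫ v, ∫ u in Ioi (0 : ℝ), D₀ (u, v) = ∫ v, -ℓ v := by
    refine integral_congr_ae ?_
    have hne : ∀ᵐ v : ℝ, v ≠ 0 := by simp [ae_iff]
    filter_upwards [i₀.prod_left_ae, hne] with v hv hv0
    rw [integral_Ioi_of_hasDerivAt_of_tendsto_nhdsGT (m := 0) (fun u hu => h₀ u hu v) hv
      (hlim v hv0) ?_]
    · simp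
    · refine tendsto_const_nhds.congr' ?_
      filter_upwards [eventually_gt_atTop r] with u hu using (hs₀ u hu v).symm
  rw [e₁, e₀, integral_neg, add_zero]

/-! ### Integrability at the vertex of the cone -/

/-- The part of the half-plane where `|v| ≤ u ≤ r`. -/
def cone (r : ℝ) : Set (ℝ × ℝ) := {z | (0 < z.1 ∧ z.1 ≤ r) ∧ |z.2| ≤ z.1}

theorem measurableSet_cone (r : ℝ) : MeasurableSet (cone r) :=
  ((measurableSet_lt measurable_const measurable_fst).inter
    (measurableSet_le measurable_fst measurable_const)).inter
    (measurableSet_le measurable_snd.abs measurable_fst)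

/-- The slice at `u` has length `2u`, so the inner integral of `u⁻¹` is the constant `2` for `0 < u
≤ r`. -/
theorem integrableOn_inv_cone (r : ℝ) : IntegrableOn (fun z : ℝ × ℝ => z.1⁻¹) (cone r) := by
  refine ⟨measurable_fst.inv.aestronglyMeasurable, ?_⟩
  have hm : Measurable ((cone r).indicator fun z : ℝ × ℝ => ‖z.1⁻¹‖ₑ) :=
    measurable_fst.inv.enorm.indicator (measurableSet_cone r)
  rw [hasFiniteIntegral_iff_enorm, ← lintegral_indicator (measurableSet_cone r)]
  have hv : (volume : Measure (ℝ × ℝ)) = (volume : Measure ℝ).prod volume := rfl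
  rw [hv, lintegral_prod _ hm.aemeasurable]
  have hle : ∀ u : ℝ, ∫⁻ v, (cone r).indicator (fun z : ℝ × ℝ => ‖z.1⁻¹‖ₑ) (u, v) ≤
      (Ioc 0 r).indicator (fun _ => 2) u := by
    intro u
    by_cases hu : u ∈ Ioc 0 r
    · rw [indicator_of_mem hu]
      have : ∀ v, (cone r).indicator (fun z : ℝ × ℝ => ‖z.1⁻¹‖ₑ) (u, v) =
          (Icc (-u) u).indicator (fun _ => ‖u⁻¹‖ₑ) v := by
        intro v
        by_cases hv : v ∈ Icc (-u) u
        · rw [indicator_of_mem hv, indicator_of_mem]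
          exact ⟨hu, abs_le.2 hv⟩
        · rw [indicator_of_notMem hv, indicator_of_notMem]
          exact fun h => hv (abs_le.1 h.2)
      simp only [this]
      rw [lintegral_indicator measurableSet_Icc, setLIntegral_const, Real.volume_Icc,
        Real.enorm_eq_ofReal (inv_nonneg.2 hu.1.le), ← ENNReal.ofReal_mul (inv_nonneg.2 hu.1.le)]
      have : u⁻¹ * (u - -u) = 2 := by
        have := hu.1.ne'
        field_simp
        ring
      rw [this]
      simp
    · rw [indicator_of_notMem hu]
      have : ∀ v, (cone r).indicator (fun z : ℝ × ℝ => ‖z.1⁻¹‖ₑ) (u, v) = 0 := fun v =>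
        indicator_of_notMem (fun h => hu h.1) _
      simp [this]
  refine (lintegral_mono hle).trans_lt ?_
  rw [lintegral_indicator measurableSet_Ioc, setLIntegral_const]
  exact ENNReal.mul_lt_top (by simp) (by simp)

/-- The dominating function is `C` on a box plus `C / u` on the cone. Both the fluxes and the
curvature have this type of bound. -/
theorem integrableOn_halfPlane_of_bound {f : ℝ × ℝ → ℝ} {C r : ℝ}
    (hf : AEStronglyMeasurable f (volume.restrict halfPlane))
    (hzero : ∀ u, 0 < u → ∀ v, r < u ∨ r < |v| → f (u, v) = 0)
    (hbound : ∀ u, 0 < u → ∀ v, u < |v| → |f (u, v)| ≤ C)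
    (hbound' : ∀ u, 0 < u → ∀ v, |v| ≤ u → |f (u, v)| ≤ C * (1 + u⁻¹)) :
    IntegrableOn f halfPlane := by
  have hbox : MeasurableSet (Icc (0 : ℝ) r ×ˢ Icc (-r) r) := measurableSet_Icc.prod measurableSet_Icc
  have hi1 : Integrable ((Icc (0 : ℝ) r ×ˢ Icc (-r) r).indicator fun _ => C) :=
    (integrable_indicator_iff hbox).2 (integrableOn_const
      ((isCompact_Icc.prod isCompact_Icc).measure_lt_top.ne))
  have hi2 : Integrable ((cone r).indicator fun z : ℝ × ℝ => C * z.1⁻¹) :=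
    (integrable_indicator_iff (measurableSet_cone r)).2 ((integrableOn_inv_cone r).const_mul C)
  refine Integrable.mono' (hi1.add hi2).integrableOn hf ?_
  filter_upwards [ae_restrict_mem measurableSet_halfPlane] with z hz
  obtain ⟨u, v⟩ := z
  have hu : 0 < u := hz.1
  rw [Real.norm_eq_abs, Pi.add_apply]
  by_cases h : r < u ∨ r < |v|
  · rw [hzero u hu v h, abs_zero]
    have h1 : (u, v) ∉ Icc (0 : ℝ) r ×ˢ Icc (-r) r := by
      rintro ⟨h1, h2⟩
      rcases h with h | h
      · exact absurd h1.2 (not_le.2 h)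
      · exact absurd (abs_le.2 h2) (not_le.2 h)
    have h2 : (u, v) ∉ cone r := by
      rintro ⟨⟨_, h1⟩, h2⟩
      rcases h with h | h
      · exact absurd h1 (not_le.2 h)
      · exact absurd (h2.trans h1) (not_le.2 h)
    rw [indicator_of_notMem h1, indicator_of_notMem h2, add_zero]
  · push Not at h
    have h1 : (u, v) ∈ Icc (0 : ℝ) r ×ˢ Icc (-r) r := ⟨⟨hu.le, h.1⟩, abs_le.1 h.2⟩
    rw [indicator_of_mem h1]
    by_cases hv : |v| ≤ u
    · have h2 : (u, v) ∈ cone r := ⟨⟨hu, h.1⟩, hv⟩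
      rw [indicator_of_mem h2]
      have := hbound' u hu v hv
      linarith
    · have h2 : (u, v) ∉ cone r := fun h => hv h.2
      rw [indicator_of_notMem h2, add_zero]
      exact hbound u hu v (not_le.1 hv)

theorem exists_bound_of_eventually_const {F : Type*} [NormedAddCommGroup F] {f : ℝ → F}
    (hf : Continuous f) (h1 : ∀ s, 1 ≤ s → f s = f 1) (h2 : ∀ s, s ≤ -1 → f s = f (-1)) :
    ∃ C, 0 ≤ C ∧ ∀ s, ‖f s‖ ≤ C := by
  obtain ⟨C, hC⟩ := (isCompact_Icc (a := (-1 : ℝ)) (b := 1)).exists_bound_of_continuousOn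
    hf.continuousOn
  have hC1 := hC 1 (by simp)
  refine ⟨C, (norm_nonneg _).trans hC1, fun s => ?_⟩
  rcases le_total 1 s with h | h
  · rwa [h1 s h]
  · rcases le_total s (-1) with h' | h'
    · rw [h2 s h']
      exact hC _ (by simp)
    · exact hC s ⟨h', h⟩

end CurvVar

end

noncomputable section

namespace CurvVar

open Set Filter Topology
open scoped RealInnerProductSpace ENNReal

/-! ### Planar fluxes -/

/-- A parametrization of the graph, with its tangent planes as matrices. -/
def matrixParam (Q : E 3 ≃ₗᵢ[ℝ] E 3) (Φ : ℝ → ℝ) (c : ℝ) (z : ℝ × ℝ) : E 3 × Mat 3 :=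
  (Q (graphMap Φ c z), (normalPlane Q Φ c (z.2 / z.1)).matrix)

/-- The derivative of the base point in the direction `(α, β)`. -/
def dirBase (Q : E 3 ≃ₗᵢ[ℝ] E 3) (Φ : ℝ → ℝ) (c α β s : ℝ) : E 3 :=
  Q !₂[α, β, slope₁ Φ c s * α + slope₂ Φ c s * β]

/-- The derivative of the tangent plane in the direction `(α, β)`, multiplied by `u`. -/
def dirPlane (Q : E 3 ≃ₗᵢ[ℝ] E 3) (Φ : ℝ → ℝ) (c α β s : ℝ) : Mat 3 :=
  (-s * α + β) • planeDeriv Q Φ c s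

/-- The derivative in the direction `(α, β)` of a test function times a function of the slope. -/
def fluxDeriv (Q : E 3 ≃ₗᵢ[ℝ] E 3) (Φ : ℝ → ℝ) (c : ℝ) (φ : E 3 × Mat 3 → ℝ) (M M' : ℝ → ℝ)
    (α β : ℝ) (z : ℝ × ℝ) : ℝ :=
  fderiv ℝ φ (matrixParam Q Φ c z) (dirBase Q Φ c α β (z.2 / z.1),
    z.1⁻¹ • dirPlane Q Φ c α β (z.2 / z.1)) * M (z.2 / z.1) +
  φ (matrixParam Q Φ c z) * (z.1⁻¹ * ((-(z.2 / z.1) * α + β) * M' (z.2 / z.1)))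

section

variable {Φ : ℝ → ℝ} (Q : E 3 ≃ₗᵢ[ℝ] E 3)

theorem hasDerivAt_div_slope {a b : ℝ → ℝ} {α β t : ℝ} (ha : HasDerivAt a α t)
    (hb : HasDerivAt b β t) (h0 : 0 < a t) :
    HasDerivAt (fun t => b t / a t) ((a t)⁻¹ * (-(b t / a t) * α + β)) t := by
  refine (hb.div ha h0.ne').congr_deriv ?_
  field_simp
  ring

theorem IsBump.hasDerivAt_matrixParam (hΦ : IsBump Φ) (c : ℝ) {a b : ℝ → ℝ} {α β t : ℝ}
    (ha : HasDerivAt a α t) (hb : HasDerivAt b β t) (h0 : 0 < a t) :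
    HasDerivAt (fun t => matrixParam Q Φ c (a t, b t))
      (dirBase Q Φ c α β (b t / a t), (a t)⁻¹ • dirPlane Q Φ c α β (b t / a t)) t := by
  refine HasDerivAt.prodMk ?_ ?_
  · have hh := (hΦ.hasFDerivAt_height c ha.hasFDerivAt hb.hasFDerivAt h0.ne').hasDerivAt
    have h := ((ha.smul_const (stdVec 0 : E 3)).add (hb.smul_const (stdVec 1 : E 3))).add
      (hh.smul_const (stdVec 2 : E 3))
    have h2 := (Q : E 3 →L[ℝ] E 3).hasFDerivAt.comp_hasDerivAt t h
    refine (h2.congr_deriv ?_).congr_of_eventuallyEq (Eventually.of_forall fun t => ?_)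
    · simp [dirBase, vec3_eq]
    · simp [graphMap_eq]
  · rw [hasDerivAt_pi]
    intro j
    rw [hasDerivAt_pi]
    intro k
    refine ((hΦ.hasDerivAt_normalPlane_matrix Q c (b t / a t) j k).comp t
      (hasDerivAt_div_slope ha hb h0)).congr_deriv ?_
    simp [dirPlane]
    ring

/-- Used on coordinate lines: `(α, β) = (1, 0)` is the `u`-derivative and `(0, 1)` the
`v`-derivative. The factor `u⁻¹ * (-s * α + β)` in `fluxDeriv` is the derivative of the slope. -/
theorem IsBump.hasDerivAt_flux (hΦ : IsBump Φ) (c : ℝ) {φ : E 3 × Mat 3 → ℝ}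
    (hφ : ContDiff ℝ 1 φ) {M M' : ℝ → ℝ} (hM : ∀ s, HasDerivAt M (M' s) s)
    {a b : ℝ → ℝ} {α β t : ℝ}
    (ha : HasDerivAt a α t) (hb : HasDerivAt b β t) (h0 : 0 < a t) :
    HasDerivAt (fun t => φ (matrixParam Q Φ c (a t, b t)) * M (b t / a t))
      (fluxDeriv Q Φ c φ M M' α β (a t, b t)) t := by
  have h1 := ((hφ.differentiable (by simp)) (matrixParam Q Φ c (a t, b t))).hasFDerivAt.comp_hasDerivAt
    t (hΦ.hasDerivAt_matrixParam Q c ha hb h0)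
  have h2 := (hM (b t / a t)).comp t (hasDerivAt_div_slope ha hb h0)
  refine (h1.mul h2).congr_deriv ?_
  simp only [fluxDeriv, Function.comp_apply]
  ring

theorem continuousOn_div_halfPlane : ContinuousOn (fun z : ℝ × ℝ => z.2 / z.1) halfPlane :=
  continuousOn_snd.div continuousOn_fst fun _ hz => ne_of_gt hz.1

theorem IsBump.continuousOn_graphMap (hΦ : IsBump Φ) (c : ℝ) :
    ContinuousOn (fun z => Q (graphMap Φ c z)) halfPlane := by
  simp only [graphMap_eq]
  refine Q.continuous.comp_continuousOn (ContinuousOn.add (by fun_prop)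
    (ContinuousOn.fun_smul ?_ continuousOn_const))
  exact (continuousOn_const.mul continuousOn_fst).mul
    (hΦ.continuous_primitive.comp_continuousOn continuousOn_div_halfPlane)

theorem IsBump.continuousOn_matrixParam (hΦ : IsBump Φ) (c : ℝ) :
    ContinuousOn (matrixParam Q Φ c) halfPlane :=
  (hΦ.continuousOn_graphMap Q c).prodMk
    ((continuous_matrix_gr.comp (hΦ.continuous_normalPlane Q c)).comp_continuousOn
      continuousOn_div_halfPlane)

theorem continuous_apply_E3 (i : Fin 3) : Continuous fun x : E 3 => x i :=
  (EuclideanSpace.proj i : E 3 →L[ℝ] ℝ).continuous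

theorem continuous_slopeGrad : Continuous slopeGrad := by
  unfold slopeGrad
  simp only [vec3_eq]
  fun_prop

theorem IsBump.continuous_tangGrad (hΦ : IsBump Φ) (c : ℝ) : Continuous (tangGrad Φ c) :=
  continuous_slopeGrad.sub (Continuous.smul (f := fun s => ⟪normal Φ c s, slopeGrad s⟫)
    ((hΦ.continuous_normal c).inner continuous_slopeGrad) (hΦ.continuous_normal c))

theorem IsBump.continuous_planeDeriv (hΦ : IsBump Φ) (c : ℝ) :
    Continuous (planeDeriv Q Φ c) := by
  refine continuous_pi fun j => continuous_pi fun k => ?_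
  have hd := hΦ.continuous_deriv
  have ha := hΦ.continuous_area c
  have hn : ∀ i, Continuous fun s => Q (normal Φ c s) i := fun i =>
    (continuous_apply_E3 i).comp (Q.continuous.comp (hΦ.continuous_normal c))
  have ht : ∀ i, Continuous fun s => Q (tangGrad Φ c s) i := fun i =>
    (continuous_apply_E3 i).comp (Q.continuous.comp (hΦ.continuous_tangGrad c))
  exact ((continuous_const.mul hd).div ha fun s => (area_pos c s).ne').mul
    (((ht j).mul (hn k)).add ((hn j).mul (ht k)))

theorem IsBump.planeDeriv_eq_zero (hΦ : IsBump Φ) (c : ℝ) {s : ℝ} (hs : 1 ≤ |s|) :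
    planeDeriv Q Φ c s = 0 := by
  funext j k
  simp [planeDeriv, hΦ.deriv_eq_zero hs]

theorem IsBump.continuous_dirBase (hΦ : IsBump Φ) (c α β : ℝ) :
    Continuous (dirBase Q Φ c α β) := by
  have h1 := hΦ.continuous_slope₁ c
  have h2 := hΦ.continuous_slope₂ c
  unfold dirBase
  simp only [vec3_eq]
  exact Q.continuous.comp (by fun_prop)

theorem IsBump.continuous_dirPlane (hΦ : IsBump Φ) (c α β : ℝ) :
    Continuous (dirPlane Q Φ c α β) := by
  have := hΦ.continuous_planeDeriv Q c
  unfold dirPlane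
  fun_prop

theorem IsBump.dirPlane_eq_zero (hΦ : IsBump Φ) (c α β : ℝ) {s : ℝ} (hs : 1 ≤ |s|) :
    dirPlane Q Φ c α β s = 0 := by
  rw [dirPlane, hΦ.planeDeriv_eq_zero Q c hs, smul_zero]

theorem IsBump.continuousOn_fluxDeriv (hΦ : IsBump Φ) (c : ℝ) {φ : E 3 × Mat 3 → ℝ}
    (hφ : ContDiff ℝ 1 φ) {M M' : ℝ → ℝ} (hM : Continuous M) (hM' : Continuous M') (α β : ℝ) :
    ContinuousOn (fluxDeriv Q Φ c φ M M' α β) halfPlane := by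
  have hs := continuousOn_div_halfPlane
  have hinv : ContinuousOn (fun z : ℝ × ℝ => z.1⁻¹) halfPlane :=
    continuousOn_fst.inv₀ fun _ hz => ne_of_gt hz.1
  have hB := hΦ.continuousOn_matrixParam Q c
  have h1 := (hφ.continuous_fderiv (by simp)).comp_continuousOn hB
  have h2 := (hΦ.continuous_dirBase Q c α β).comp_continuousOn hs
  have h3 := (hΦ.continuous_dirPlane Q c α β).comp_continuousOn hs
  exact ((h1.clm_apply (h2.prodMk (hinv.smul h3))).mul (hM.comp_continuousOn hs)).add
    ((hφ.continuous.comp_continuousOn hB).mul (hinv.mul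
      (((hs.neg.mul continuousOn_const).add continuousOn_const).mul (hM'.comp_continuousOn hs))))

theorem norm_graphMap_ge (c : ℝ) (z : ℝ × ℝ) :
    |z.1| ≤ ‖Q (graphMap Φ c z)‖ ∧ |z.2| ≤ ‖Q (graphMap Φ c z)‖ := by
  rw [Q.norm_map]
  have h := fun i => PiLp.norm_apply_le (graphMap Φ c z) i
  exact ⟨by simpa [graphMap] using h 0, by simpa [graphMap] using h 1⟩

theorem exists_radius {n : ℕ} {φ : E n × Mat n → ℝ} (hφ : HasCompactSupport φ) :
    ∃ r : ℝ, ∀ x P, r < ‖x‖ → φ (x, P) = 0 ∧ fderiv ℝ φ (x, P) = 0 := by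
  obtain ⟨r, hr⟩ := hφ.isCompact.isBounded.exists_norm_le
  refine ⟨r, fun x P hx => ?_⟩
  have h : (x, P) ∉ tsupport φ := fun h =>
    absurd ((norm_fst_le (x, P)).trans (hr _ h)) (not_le.2 hx)
  exact ⟨image_eq_zero_of_notMem_tsupport h,
    image_eq_zero_of_notMem_tsupport fun h' => h (tsupport_fderiv_subset ℝ h')⟩

/-- Only the terms that differentiate the slope carry `u⁻¹`, and they vanish outside the cone
because the plane and the coefficient `M` are constant there. -/
theorem IsBump.integrableOn_fluxDeriv (hΦ : IsBump Φ) (c : ℝ) {φ : E 3 × Mat 3 → ℝ}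
    (hφ : ContDiff ℝ 1 φ) (hφc : HasCompactSupport φ) {M M' : ℝ → ℝ} (hM : Continuous M)
    (hM' : Continuous M') (hM1 : ∀ s, 1 ≤ s → M s = M 1) (hM2 : ∀ s, s ≤ -1 → M s = M (-1))
    (hM'0 : ∀ s, 1 ≤ |s| → M' s = 0) (α β : ℝ) :
    IntegrableOn (fluxDeriv Q Φ c φ M M' α β) halfPlane := by
  obtain ⟨r, hr⟩ := exists_radius hφc
  obtain ⟨K₀, hK₀⟩ := hφc.exists_bound_of_continuous hφ.continuous
  obtain ⟨K₁, hK₁⟩ := (hφc.fderiv (𝕜 := ℝ)).exists_bound_of_continuous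
    (hφ.continuous_fderiv (by simp))
  have h11 : (1 : ℝ) ≤ |1| := by simp
  have h12 : (1 : ℝ) ≤ |-1| := by simp
  have hge : ∀ {s : ℝ}, 1 ≤ s → 1 ≤ |s| := fun h => h.trans (le_abs_self _)
  have hle : ∀ {s : ℝ}, s ≤ -1 → 1 ≤ |s| := fun h => le_abs'.2 (Or.inl h)
  have hp1 : ∀ s : ℝ, 1 ≤ s → (1 : ℝ) ≤ 1 * s := by simp
  have hp2 : ∀ s : ℝ, s ≤ -1 → (1 : ℝ) ≤ -1 * s := by intro s h; linarith
  obtain ⟨C₁, hC₁0, hC₁⟩ := exists_bound_of_eventually_const (hΦ.continuous_dirBase Q c α β)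
    (fun s hs => by
      simp only [dirBase, hΦ.slope₁_of_le c (Or.inl rfl) (hp1 s hs),
        hΦ.slope₂_of_le c (Or.inl rfl) (hp1 s hs), hΦ.slope₁_of_le c (Or.inl rfl) (hp1 1 le_rfl),
        hΦ.slope₂_of_le c (Or.inl rfl) (hp1 1 le_rfl)])
    (fun s hs => by
      simp only [dirBase, hΦ.slope₁_of_le c (Or.inr rfl) (hp2 s hs),
        hΦ.slope₂_of_le c (Or.inr rfl) (hp2 s hs), hΦ.slope₁_of_le c (Or.inr rfl) (hp2 (-1) le_rfl),
        hΦ.slope₂_of_le c (Or.inr rfl) (hp2 (-1) le_rfl)])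
  obtain ⟨C₂, hC₂0, hC₂⟩ := exists_bound_of_eventually_const (hΦ.continuous_dirPlane Q c α β)
    (fun s hs => by rw [hΦ.dirPlane_eq_zero Q c α β (hge hs), hΦ.dirPlane_eq_zero Q c α β h11])
    (fun s hs => by rw [hΦ.dirPlane_eq_zero Q c α β (hle hs), hΦ.dirPlane_eq_zero Q c α β h12])
  obtain ⟨C₃, hC₃0, hC₃⟩ := exists_bound_of_eventually_const hM hM1 hM2
  obtain ⟨C₄, hC₄0, hC₄⟩ := exists_bound_of_eventually_const
    (f := fun s => (-s * α + β) * M' s) (by fun_prop)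
    (fun s hs => by simp only [hM'0 s (hge hs), hM'0 1 h11, mul_zero])
    (fun s hs => by simp only [hM'0 s (hle hs), hM'0 (-1) h12, mul_zero])
  have hK₀0 : 0 ≤ K₀ := (norm_nonneg _).trans (hK₀ 0)
  have hK₁0 : 0 ≤ K₁ := (norm_nonneg _).trans (hK₁ 0)
  -- The two singular contributions are kept as parameters: `d = m = 0` outside the cone, and
  -- multiples of `u⁻¹` inside.
  have hmain : ∀ u : ℝ, 0 < u → ∀ v : ℝ, ∀ d m : ℝ, 0 ≤ d →
      ‖u⁻¹ • dirPlane Q Φ c α β (v / u)‖ ≤ d →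
      |u⁻¹ * ((-(v / u) * α + β) * M' (v / u))| ≤ m →
      |fluxDeriv Q Φ c φ M M' α β (u, v)| ≤ K₁ * (C₁ + d) * C₃ + K₀ * m := by
    intro u hu v d m hd0 hd hm
    refine (abs_add_le _ _).trans (add_le_add ?_ ?_)
    · rw [abs_mul]
      refine mul_le_mul ?_ (hC₃ _) (abs_nonneg _) (by positivity)
      refine (ContinuousLinearMap.le_opNorm _ _).trans
        (mul_le_mul (hK₁ _) ?_ (norm_nonneg _) hK₁0)
      rw [Prod.norm_def]
      exact max_le ((hC₁ _).trans (by linarith)) (hd.trans (by linarith))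
    · rw [abs_mul]
      exact mul_le_mul (hK₀ _) hm (abs_nonneg _) hK₀0
  refine integrableOn_halfPlane_of_bound (C := K₁ * (C₁ + C₂) * C₃ + K₀ * C₄) (r := r)
    ((hΦ.continuousOn_fluxDeriv Q c hφ hM hM' α β).aestronglyMeasurable measurableSet_halfPlane)
    ?_ ?_ ?_
  · intro u hu v h
    obtain ⟨h1, h2⟩ := norm_graphMap_ge (Φ := Φ) Q c (u, v)
    have hlt : r < ‖Q (graphMap Φ c (u, v))‖ := by
      rcases h with h | h
      · exact h.trans_le ((le_abs_self u).trans h1)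
      · exact h.trans_le h2
    obtain ⟨e1, e2⟩ := hr _ ((normalPlane Q Φ c (v / u)).matrix) hlt
    simp [fluxDeriv, matrixParam, e1, e2]
  · intro u hu v h
    have hs : 1 ≤ |v / u| := by
      rw [abs_div, abs_of_pos hu, one_le_div hu]
      exact h.le
    refine (hmain u hu v 0 0 le_rfl ?_ ?_).trans ?_
    · simp [hΦ.dirPlane_eq_zero Q c α β hs]
    · simp [hM'0 _ hs]
    · have : 0 ≤ K₁ * C₂ * C₃ + K₀ * C₄ := by positivity
      nlinarith
  · intro u hu v h
    have hu' : 0 ≤ u⁻¹ := inv_nonneg.2 hu.le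
    refine (hmain u hu v (u⁻¹ * C₂) (u⁻¹ * C₄) (by positivity) ?_ ?_).trans ?_
    · rw [norm_smul, Real.norm_of_nonneg hu']
      exact mul_le_mul_of_nonneg_left (hC₂ _) hu'
    · rw [abs_mul, abs_of_nonneg hu']
      exact mul_le_mul_of_nonneg_left (hC₄ _) hu'
    · have h1 : 0 ≤ K₁ * C₂ * C₃ := by positivity
      have h2 : 0 ≤ K₀ * C₄ := by positivity
      have h3 : 0 ≤ K₁ * C₁ * C₃ * u⁻¹ := by positivity
      nlinarith

end

end CurvVar

end

noncomputable section

namespace CurvVar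

open Set Filter Topology
open scoped RealInnerProductSpace ENNReal

/-! ### The first variation of the graph -/

/-- The integrand in the definition of a curvature varifold with boundary. -/
def firstVar {n m : ℕ} (φ : E n × Mat n → ℝ) (A : GrBundle n m → Fin n → Fin n → Fin n → ℝ)
    (i : Fin n) (p : GrBundle n m) : ℝ :=
  (∑ j, p.2.matrix i j * fderiv ℝ φ (p.1, p.2.matrix) (stdVec j, 0))
    + (∑ j, ∑ k, fderiv ℝ φ (p.1, p.2.matrix) (0, Pi.single j (Pi.single k 1)) * A p i j k)
    + φ (p.1, p.2.matrix) * ∑ j, A p j i j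

/-- The components of the projected basis vector `T e_i` in graph coordinates, times the area
element. -/
def fluxCoeff (Q : E 3 ≃ₗᵢ[ℝ] E 3) (Φ : ℝ → ℝ) (c : ℝ) (i a : Fin 3) (s : ℝ) : ℝ :=
  area Φ c s * (Q.symm (stdVec i) a - Q (normal Φ c s) i * normal Φ c s a)

/-- The derivative of `fluxCoeff`. -/
def fluxCoeffDeriv (Q : E 3 ≃ₗᵢ[ℝ] E 3) (Φ : ℝ → ℝ) (c : ℝ) (i a : Fin 3) (s : ℝ) : ℝ :=
  c * deriv Φ s * (-⟪normal Φ c s, slopeGrad s⟫ *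
      (Q.symm (stdVec i) a - Q (normal Φ c s) i * normal Φ c s a) +
    Q (tangGrad Φ c s) i * normal Φ c s a + Q (normal Φ c s) i * tangGrad Φ c s a)

theorem sum_mul_apply_stdVec {n : ℕ} {F : Type*} [NormedAddCommGroup F] [NormedSpace ℝ F]
    (L : E n × F →L[ℝ] ℝ) (x : E n) : ∑ j, x j * L (stdVec j, 0) = L (x, 0) := by
  have hx : x = ∑ j, x j • (stdVec j : E n) := by
    ext k
    simp [stdVec, Finset.sum_apply, Pi.single_apply]
  have h : (x, (0 : F)) = ∑ j, x j • ((stdVec j : E n), (0 : F)) := by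
    conv_lhs => rw [hx]
    ext1
    · simp [Prod.fst_sum]
    · simp [Prod.snd_sum]
  rw [h, map_sum]
  simp only [map_smul, smul_eq_mul]

theorem sum_apply_single_mul {n : ℕ} {F : Type*} [NormedAddCommGroup F] [NormedSpace ℝ F]
    (L : F × Mat n →L[ℝ] ℝ) (m : Mat n) :
    ∑ j, ∑ k, L (0, Pi.single j (Pi.single k 1)) * m j k = L (0, m) := by
  have hm : m = ∑ j, ∑ k, m j k • (Pi.single j (Pi.single k 1) : Mat n) := by
    funext a b
    simp [Finset.sum_apply, Pi.single_apply, Finset.sum_ite_eq, apply_ite, ite_apply]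
  have h : ((0 : F), m) = ∑ j, ∑ k, m j k • ((0 : F), (Pi.single j (Pi.single k 1) : Mat n)) := by
    conv_lhs => rw [hm]
    ext1
    · simp [Prod.fst_sum]
    · simp [Prod.snd_sum]
  simp only [h, map_sum, map_smul, smul_eq_mul, mul_comm]

section

variable {Φ : ℝ → ℝ} (Q : E 3 ≃ₗᵢ[ℝ] E 3)

theorem IsBump.hasDerivAt_fluxCoeff (hΦ : IsBump Φ) (c : ℝ) (i a : Fin 3) (s : ℝ) :
    HasDerivAt (fluxCoeff Q Φ c i a) (fluxCoeffDeriv Q Φ c i a s) s := by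
  have h1 := hΦ.hasDerivAt_normal_apply (LinearIsometryEquiv.refl ℝ (E 3)) c s a
  simp only [LinearIsometryEquiv.coe_refl, id_eq] at h1
  refine ((hΦ.hasDerivAt_area c s).mul (((hΦ.hasDerivAt_normal_apply Q c s i).mul h1).const_sub
    (Q.symm (stdVec i) a))).congr_deriv ?_
  have := (area_pos (Φ := Φ) c s).ne'
  simp only [fluxCoeffDeriv, Pi.mul_apply]
  field_simp
  ring

theorem symm_starProjection_apply (c s : ℝ) (i a : Fin 3) :
    Q.symm ((normalPlane Q Φ c s).plane.starProjection (stdVec i)) a =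
      Q.symm (stdVec i) a - Q (normal Φ c s) i * normal Φ c s a := by
  rw [normalPlane_starProjection, map_sub, map_smul, Q.symm_apply_apply, inner_stdVec]
  simp

theorem fluxCoeff_eq (c s : ℝ) (i a : Fin 3) : fluxCoeff Q Φ c i a s =
    area Φ c s * Q.symm ((normalPlane Q Φ c s).plane.starProjection (stdVec i)) a := by
  rw [symm_starProjection_apply, fluxCoeff]

theorem slope_mul_starProjection (c s : ℝ) (i : Fin 3) :
    -s * Q.symm ((normalPlane Q Φ c s).plane.starProjection (stdVec i)) 0 +
      Q.symm ((normalPlane Q Φ c s).plane.starProjection (stdVec i)) 1 =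
      Q (tangGrad Φ c s) i := by
  rw [← inner_slopeGrad_tangent]
  conv_rhs => rw [← Q.apply_symm_apply ((normalPlane Q Φ c s).plane.starProjection (stdVec i))]
  rw [Q.inner_map_map, inner_E3]
  simp [slopeGrad]

/-- A tangent vector is expanded in the coordinate basis of the graph; as the parametrization is a
graph, the coefficients are its first two unrotated components. -/
theorem smul_dirBase_add (c s : ℝ) {w : E 3} (hw : w ∈ (normalPlane Q Φ c s).plane) :
    Q.symm w 0 • dirBase Q Φ c 1 0 s + Q.symm w 1 • dirBase Q Φ c 0 1 s = w := by
  apply Q.symm.injective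
  simp only [dirBase, map_add, map_smul, Q.symm_apply_apply]
  have := (mem_normalPlane_iff Q).1 hw
  ext k
  fin_cases k
  · simp
  · simp
  · simp [this, mul_comm]

theorem inner_slopeGrad_tangGrad (c s : ℝ) :
    ⟪slopeGrad s, tangGrad Φ c s⟫ = ⟪tangGrad Φ c s, tangGrad Φ c s⟫ := by
  have h : slopeGrad s = tangGrad Φ c s + ⟪normal Φ c s, slopeGrad s⟫ • normal Φ c s := by
    simp [tangGrad]
  conv_lhs => rw [h]
  rw [inner_add_left, inner_smul_left, inner_normal_tangGrad]
  simp

/-- This is the coordinate formula for the surface divergence, `area · div X = ∂_a (area · X^a)`,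
applied to `X = φ(x, T) T e_i`: the first two terms of `firstVar` differentiate `φ` along `T e_i`,
and `∑ A_{jij}` is the divergence of `T e_i`. -/
theorem area_mul_firstVar (c : ℝ) (φ : E 3 × Mat 3 → ℝ) {A : GrBundle 3 2 → Fin 3 → Fin 3 → Fin 3 → ℝ}
    {z : ℝ × ℝ} (hA : ∀ i j k, A (bundleParam Q Φ c z) i j k =
      Q (tangGrad Φ c (z.2 / z.1)) i / z.1 * planeDeriv Q Φ c (z.2 / z.1) j k) (i : Fin 3) :
    area Φ c (z.2 / z.1) * firstVar φ A i (bundleParam Q Φ c z) =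
      fluxDeriv Q Φ c φ (fluxCoeff Q Φ c i 0) (fluxCoeffDeriv Q Φ c i 0) 1 0 z +
      fluxDeriv Q Φ c φ (fluxCoeff Q Φ c i 1) (fluxCoeffDeriv Q Φ c i 1) 0 1 z := by
  set s := z.2 / z.1 with hs
  set w := (normalPlane Q Φ c s).plane.starProjection (stdVec i) with hw
  have hpt : ((bundleParam Q Φ c z).1, (bundleParam Q Φ c z).2.matrix) = matrixParam Q Φ c z := rfl
  set L := fderiv ℝ φ (matrixParam Q Φ c z) with hL
  have hwm : w ∈ (normalPlane Q Φ c s).plane := Submodule.starProjection_apply_mem _ _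
  have e1 : ∑ j, (bundleParam Q Φ c z).2.matrix i j * L (stdVec j, 0) = L (w, 0) := by
    rw [← sum_mul_apply_stdVec]
    refine Finset.sum_congr rfl fun j _ => ?_
    have : (bundleParam Q Φ c z).2.matrix i j = (normalPlane Q Φ c s).matrix j i := by
      simp only [bundleParam, normalPlane_matrix, eq_comm (a := i), mul_comm, hs]
    rw [this, Gr.matrix]
  have e2 : ∑ j, ∑ k, L (0, Pi.single j (Pi.single k 1)) * A (bundleParam Q Φ c z) i j k =
      L (0, (Q (tangGrad Φ c s) i / z.1) • planeDeriv Q Φ c s) := by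
    rw [← sum_apply_single_mul]
    simp only [hA, Pi.smul_apply, smul_eq_mul, hs]
  -- Orthogonality of the normal and `tangGrad` leaves only `N_i |κ|²` in the trace, with `N` and
  -- `κ` the rotated normal and `tangGrad`. The two sides then match after writing `-s F₀' + F₁'`
  -- through `h3` and `h5`.
  have e3 : area Φ c s * ∑ j, A (bundleParam Q Φ c z) j i j =
      z.1⁻¹ * (-s * fluxCoeffDeriv Q Φ c i 0 s + fluxCoeffDeriv Q Φ c i 1 s) := by
    have h1 : ⟪Q (normal Φ c s), Q (tangGrad Φ c s)⟫ = 0 := by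
      rw [Q.inner_map_map, inner_normal_tangGrad]
    have h2 : ⟪Q (tangGrad Φ c s), Q (tangGrad Φ c s)⟫ = ⟪slopeGrad s, tangGrad Φ c s⟫ := by
      rw [Q.inner_map_map, inner_slopeGrad_tangGrad]
    have h3 := slope_mul_starProjection (Φ := Φ) Q c s i
    rw [symm_starProjection_apply, symm_starProjection_apply] at h3
    rw [inner_E3] at h1 h2
    have h4 : ⟪slopeGrad s, tangGrad Φ c s⟫ = -s * tangGrad Φ c s 0 + tangGrad Φ c s 1 := by
      rw [inner_E3]; simp [slopeGrad]
    have h5 : ⟪normal Φ c s, slopeGrad s⟫ = -s * normal Φ c s 0 + normal Φ c s 1 := by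
      rw [inner_E3]; simp [slopeGrad]; ring
    rw [h4] at h2
    have hne := (area_pos (Φ := Φ) c s).ne'
    simp only [hA, Fin.sum_univ_three, planeDeriv, fluxCoeffDeriv]
    set N := Q (normal Φ c s)
    set κ := Q (tangGrad Φ c s)
    set α := ⟪normal Φ c s, slopeGrad s⟫
    have hl : area Φ c s * (κ 0 / z.1 * (c * deriv Φ s / area Φ c s * (κ i * N 0 + N i * κ 0)) +
        κ 1 / z.1 * (c * deriv Φ s / area Φ c s * (κ i * N 1 + N i * κ 1)) +
        κ 2 / z.1 * (c * deriv Φ s / area Φ c s * (κ i * N 2 + N i * κ 2))) =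
        z.1⁻¹ * (c * deriv Φ s) * (κ i * (N 0 * κ 0 + N 1 * κ 1 + N 2 * κ 2) +
          N i * (κ 0 * κ 0 + κ 1 * κ 1 + κ 2 * κ 2)) := by
      field_simp
      ring
    rw [hl, h1, h2]
    linear_combination (z.1⁻¹ * c * deriv Φ s * α) * h3 + (z.1⁻¹ * c * deriv Φ s * κ i) * h5
  -- The chain rule: moving along `T e_i` is the combination of the two coordinate directions, for
  -- the base point and for the plane at once.
  have e4 : (w, (Q (tangGrad Φ c s) i / z.1) • planeDeriv Q Φ c s) =
      Q.symm w 0 • (dirBase Q Φ c 1 0 s, z.1⁻¹ • dirPlane Q Φ c 1 0 s) +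
      Q.symm w 1 • (dirBase Q Φ c 0 1 s, z.1⁻¹ • dirPlane Q Φ c 0 1 s) := by
    refine Prod.ext ?_ ?_
    · exact (smul_dirBase_add Q c s hwm).symm
    · have := slope_mul_starProjection (Φ := Φ) Q c s i
      rw [← hw] at this
      simp only [Prod.snd_add, Prod.smul_snd, dirPlane, smul_smul, ← add_smul, ← this]
      congr 1
      ring
  have e5 : L (w, 0) + L (0, (Q (tangGrad Φ c s) i / z.1) • planeDeriv Q Φ c s) =
      L (w, (Q (tangGrad Φ c s) i / z.1) • planeDeriv Q Φ c s) := by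
    rw [← map_add]; simp
  rw [firstVar, hpt, e1, e2, e5, e4, mul_add, mul_left_comm (area Φ c s) (φ _), e3]
  simp only [fluxDeriv, ← hs, ← hL, map_add, map_smul, fluxCoeff_eq, ← hw, smul_eq_mul]
  ring

end

end CurvVar

end

noncomputable section

namespace CurvVar

open Set Filter Topology
open scoped RealInnerProductSpace ENNReal

/-! ### The first variation as a boundary integral -/

/-- A measurable function on the Grassmann bundle which agrees with the second fundamental form of
the graph. -/
def curvExt (Q : E 3 ≃ₗᵢ[ℝ] E 3) (Φ : ℝ → ℝ) (c : ℝ) (p : GrBundle 3 2) (i j k : Fin 3) : ℝ :=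
  Q (tangGrad Φ c (Q.symm p.1 1 / Q.symm p.1 0)) i / Q.symm p.1 0 *
    planeDeriv Q Φ c (Q.symm p.1 1 / Q.symm p.1 0) j k

theorem continuous_matrixPair {n m : ℕ} :
    Continuous fun p : GrBundle n m => (p.1, p.2.matrix) :=
  continuous_fst.prodMk (continuous_matrix_gr.comp continuous_snd)

theorem measurable_matrix_apply {n m : ℕ} (j k : Fin n) :
    Measurable fun p : GrBundle n m => p.2.matrix j k :=
  (((continuous_apply k).comp (continuous_apply j)).comp
    (continuous_matrix_gr.comp continuous_snd)).measurable

theorem continuous_fderiv_pair {n m : ℕ} {φ : E n × Mat n → ℝ} (hφ : ContDiff ℝ 1 φ)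
    (v : E n × Mat n) :
    Continuous fun p : GrBundle n m => fderiv ℝ φ (p.1, p.2.matrix) v :=
  ((hφ.continuous_fderiv (by simp)).comp continuous_matrixPair).clm_apply continuous_const

theorem aestronglyMeasurable_firstVar {n m : ℕ} {V : Measure (GrBundle n m)}
    {φ : E n × Mat n → ℝ} (hφ : ContDiff ℝ 1 φ) {A : GrBundle n m → Fin n → Fin n → Fin n → ℝ}
    (hA : ∀ i j k, AEStronglyMeasurable (fun p => A p i j k) V) (i : Fin n) :
    AEStronglyMeasurable (firstVar φ A i) V := by
  have hd := fun v => (continuous_fderiv_pair (m := m) hφ v).aestronglyMeasurable (μ := V)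
  refine AEStronglyMeasurable.add (AEStronglyMeasurable.add ?_ ?_) ?_
  · exact Finset.aestronglyMeasurable_fun_sum _ fun j _ =>
      (measurable_matrix_apply i j).aestronglyMeasurable.mul (hd _)
  · exact Finset.aestronglyMeasurable_fun_sum _ fun j _ =>
      Finset.aestronglyMeasurable_fun_sum _ fun k _ => (hd _).mul (hA i j k)
  · exact (hφ.continuous.comp continuous_matrixPair).aestronglyMeasurable.mul
      (Finset.aestronglyMeasurable_fun_sum _ fun j _ => hA j i j)

section

variable {Φ : ℝ → ℝ} (Q : E 3 ≃ₗᵢ[ℝ] E 3)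

theorem measurable_symm_apply (i : Fin 3) : Measurable fun x : E 3 => Q.symm x i :=
  ((continuous_apply_E3 i).comp Q.symm.continuous).measurable

theorem IsBump.measurable_curvExt (hΦ : IsBump Φ) (c : ℝ) (i j k : Fin 3) :
    Measurable fun p => curvExt Q Φ c p i j k := by
  have h0 : Measurable fun p : GrBundle 3 2 => Q.symm p.1 0 :=
    (measurable_symm_apply Q 0).comp measurable_fst
  have h1 : Measurable fun p : GrBundle 3 2 => Q.symm p.1 1 :=
    (measurable_symm_apply Q 1).comp measurable_fst
  have hs := h1.div h0
  have ht : Continuous fun s => Q (tangGrad Φ c s) i :=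
    (continuous_apply_E3 i).comp (Q.continuous.comp (hΦ.continuous_tangGrad c))
  have hp : Continuous fun s => planeDeriv Q Φ c s j k :=
    (continuous_apply k).comp ((continuous_apply j).comp (hΦ.continuous_planeDeriv Q c))
  exact ((ht.measurable.comp hs).div h0).mul (hp.measurable.comp hs)

theorem curvExt_bundleParam (c : ℝ) (z : ℝ × ℝ) (i j k : Fin 3) :
    curvExt Q Φ c (bundleParam Q Φ c z) i j k =
      Q (tangGrad Φ c (z.2 / z.1)) i / z.1 * planeDeriv Q Φ c (z.2 / z.1) j k := by
  simp [curvExt, bundleParam, graphMap]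

theorem graphMeasure_ac (c : ℝ) : graphMeasure Φ c ≪ volume.restrict halfPlane :=
  withDensity_absolutelyContinuous _ _

theorem IsBump.ae_mem_graphSet (hΦ : IsBump Φ) (c : ℝ) :
    ∀ᵐ p ∂inducedVarifold 2 (Q '' graphSet Φ c), p.1 ∈ Q '' graphSet Φ c := by
  rw [hΦ.inducedVarifold_eq, ae_map_iff (hΦ.measurable_bundleParam Q c).aemeasurable
    (measurable_fst (hΦ.measurableSet_graphSet Q c))]
  filter_upwards [(graphMeasure_ac c).ae_le (ae_restrict_mem measurableSet_halfPlane)] with z hz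
  exact mem_image_of_mem Q ⟨by simpa [graphMap] using hz.1, by simp [graphMap]⟩

/-- `secondFundamentalForm` is understood only at points of the surface; `curvExt` supplies the
measurability needed for the integrals. -/
theorem IsBump.secondFundamentalForm_ae_eq (hΦ : IsBump Φ) (c : ℝ) :
    secondFundamentalForm 2 (Q '' graphSet Φ c)
      =ᵐ[inducedVarifold 2 (Q '' graphSet Φ c)] curvExt Q Φ c := by
  filter_upwards [hΦ.ae_mem_graphSet Q c] with p hp
  rw [graphSet_eq_image] at hp
  obtain ⟨y, hy, hyp⟩ := hp
  funext i j k
  have hy' : 0 < y 0 := hy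
  rw [hΦ.secondFundamentalForm_eq Q c hy' (y 1) hyp.symm]
  simp [curvExt, ← hyp, graphMap]

theorem IsBump.area_of_le (hΦ : IsBump Φ) (c : ℝ) {s t : ℝ} (hs : s = 1 ∨ s = -1)
    (ht : 1 ≤ s * t) : area Φ c t = area Φ c s := by
  have h1 : 1 ≤ s * s := by rcases hs with rfl | rfl <;> norm_num
  simp only [area, hΦ.slope₁_of_le c hs ht, hΦ.slope₁_of_le c hs h1,
    hΦ.slope₂_of_le c hs ht, hΦ.slope₂_of_le c hs h1]

theorem IsBump.fluxCoeff_of_le (hΦ : IsBump Φ) (c : ℝ) (i a : Fin 3) {s t : ℝ}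
    (hs : s = 1 ∨ s = -1) (ht : 1 ≤ s * t) : fluxCoeff Q Φ c i a t = fluxCoeff Q Φ c i a s := by
  simp only [fluxCoeff, hΦ.area_of_le c hs ht, hΦ.normal_of_le c hs ht]

theorem IsBump.continuous_fluxCoeff (hΦ : IsBump Φ) (c : ℝ) (i a : Fin 3) :
    Continuous (fluxCoeff Q Φ c i a) :=
  continuous_iff_continuousAt.2 fun s => (hΦ.hasDerivAt_fluxCoeff Q c i a s).continuousAt

theorem IsBump.continuous_fluxCoeffDeriv (hΦ : IsBump Φ) (c : ℝ) (i a : Fin 3) :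
    Continuous (fluxCoeffDeriv Q Φ c i a) := by
  have hd := hΦ.continuous_deriv
  have hn := hΦ.continuous_normal c
  have ht := hΦ.continuous_tangGrad c
  have hin := hn.inner (𝕜 := ℝ) continuous_slopeGrad
  have hQn := (continuous_apply_E3 i).comp (Q.continuous.comp hn)
  have hQt := (continuous_apply_E3 i).comp (Q.continuous.comp ht)
  have hna := (continuous_apply_E3 a).comp hn
  have hta := (continuous_apply_E3 a).comp ht
  exact (continuous_const.mul hd).mul (((hin.neg.mul (continuous_const.sub (hQn.mul hna))).add
    (hQt.mul hna)).add (hQn.mul hta))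

theorem continuous_axis : Continuous fun v : ℝ => Q !₂[0, v, 0] := by
  simp only [vec3_eq]
  exact Q.continuous.comp (by fun_prop)

theorem integrable_axis {φ : E 3 × Mat 3 → ℝ} (hφ : Continuous φ) (hφc : HasCompactSupport φ)
    (P : Mat 3) : Integrable fun v : ℝ => φ (Q !₂[0, v, 0], P) := by
  obtain ⟨r, hr⟩ := exists_radius hφc
  refine Continuous.integrable_of_hasCompactSupport
    (hφ.comp ((continuous_axis Q).prodMk continuous_const))
    (HasCompactSupport.intro (isCompact_closedBall (0 : ℝ) r) fun v hv => (hr _ P ?_).1)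
  rw [Metric.mem_closedBall, dist_zero_right, not_le] at hv
  refine hv.trans_le ?_
  rw [Q.norm_map]
  simpa using PiLp.norm_apply_le (!₂[0, v, 0] : E 3) 1

theorem IsBump.measurable_area_slope (hΦ : IsBump Φ) (c : ℝ) :
    Measurable fun z : ℝ × ℝ => area Φ c (z.2 / z.1) :=
  (hΦ.continuous_area c).measurable.comp (measurable_snd.div measurable_fst)

theorem IsBump.integral_graphMeasure (hΦ : IsBump Φ) (c : ℝ) (f : ℝ × ℝ → ℝ) :
    ∫ z, f z ∂graphMeasure Φ c = ∫ z in halfPlane, area Φ c (z.2 / z.1) * f z := by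
  rw [graphMeasure, integral_withDensity_eq_integral_toReal_smul
    (hΦ.measurable_area_slope c).ennreal_ofReal (by simp)]
  simp only [ENNReal.toReal_ofReal (area_pos c _).le, smul_eq_mul]

theorem IsBump.integral_firstVar (hΦ : IsBump Φ) (c : ℝ) {φ : E 3 × Mat 3 → ℝ}
    (hφ : ContDiff ℝ 1 φ) (hφc : HasCompactSupport φ) (i : Fin 3) :
    ∫ p, firstVar φ (secondFundamentalForm 2 (Q '' graphSet Φ c)) i p
        ∂inducedVarifold 2 (Q '' graphSet Φ c) =
      -((∫ v in Ioi 0, φ (Q !₂[0, v, 0], (normalPlane Q Φ c 1).matrix)) *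
          fluxCoeff Q Φ c i 0 1 +
        (∫ v in Iio 0, φ (Q !₂[0, v, 0], (normalPlane Q Φ c (-1)).matrix)) *
          fluxCoeff Q Φ c i 0 (-1)) := by
  have hae : firstVar φ (secondFundamentalForm 2 (Q '' graphSet Φ c)) i
      =ᵐ[inducedVarifold 2 (Q '' graphSet Φ c)] firstVar φ (curvExt Q Φ c) i := by
    filter_upwards [hΦ.secondFundamentalForm_ae_eq Q c] with p hp
    simp only [firstVar, hp]
  have hmeas := aestronglyMeasurable_firstVar (V := inducedVarifold 2 (Q '' graphSet Φ c)) hφ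
    (fun i j k => (hΦ.measurable_curvExt Q c i j k).aestronglyMeasurable) i
  rw [hΦ.inducedVarifold_eq] at hmeas
  rw [integral_congr_ae hae, hΦ.inducedVarifold_eq, integral_map
    (hΦ.measurable_bundleParam Q c).aemeasurable hmeas, hΦ.integral_graphMeasure]
  simp only [area_mul_firstVar Q c φ (curvExt_bundleParam Q c _)]
  obtain ⟨r, hr⟩ := exists_radius hφc
  have hconst : ∀ a : Fin 3, (∀ s, 1 ≤ s → fluxCoeff Q Φ c i a s = fluxCoeff Q Φ c i a 1) ∧
      (∀ s, s ≤ -1 → fluxCoeff Q Φ c i a s = fluxCoeff Q Φ c i a (-1)) ∧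
      (∀ s, 1 ≤ |s| → fluxCoeffDeriv Q Φ c i a s = 0) := fun a =>
    ⟨fun s hs => hΦ.fluxCoeff_of_le Q c i a (Or.inl rfl) (by linarith),
      fun s hs => hΦ.fluxCoeff_of_le Q c i a (Or.inr rfl) (by linarith),
      fun s hs => by simp [fluxCoeffDeriv, hΦ.deriv_eq_zero hs]⟩
  set P₁ := (normalPlane Q Φ c 1).matrix
  set P₂ := (normalPlane Q Φ c (-1)).matrix
  -- The boundary value of the flux, read off from the wing on either side of the origin; its value
  -- at `v = 0` is immaterial.
  set ℓ : ℝ → ℝ := fun v => if 0 < v then φ (Q !₂[0, v, 0], P₁) * fluxCoeff Q Φ c i 0 1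
    else φ (Q !₂[0, v, 0], P₂) * fluxCoeff Q Φ c i 0 (-1) with hℓ
  -- As soon as `u ≤ s * v` the point is in the flat wing, where plane and coefficient no longer
  -- depend on `u`; only the base point still moves, continuously up to the axis.
  have hlim : ∀ (s : ℝ), s = 1 ∨ s = -1 → ∀ v, 0 < s * v →
      Tendsto (fun u => φ (matrixParam Q Φ c (u, v)) * fluxCoeff Q Φ c i 0 (v / u)) (𝓝[>] 0)
        (𝓝 (φ (Q !₂[0, v, 0], (normalPlane Q Φ c s).matrix) * fluxCoeff Q Φ c i 0 s)) := by
    intro s hs v hv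
    have hc : Continuous fun u : ℝ => φ (Q !₂[u, v, c * (s / 2) * u],
        (normalPlane Q Φ c s).matrix) * fluxCoeff Q Φ c i 0 s := by
      simp only [vec3_eq]
      refine (hφ.continuous.comp (Continuous.prodMk (Q.continuous.comp ?_)
        continuous_const)).mul continuous_const
      fun_prop
    have ht := (hc.tendsto 0).mono_left (nhdsWithin_le_nhds (s := Ioi 0))
    rw [mul_zero] at ht
    refine ht.congr' ?_
    filter_upwards [Ioc_mem_nhdsGT hv] with u hu
    have h1 : 1 ≤ s * (v / u) := by
      rw [← mul_div_assoc, one_le_div hu.1]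
      exact hu.2
    have h2 : normalPlane Q Φ c (v / u) = normalPlane Q Φ c s := by
      apply Gr.ext
      simp only [normalPlane, hΦ.normal_of_le c hs h1]
    simp only [matrixParam, h2, hΦ.fluxCoeff_of_le Q c i 0 hs h1, graphMap,
      hΦ.height_of_le c hs hu.1 hu.2]
  have hz : ∀ z : ℝ × ℝ, r < |z.1| ∨ r < |z.2| → φ (matrixParam Q Φ c z) = 0 := by
    intro z h
    obtain ⟨h1, h2⟩ := norm_graphMap_ge (Φ := Φ) Q c z
    exact (hr _ _ (h.elim (fun h => h.trans_le h1) fun h => h.trans_le h2)).1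
  rw [integral_divergence_halfPlane (r := r) (ℓ := ℓ)
    (G₀ := fun z => φ (matrixParam Q Φ c z) * fluxCoeff Q Φ c i 0 (z.2 / z.1))
    (G₁ := fun z => φ (matrixParam Q Φ c z) * fluxCoeff Q Φ c i 1 (z.2 / z.1))
    (fun u hu v => hΦ.hasDerivAt_flux Q c hφ (hΦ.hasDerivAt_fluxCoeff Q c i 0)
      (a := fun t => t) (b := fun _ => v) (hasDerivAt_id' u) (hasDerivAt_const u v) hu)
    (fun u hu v => hΦ.hasDerivAt_flux Q c hφ (hΦ.hasDerivAt_fluxCoeff Q c i 1)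
      (a := fun _ => u) (b := fun t => t) (hasDerivAt_const v u) (hasDerivAt_id' v) hu)
    (hΦ.integrableOn_fluxDeriv Q c hφ hφc (hΦ.continuous_fluxCoeff Q c i 0)
      (hΦ.continuous_fluxCoeffDeriv Q c i 0) (hconst 0).1 (hconst 0).2.1 (hconst 0).2.2 1 0)
    (hΦ.integrableOn_fluxDeriv Q c hφ hφc (hΦ.continuous_fluxCoeff Q c i 1)
      (hΦ.continuous_fluxCoeffDeriv Q c i 1) (hconst 1).1 (hconst 1).2.1 (hconst 1).2.2 0 1)
    ?_ ?_ ?_]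
  · congr 1
    have i1 := integrable_axis Q hφ.continuous hφc P₁
    have i2 := integrable_axis Q hφ.continuous hφc P₂
    have hint : Integrable ℓ := Integrable.piecewise (s := Ioi (0 : ℝ)) measurableSet_Ioi
      (i1.mul_const _).integrableOn (i2.mul_const _).integrableOn
    rw [← integral_add_compl measurableSet_Ioi hint, compl_Ioi, integral_Iic_eq_integral_Iio]
    have e1 : ∫ v in Ioi 0, ℓ v = ∫ v in Ioi 0, φ (Q !₂[0, v, 0], P₁) * fluxCoeff Q Φ c i 0 1 :=
      setIntegral_congr_fun measurableSet_Ioi fun v (hv : 0 < v) => by simp [hℓ, hv]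
    have e2 : ∫ v in Iio 0, ℓ v = ∫ v in Iio 0, φ (Q !₂[0, v, 0], P₂) * fluxCoeff Q Φ c i 0 (-1) :=
      setIntegral_congr_fun measurableSet_Iio fun v (hv : v < 0) => by simp [hℓ, not_lt.2 hv.le]
    rw [e1, e2, integral_mul_const, integral_mul_const]
  · intro v hv
    rcases lt_or_gt_of_ne hv with h | h
    · have := hlim (-1) (Or.inr rfl) v (by linarith)
      simpa only [hℓ, if_neg (not_lt.2 h.le)] using this
    · have := hlim 1 (Or.inl rfl) v (by linarith)
      simpa only [hℓ, if_pos h] using this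
  · intro u hu v
    simp only [hz (u, v) (Or.inl (hu.trans_le (le_abs_self u))), zero_mul]
  · intro u _ v hv
    simp only [hz (u, v) (Or.inr hv), zero_mul]

/-! ### Local finiteness and local integrability of the curvature -/

theorem IsBump.exists_area_le (hΦ : IsBump Φ) (c : ℝ) : ∃ C, 0 ≤ C ∧ ∀ s, area Φ c s ≤ C := by
  obtain ⟨C, h0, h⟩ := exists_bound_of_eventually_const (hΦ.continuous_area c)
    (fun s hs => hΦ.area_of_le c (Or.inl rfl) (by linarith))
    (fun s hs => hΦ.area_of_le c (Or.inr rfl) (by linarith))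
  exact ⟨C, h0, fun s => (le_abs_self _).trans (h s)⟩

/-- A bound through the planar parametrization suffices: a point of the graph over a ball of radius
`r` has `u ≤ r` and `|v| ≤ r`, and the area element is bounded. -/
theorem IsBump.integrableOn_inducedVarifold (hΦ : IsBump Φ) (c : ℝ) {h : GrBundle 3 2 → ℝ}
    (hm : Measurable h) {C : ℝ}
    (h1 : ∀ u, 0 < u → ∀ v, u < |v| → |h (bundleParam Q Φ c (u, v))| ≤ C)
    (h2 : ∀ u, 0 < u → ∀ v, |v| ≤ u → |h (bundleParam Q Φ c (u, v))| ≤ C * (1 + u⁻¹)) (r : ℝ) :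
    IntegrableOn h (Prod.fst ⁻¹' Metric.closedBall 0 r) (inducedVarifold 2 (Q '' graphSet Φ c)) := by
  have hS : MeasurableSet (Prod.fst ⁻¹' Metric.closedBall 0 r : Set (GrBundle 3 2)) :=
    measurable_fst Metric.isClosed_closedBall.measurableSet
  obtain ⟨K, hK0, hK⟩ := hΦ.exists_area_le c
  have hρ := hΦ.measurable_area_slope c
  have hi := hm.indicator hS
  have hB := hΦ.measurable_bundleParam Q c
  rw [← integrable_indicator_iff hS, hΦ.inducedVarifold_eq, integrable_map_measure
    hi.aestronglyMeasurable hB.aemeasurable, graphMeasure,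
    integrable_withDensity_iff_integrable_smul' hρ.ennreal_ofReal (by simp)]
  simp only [ENNReal.toReal_ofReal (area_pos c _).le, smul_eq_mul]
  have habs : ∀ (z : ℝ × ℝ) (D : ℝ), 0 ≤ D → |h (bundleParam Q Φ c z)| ≤ D →
      |area Φ c (z.2 / z.1) * ((Prod.fst ⁻¹' Metric.closedBall 0 r).indicator h ∘
        bundleParam Q Φ c) z| ≤ K * D := by
    intro z D hD hz
    rw [abs_mul, abs_of_pos (area_pos c _)]
    refine mul_le_mul (hK _) ?_ (abs_nonneg _) hK0
    rw [Function.comp_apply]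
    by_cases hmem : bundleParam Q Φ c z ∈ (Prod.fst ⁻¹' Metric.closedBall 0 r : Set (GrBundle 3 2))
    · rwa [indicator_of_mem hmem]
    · rwa [indicator_of_notMem hmem, abs_zero]
  refine integrableOn_halfPlane_of_bound (C := K * C) (r := r)
    (hρ.mul (hi.comp hB)).aestronglyMeasurable ?_ ?_ ?_
  · intro u hu v h'
    obtain ⟨g1, g2⟩ := norm_graphMap_ge (Φ := Φ) Q c (u, v)
    have hlt : r < ‖Q (graphMap Φ c (u, v))‖ :=
      h'.elim (fun h => h.trans_le ((le_abs_self u).trans g1)) fun h => h.trans_le g2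
    rw [Function.comp_apply, indicator_of_notMem, mul_zero]
    simpa [bundleParam] using hlt
  · intro u hu v huv
    have := h1 u hu v huv
    exact habs (u, v) C ((abs_nonneg _).trans this) this
  · intro u hu v huv
    have := h2 u hu v huv
    rw [mul_assoc]
    exact habs (u, v) _ ((abs_nonneg _).trans this) this

theorem IsBump.integrableOn_secondFundamentalForm (hΦ : IsBump Φ) (c : ℝ) (i j k : Fin 3) (r : ℝ) :
    IntegrableOn (fun p => secondFundamentalForm 2 (Q '' graphSet Φ c) p i j k)
      (Prod.fst ⁻¹' Metric.closedBall 0 r) (inducedVarifold 2 (Q '' graphSet Φ c)) := by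
  have hcont : Continuous fun s => Q (tangGrad Φ c s) i * planeDeriv Q Φ c s j k :=
    ((continuous_apply_E3 i).comp (Q.continuous.comp (hΦ.continuous_tangGrad c))).mul
      ((continuous_apply k).comp ((continuous_apply j).comp (hΦ.continuous_planeDeriv Q c)))
  have hzero : ∀ s, 1 ≤ |s| → Q (tangGrad Φ c s) i * planeDeriv Q Φ c s j k = 0 := fun s hs => by
    rw [hΦ.planeDeriv_eq_zero Q c hs]; simp
  obtain ⟨C, hC0, hC⟩ := exists_bound_of_eventually_const hcont
    (fun s hs => by rw [hzero s (hs.trans (le_abs_self s)), hzero 1 (by simp)])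
    (fun s hs => by rw [hzero s (le_abs'.2 (Or.inl hs)), hzero (-1) (by simp)])
  have key := hΦ.integrableOn_inducedVarifold Q c (hΦ.measurable_curvExt Q c i j k) (C := C)
    ?_ ?_ r
  · refine key.congr_fun_ae ?_
    filter_upwards [ae_restrict_of_ae (hΦ.secondFundamentalForm_ae_eq Q c)] with p hp
    rw [hp]
  · intro u hu v huv
    have hs : 1 ≤ |v / u| := by
      rw [abs_div, abs_of_pos hu, one_le_div hu]
      exact huv.le
    rw [curvExt_bundleParam, hΦ.planeDeriv_eq_zero Q c hs]
    simpa using hC0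
  · intro u hu v _
    rw [curvExt_bundleParam, div_mul_eq_mul_div, div_eq_mul_inv, abs_mul,
      abs_of_pos (inv_pos.2 hu)]
    have := hC (v / u)
    rw [Real.norm_eq_abs] at this
    have h3 := mul_le_mul_of_nonneg_right this (inv_pos.2 hu).le
    refine h3.trans ?_
    rw [mul_add, mul_one]
    linarith

theorem IsBump.inducedVarifold_lt_top (hΦ : IsBump Φ) (c r : ℝ) :
    inducedVarifold 2 (Q '' graphSet Φ c) (Prod.fst ⁻¹' Metric.closedBall 0 r) < ⊤ := by
  -- Integrability of the constant `1` is finiteness of the measure of the cylinder.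
  have h := hΦ.integrableOn_inducedVarifold Q c (h := fun _ => 1) measurable_const (C := 1)
    (by simp) (fun u hu v _ => by have := inv_pos.2 hu; simp; linarith) r
  simpa using (integrableOn_const_iff (by simp)).1 h

end

end CurvVar

end

noncomputable section

namespace CurvVar

open Set Filter Topology
open scoped RealInnerProductSpace

/-! ### The boundary measure -/

theorem mem_nhds_preimage_closedBall {n m : ℕ} (p : GrBundle n m) :
    (Prod.fst ⁻¹' Metric.closedBall 0 (‖p.1‖ + 1) : Set (GrBundle n m)) ∈ 𝓝 p := by
  refine continuous_fst.continuousAt.preimage_mem_nhds (mem_of_superset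
    (Metric.ball_mem_nhds p.1 one_pos) fun x hx => ?_)
  have h1 : ‖x - p.1‖ < 1 := by simpa [dist_eq_norm] using hx
  have h2 : ‖x‖ ≤ ‖x - p.1‖ + ‖p.1‖ := by simpa using norm_add_le (x - p.1) p.1
  rw [Metric.mem_closedBall, dist_zero_right]
  linarith

theorem isLocallyFiniteMeasure_of_lt_top {n m : ℕ} {V : Measure (GrBundle n m)}
    (h : ∀ r, V (Prod.fst ⁻¹' Metric.closedBall 0 r) < ⊤) : IsLocallyFiniteMeasure V :=
  ⟨fun p => ⟨_, mem_nhds_preimage_closedBall p, h _⟩⟩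

theorem locallyIntegrable_of_integrableOn {n m : ℕ} {V : Measure (GrBundle n m)}
    {f : GrBundle n m → ℝ} (h : ∀ r, IntegrableOn f (Prod.fst ⁻¹' Metric.closedBall 0 r) V) :
    LocallyIntegrable f V :=
  fun p => ⟨_, mem_nhds_preimage_closedBall p, h _⟩

/-- The pushforward of `ν⁺ H¹⌞L⁺ + ν⁻ H¹⌞L⁻` by the tangent map of `R`. -/
def boundaryOf (R : Set (E 3)) (ν : ℝ → E 3) : RnMeasure 3 (GrBundle 3 2) :=
  RnMeasure.map (tangentMap 2 R)
    (RnMeasure.add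
      (RnMeasure.constMul (ν 1) ((μHE[1] : Measure (E 3)).restrict (halfLine 1)))
      (RnMeasure.constMul (ν (-1)) ((μHE[1] : Measure (E 3)).restrict (halfLine (-1)))))

theorem isometry_axis : Isometry fun v : ℝ => (!₂[0, v, 0] : E 3) := by
  refine Isometry.of_dist_eq fun v w => ?_
  simp [EuclideanSpace.dist_eq, Fin.sum_univ_three, Real.dist_eq, Real.sqrt_sq_eq_abs]

theorem restrict_halfLine (s : ℝ) : (μHE[1] : Measure (E 3)).restrict (halfLine s) =
    (volume.restrict {v : ℝ | 0 < s * v}).map fun v => !₂[0, v, 0] := by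
  have h1 : (μHE[1] : Measure ℝ) = volume := by
    have := InnerProductSpace.euclideanHausdorffMeasure_eq_volume (V := ℝ)
    rwa [Module.finrank_self] at this
  have hm : MeasurableSet (halfLine s) :=
    ((measurableSet_eq_fun (continuous_apply_E3 0).measurable measurable_const).inter
      ((measurableSet_eq_fun (continuous_apply_E3 2).measurable measurable_const).inter
        (measurableSet_lt measurable_const ((continuous_apply_E3 1).measurable.const_mul s))))
  have hsub : halfLine s ⊆ range fun v : ℝ => (!₂[0, v, 0] : E 3) := by
    rintro x ⟨h0, h2, _⟩
    refine ⟨x 1, ?_⟩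
    ext i
    fin_cases i <;> simp [h0, h2]
  have h2 := isometry_axis.map_euclideanHausdorffMeasure (d := 1)
  rw [← Measure.restrict_restrict_of_subset hsub, ← h2, h1,
    Measure.restrict_map isometry_axis.continuous.measurable hm]
  congr 2
  ext v
  simp [halfLine]

section

variable {Φ : ℝ → ℝ} (Q : E 3 ≃ₗᵢ[ℝ] E 3)

/-- The measure `H¹⌞L^±` lifted by the tangent plane of the graph. -/
def axisMeasure (Φ : ℝ → ℝ) (c s : ℝ) : Measure (GrBundle 3 2) :=
  (volume.restrict {v : ℝ | 0 < s * v}).map fun v => (!₂[0, v, 0], normalPlane Q Φ c s)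

theorem measurable_axis_pair (P : Gr 3 2) :
    Measurable fun v : ℝ => ((!₂[0, v, 0], P) : GrBundle 3 2) :=
  isometry_axis.continuous.measurable.prodMk measurable_const

/-- A measurable version of the tangent map of the graph along the axis. -/
def axisTangentMap (Φ : ℝ → ℝ) (c : ℝ) (x : E 3) : GrBundle 3 2 :=
  open scoped Classical in (x, if 0 < x 1 then normalPlane Q Φ c 1 else normalPlane Q Φ c (-1))

theorem measurable_axisTangentMap (c : ℝ) : Measurable (axisTangentMap Q Φ c) := by
  classical
  refine measurable_id.prodMk (Measurable.ite ?_ measurable_const measurable_const)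
  exact measurableSet_lt measurable_const (continuous_apply_E3 1).measurable

theorem map_axisTangentMap (c : ℝ) {s : ℝ} (hs : s = 1 ∨ s = -1) :
    ((μHE[1] : Measure (E 3)).restrict (halfLine s)).map (axisTangentMap Q Φ c) =
      axisMeasure Q Φ c s := by
  have hS : MeasurableSet {v : ℝ | 0 < s * v} :=
    measurableSet_lt measurable_const (measurable_const_mul s)
  rw [restrict_halfLine, Measure.map_map (measurable_axisTangentMap Q c)
    isometry_axis.continuous.measurable, axisMeasure]
  refine Measure.map_congr ?_
  filter_upwards [ae_restrict_mem hS] with v hv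
  rcases hs with rfl | rfl
  · have : 0 < v := by simpa using hv
    simp [axisTangentMap, this]
  · have : ¬ 0 < v := by simp at hv; linarith
    simp [axisTangentMap, this]

/-- `Q` fixes the axis pointwise, so points of `L^±` are images of boundary points of the unrotated
graph, whose tangent plane is constant along each half-line. -/
theorem IsBump.tangentMap_ae_eq (hΦ : IsBump Φ) (c : ℝ) (hQ : ∀ v, Q !₂[0, v, 0] = !₂[0, v, 0])
    {s : ℝ} (hs : s = 1 ∨ s = -1) :
    tangentMap 2 (Q '' graphSet Φ c) =ᵐ[(μHE[1] : Measure (E 3)).restrict (halfLine s)]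
      axisTangentMap Q Φ c := by
  have hm : MeasurableSet (halfLine s) :=
    ((measurableSet_eq_fun (continuous_apply_E3 0).measurable measurable_const).inter
      ((measurableSet_eq_fun (continuous_apply_E3 2).measurable measurable_const).inter
        (measurableSet_lt measurable_const ((continuous_apply_E3 1).measurable.const_mul s))))
  filter_upwards [ae_restrict_mem hm] with x hx
  obtain ⟨h0, h2, h1⟩ := hx
  have hx' : x = Q !₂[0, x 1, 0] := by
    rw [hQ]
    ext i
    fin_cases i <;> simp [h0, h2]
  have ht : tangentPlane 2 (Q '' graphSet Φ c) x = normalPlane Q Φ c s := by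
    conv_lhs => rw [hx']
    exact hΦ.tangentPlane_axis Q c hs h1
  rw [tangentMap, ht, axisTangentMap]
  rcases hs with rfl | rfl
  · rw [if_pos (by linarith)]
  · rw [if_neg (by linarith)]

theorem IsBump.map_tangentMap_add (hΦ : IsBump Φ) (c : ℝ)
    (hQ : ∀ v, Q !₂[0, v, 0] = !₂[0, v, 0]) (a b : ENNReal) :
    (a • (μHE[1] : Measure (E 3)).restrict (halfLine 1) +
      b • (μHE[1] : Measure (E 3)).restrict (halfLine (-1))).map
        (tangentMap 2 (Q '' graphSet Φ c)) =
      a • axisMeasure Q Φ c 1 + b • axisMeasure Q Φ c (-1) := by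
  have hae : tangentMap 2 (Q '' graphSet Φ c)
      =ᵐ[a • (μHE[1] : Measure (E 3)).restrict (halfLine 1) +
      b • (μHE[1] : Measure (E 3)).restrict (halfLine (-1))] axisTangentMap Q Φ c :=
    (ae_add_measure_iff).2 ⟨Measure.ae_smul_measure (hΦ.tangentMap_ae_eq Q c hQ (Or.inl rfl)) a,
      Measure.ae_smul_measure (hΦ.tangentMap_ae_eq Q c hQ (Or.inr rfl)) b⟩
  rw [Measure.map_congr hae, Measure.map_add _ _ (measurable_axisTangentMap Q c),
    Measure.map_smul, Measure.map_smul, map_axisTangentMap Q c (Or.inl rfl),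
    map_axisTangentMap Q c (Or.inr rfl)]

theorem IsBump.boundaryOf_pos (hΦ : IsBump Φ) (c : ℝ) (hQ : ∀ v, Q !₂[0, v, 0] = !₂[0, v, 0])
    (ν : ℝ → E 3) (i : Fin 3) : (boundaryOf (Q '' graphSet Φ c) ν).pos i =
      ENNReal.ofReal (ν 1 i) • axisMeasure Q Φ c 1 +
        ENNReal.ofReal (ν (-1) i) • axisMeasure Q Φ c (-1) :=
  hΦ.map_tangentMap_add Q c hQ _ _

theorem IsBump.boundaryOf_neg (hΦ : IsBump Φ) (c : ℝ) (hQ : ∀ v, Q !₂[0, v, 0] = !₂[0, v, 0])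
    (ν : ℝ → E 3) (i : Fin 3) : (boundaryOf (Q '' graphSet Φ c) ν).neg i =
      ENNReal.ofReal (-ν 1 i) • axisMeasure Q Φ c 1 +
        ENNReal.ofReal (-ν (-1) i) • axisMeasure Q Φ c (-1) :=
  hΦ.map_tangentMap_add Q c hQ _ _

theorem axisMeasure_lt_top (c s r : ℝ) :
    axisMeasure Q Φ c s (Prod.fst ⁻¹' Metric.closedBall 0 r) < ⊤ := by
  have hS : MeasurableSet (Prod.fst ⁻¹' Metric.closedBall 0 r : Set (GrBundle 3 2)) :=
    measurable_fst Metric.isClosed_closedBall.measurableSet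
  rw [axisMeasure, Measure.map_apply (measurable_axis_pair _) hS]
  refine (Measure.restrict_apply_le _ _).trans_lt ((measure_mono fun v hv => ?_).trans_lt
    (measure_closedBall_lt_top (x := (0 : ℝ)) (r := r)))
  have h : ‖(!₂[0, v, 0] : E 3)‖ ≤ r := by simpa using hv
  rw [Metric.mem_closedBall, dist_zero_right]
  exact le_trans (by simpa using PiLp.norm_apply_le (!₂[0, v, 0] : E 3) 1) h

theorem IsBump.boundaryOf_lt_top (hΦ : IsBump Φ) (c : ℝ) (hQ : ∀ v, Q !₂[0, v, 0] = !₂[0, v, 0])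
    (ν : ℝ → E 3) (i : Fin 3) (r : ℝ) :
    (boundaryOf (Q '' graphSet Φ c) ν).pos i (Prod.fst ⁻¹' Metric.closedBall 0 r) < ⊤ ∧
    (boundaryOf (Q '' graphSet Φ c) ν).neg i (Prod.fst ⁻¹' Metric.closedBall 0 r) < ⊤ := by
  rw [hΦ.boundaryOf_pos Q c hQ, hΦ.boundaryOf_neg Q c hQ]
  simp only [Measure.add_apply, Measure.smul_apply, smul_eq_mul]
  have h := axisMeasure_lt_top (Φ := Φ) Q c
  exact ⟨ENNReal.add_lt_top.2 ⟨ENNReal.mul_lt_top (by simp) (h _ _),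
    ENNReal.mul_lt_top (by simp) (h _ _)⟩, ENNReal.add_lt_top.2
    ⟨ENNReal.mul_lt_top (by simp) (h _ _), ENNReal.mul_lt_top (by simp) (h _ _)⟩⟩

/-- A compactly supported test function vanishes outside a cylinder over a ball, so finiteness on
such cylinders is enough and compactness of the Grassmannian is not needed. -/
theorem integrable_pair_of_lt_top {n m : ℕ} {μ : Measure (GrBundle n m)}
    (hμ : ∀ r, μ (Prod.fst ⁻¹' Metric.closedBall 0 r) < ⊤) {φ : E n × Mat n → ℝ}
    (hφ : Continuous φ) (hφc : HasCompactSupport φ) :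
    Integrable (fun p : GrBundle n m => φ (p.1, p.2.matrix)) μ := by
  obtain ⟨r, hr⟩ := exists_radius hφc
  obtain ⟨K, hK⟩ := hφc.exists_bound_of_continuous hφ
  have hS : MeasurableSet (Prod.fst ⁻¹' Metric.closedBall 0 r : Set (GrBundle n m)) :=
    measurable_fst Metric.isClosed_closedBall.measurableSet
  refine Integrable.mono' ((integrable_indicator_iff hS).2 (integrableOn_const (C := K) (hμ r).ne))
    (hφ.comp continuous_matrixPair).aestronglyMeasurable (Eventually.of_forall fun p => ?_)
  by_cases hp : p ∈ (Prod.fst ⁻¹' Metric.closedBall 0 r : Set (GrBundle n m))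
  · rw [indicator_of_mem hp]
    exact hK _
  · rw [indicator_of_notMem hp, (hr p.1 p.2.matrix (by simpa using hp)).1, norm_zero]

theorem IsBump.integral_boundaryOf (hΦ : IsBump Φ) (c : ℝ)
    (hQ : ∀ v, Q !₂[0, v, 0] = !₂[0, v, 0]) (ν : ℝ → E 3) {φ : E 3 × Mat 3 → ℝ}
    (hφ : Continuous φ) (hφc : HasCompactSupport φ) (i : Fin 3) :
    (boundaryOf (Q '' graphSet Φ c) ν).integral i (fun p => φ (p.1, p.2.matrix)) =
      (∫ v in Ioi 0, φ (!₂[0, v, 0], (normalPlane Q Φ c 1).matrix)) * ν 1 i +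
      (∫ v in Iio 0, φ (!₂[0, v, 0], (normalPlane Q Φ c (-1)).matrix)) * ν (-1) i := by
  have hint : ∀ s, Integrable (fun p : GrBundle 3 2 => φ (p.1, p.2.matrix)) (axisMeasure Q Φ c s) :=
    fun s => integrable_pair_of_lt_top (axisMeasure_lt_top Q c s) hφ hφc
  have hax : ∀ s, ∫ p : GrBundle 3 2, φ (p.1, p.2.matrix) ∂axisMeasure Q Φ c s =
      ∫ v in {v : ℝ | 0 < s * v}, φ (!₂[0, v, 0], (normalPlane Q Φ c s).matrix) := fun s => by
    exact integral_map (measurable_axis_pair _).aemeasurable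
      (hφ.comp continuous_matrixPair).aestronglyMeasurable
  have h1 : {v : ℝ | 0 < 1 * v} = Ioi 0 := by ext v; simp
  have h2 : {v : ℝ | 0 < -1 * v} = Iio 0 := by ext v; simp
  -- The coordinates of `constMul` are split into positive and negative parts, which recombine here.
  have hmax : ∀ x : ℝ, (ENNReal.ofReal x).toReal - (ENNReal.ofReal (-x)).toReal = x := fun x => by
    rw [ENNReal.toReal_ofReal', ENNReal.toReal_ofReal', max_zero_sub_max_neg_zero_eq_self]
  rw [RnMeasure.integral, hΦ.boundaryOf_pos Q c hQ, hΦ.boundaryOf_neg Q c hQ]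
  rw [integral_add_measure ((hint 1).smul_measure ENNReal.ofReal_ne_top)
    ((hint (-1)).smul_measure ENNReal.ofReal_ne_top),
    integral_add_measure ((hint 1).smul_measure ENNReal.ofReal_ne_top)
    ((hint (-1)).smul_measure ENNReal.ofReal_ne_top)]
  simp only [integral_smul_measure, hax, h1, h2, smul_eq_mul]
  have e1 := hmax (ν 1 i)
  have e2 := hmax (ν (-1) i)
  linear_combination (∫ v in Ioi 0, φ (!₂[0, v, 0], (normalPlane Q Φ c 1).matrix)) * e1 +
    (∫ v in Iio 0, φ (!₂[0, v, 0], (normalPlane Q Φ c (-1)).matrix)) * e2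

/-- In the wings the gradient is `(± c / 2, 0)`, and `1 + c² / 4 = 4 / 3`. Only `c²` enters, so both
signs of `c` are covered. -/
theorem IsBump.area_eq (hΦ : IsBump Φ) {c : ℝ} (hc : c ^ 2 = 4 / 3) {s : ℝ}
    (hs : s = 1 ∨ s = -1) : area Φ c s = 2 / √3 := by
  have h1 : 1 ≤ s * s := by rcases hs with rfl | rfl <;> norm_num
  have hs2 : s ^ 2 = 1 := by rcases hs with rfl | rfl <;> norm_num
  have h3 : (√3 : ℝ) ^ 2 = 3 := Real.sq_sqrt (by norm_num)
  refine (pow_left_inj₀ (area_pos c s).le (by positivity) two_ne_zero).1 ?_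
  rw [area_sq, hΦ.slope₁_of_le c hs h1, hΦ.slope₂_of_le c hs h1, div_pow, h3]
  linear_combination (s ^ 2 / 4) * hc + (1 / 3) * hs2

theorem IsBump.normal_eq (hΦ : IsBump Φ) {c : ℝ} (hc : c ^ 2 = 4 / 3) {s : ℝ}
    (hs : s = 1 ∨ s = -1) : normal Φ c s = !₂[-(√3 / 4 * c * s), 0, √3 / 2] := by
  have h1 : 1 ≤ s * s := by rcases hs with rfl | rfl <;> norm_num
  rw [normal, gradNormal, hΦ.area_eq hc hs, hΦ.slope₁_of_le c hs h1, hΦ.slope₂_of_le c hs h1]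
  ext i
  fin_cases i
  · simp; ring
  · simp
  · simp

/-- The flux through the axis is the area element times the tangential part of `e₁`. In a wing this
vector is the unit vector tangent to the graph and orthogonal to the axis, pointing into the
surface. -/
theorem IsBump.fluxCoeff_eq_conormal (hΦ : IsBump Φ) {c : ℝ} (hc : c ^ 2 = 4 / 3) {s : ℝ}
    (hs : s = 1 ∨ s = -1) (i : Fin 3) :
    fluxCoeff Q Φ c i 0 s = Q !₂[√3 / 2, 0, √3 / 4 * c * s] i := by
  have hs2 : s ^ 2 = 1 := by rcases hs with rfl | rfl <;> norm_num
  have h3 : (√3 : ℝ) ^ 2 = 3 := Real.sq_sqrt (by norm_num)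
  have hn3 : (√3 : ℝ) ≠ 0 := by positivity
  -- The inverse of an isometry is its adjoint.
  have h0 : Q.symm (stdVec i) 0 = Q (stdVec 0) i := by
    rw [← inner_stdVec, real_inner_comm, ← inner_stdVec (Q (stdVec 0)), ← Q.inner_map_map,
      Q.apply_symm_apply]
  have hv : (!₂[√3 / 2, 0, √3 / 4 * c * s] : E 3) =
      area Φ c s • (stdVec 0 - normal Φ c s 0 • normal Φ c s) := by
    rw [hΦ.area_eq hc hs, hΦ.normal_eq hc hs]
    ext i
    fin_cases i
    · simp [stdVec]
      field_simp
      linear_combination (4 * s ^ 2 * √3 ^ 2) * hc + (16 / 3 * √3 ^ 2) * hs2 + (64 / 3 : ℝ) * h3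
    · simp [stdVec]
    · simp [stdVec]
      field_simp
  rw [hv, fluxCoeff, h0]
  simp only [map_smul, map_sub, PiLp.smul_apply, PiLp.sub_apply, smul_eq_mul]
  ring

/-- The data of a curvature varifold with boundary with bounds on all cylinders over balls. -/
structure IsTame (V : Measure (GrBundle 3 2)) (A : GrBundle 3 2 → Fin 3 → Fin 3 → Fin 3 → ℝ)
    (β : RnMeasure 3 (GrBundle 3 2)) : Prop where
  hasCurvatureAndBoundary : HasCurvatureAndBoundary V A β
  lt_top : ∀ r, V (Prod.fst ⁻¹' Metric.closedBall 0 r) < ⊤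
  integrableOn : ∀ i j k r, IntegrableOn (fun p => A p i j k) (Prod.fst ⁻¹' Metric.closedBall 0 r) V
  boundary_lt_top : ∀ i r, β.pos i (Prod.fst ⁻¹' Metric.closedBall 0 r) < ⊤ ∧
    β.neg i (Prod.fst ⁻¹' Metric.closedBall 0 r) < ⊤

theorem IsBump.isTame_graph (hΦ : IsBump Φ) {c : ℝ} (hc : c ^ 2 = 4 / 3)
    (hQ : ∀ v, Q !₂[0, v, 0] = !₂[0, v, 0]) {ν : ℝ → E 3}
    (hν : ∀ s, s = 1 ∨ s = -1 → ν s = Q !₂[√3 / 2, 0, √3 / 4 * c * s]) :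
    IsTame (inducedVarifold 2 (Q '' graphSet Φ c))
      (secondFundamentalForm 2 (Q '' graphSet Φ c)) (boundaryOf (Q '' graphSet Φ c) ν) where
  hasCurvatureAndBoundary :=
    { isVarifold := isLocallyFiniteMeasure_of_lt_top (hΦ.inducedVarifold_lt_top Q c)
      locallyIntegrable := fun i j k => locallyIntegrable_of_integrableOn
        (hΦ.integrableOn_secondFundamentalForm Q c i j k)
      isRadon := fun i => ⟨isLocallyFiniteMeasure_of_lt_top fun r =>
          (hΦ.boundaryOf_lt_top Q c hQ ν i r).1,
        isLocallyFiniteMeasure_of_lt_top fun r => (hΦ.boundaryOf_lt_top Q c hQ ν i r).2⟩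
      integral_eq := fun φ hφ hφc i => by
        rw [hΦ.integral_boundaryOf Q c hQ ν hφ.continuous hφc, hν 1 (Or.inl rfl),
          hν (-1) (Or.inr rfl), ← hΦ.fluxCoeff_eq_conormal Q hc (Or.inl rfl),
          ← hΦ.fluxCoeff_eq_conormal Q hc (Or.inr rfl)]
        have h := hΦ.integral_firstVar Q c hφ hφc i
        simp only [hQ] at h
        exact h }
  lt_top := hΦ.inducedVarifold_lt_top Q c
  integrableOn := hΦ.integrableOn_secondFundamentalForm Q c
  boundary_lt_top := hΦ.boundaryOf_lt_top Q c hQ ν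

end

end CurvVar

end

noncomputable section

namespace CurvVar

open Set Filter Topology

/-! ### Sums of varifolds -/

theorem abs_matrix_le {n m : ℕ} (P : Gr n m) (j k : Fin n) : |P.matrix j k| ≤ 1 := by
  have h1 : ‖P.plane.starProjection (stdVec k)‖ ≤ ‖(stdVec k : E n)‖ :=
    P.plane.norm_starProjection_apply_le _
  have h2 := PiLp.norm_apply_le (P.plane.starProjection (stdVec k)) j
  have h3 : ‖(stdVec k : E n)‖ = 1 := by simp [stdVec]
  rw [h3] at h1
  exact h2.trans h1

theorem integrableOn_firstVar {n m : ℕ} {V : Measure (GrBundle n m)} {φ : E n × Mat n → ℝ}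
    (hφ : ContDiff ℝ 1 φ) (hφc : HasCompactSupport φ)
    {A : GrBundle n m → Fin n → Fin n → Fin n → ℝ} {S : Set (GrBundle n m)} (hV : V S < ⊤)
    (hA : ∀ i j k, IntegrableOn (fun p => A p i j k) S V) (i : Fin n) :
    IntegrableOn (firstVar φ A i) S V := by
  obtain ⟨K₀, hK₀⟩ := hφc.exists_bound_of_continuous hφ.continuous
  obtain ⟨K₁, hK₁⟩ := (hφc.fderiv (𝕜 := ℝ)).exists_bound_of_continuous
    (hφ.continuous_fderiv (by simp))
  have hd := fun v => (continuous_fderiv_pair (m := m) hφ v).aestronglyMeasurable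
    (μ := V.restrict S)
  have hdb : ∀ (v : E n × Mat n) (p : GrBundle n m),
      ‖fderiv ℝ φ (p.1, p.2.matrix) v‖ ≤ K₁ * ‖v‖ := fun v p =>
    ((fderiv ℝ φ (p.1, p.2.matrix)).le_opNorm v).trans
      (mul_le_mul_of_nonneg_right (hK₁ _) (norm_nonneg _))
  have hfin : IsFiniteMeasure (V.restrict S) := ⟨by simpa using hV⟩
  refine Integrable.add (Integrable.add ?_ ?_) ?_
  · refine integrable_finsetSum _ fun j _ => ?_
    refine Integrable.bdd_mul (c := 1) ?_ (measurable_matrix_apply i j).aestronglyMeasurable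
      (Eventually.of_forall fun p => abs_matrix_le p.2 i j)
    exact Integrable.of_bound (hd _) _ (Eventually.of_forall (hdb _))
  · refine integrable_finsetSum _ fun j _ => integrable_finsetSum _ fun k _ => ?_
    exact Integrable.bdd_mul (hA i j k) (hd _) (Eventually.of_forall (hdb _))
  · exact Integrable.bdd_mul (integrable_finsetSum _ fun j _ => hA j i j)
      (hφ.continuous.comp continuous_matrixPair).aestronglyMeasurable
      (Eventually.of_forall fun p => hK₀ _)

theorem integrable_firstVar {n m : ℕ} {V : Measure (GrBundle n m)} {φ : E n × Mat n → ℝ}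
    (hφ : ContDiff ℝ 1 φ) (hφc : HasCompactSupport φ)
    {A : GrBundle n m → Fin n → Fin n → Fin n → ℝ} {S : Set (GrBundle n m)} (hV : V S < ⊤)
    (hA : ∀ i j k, IntegrableOn (fun p => A p i j k) S V)
    (hS : ∀ p ∉ S, (p.1, p.2.matrix) ∉ tsupport φ) (i : Fin n) :
    Integrable (firstVar φ A i) V := by
  refine (integrableOn_iff_integrable_of_support_subset fun p hp => ?_).1
    (integrableOn_firstVar hφ hφc hV hA i)
  by_contra h
  have h1 := image_eq_zero_of_notMem_tsupport (hS p h)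
  have h2 : fderiv ℝ φ (p.1, p.2.matrix) = 0 :=
    image_eq_zero_of_notMem_tsupport fun h' => hS p h (tsupport_fderiv_subset ℝ h')
  exact hp (by simp [firstVar, h1, h2])

theorem exists_closedBall_of_hasCompactSupport {n m : ℕ} {φ : E n × Mat n → ℝ}
    (hφc : HasCompactSupport φ) : ∃ r : ℝ, ∀ p : GrBundle n m,
      p ∉ (Prod.fst ⁻¹' Metric.closedBall 0 r : Set (GrBundle n m)) →
        (p.1, p.2.matrix) ∉ tsupport φ := by
  obtain ⟨r, hr⟩ := hφc.isCompact.isBounded.exists_norm_le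
  refine ⟨r, fun p hp h => hp ?_⟩
  simpa using (norm_fst_le (p.1, p.2.matrix)).trans (hr _ h)

theorem IsTame.integral_add_boundary {V₁ V₂ : Measure (GrBundle 3 2)}
    {A₁ A₂ : GrBundle 3 2 → Fin 3 → Fin 3 → Fin 3 → ℝ} {β₁ β₂ : RnMeasure 3 (GrBundle 3 2)}
    (h₁ : IsTame V₁ A₁ β₁) (h₂ : IsTame V₂ A₂ β₂) {φ : E 3 × Mat 3 → ℝ}
    (hφ : Continuous φ) (hφc : HasCompactSupport φ) (i : Fin 3) :
    (β₁.add β₂).integral i (fun p => φ (p.1, p.2.matrix)) =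
      β₁.integral i (fun p => φ (p.1, p.2.matrix)) +
      β₂.integral i (fun p => φ (p.1, p.2.matrix)) := by
  simp only [RnMeasure.integral, RnMeasure.add]
  rw [integral_add_measure
      (integrable_pair_of_lt_top (fun r => (h₁.boundary_lt_top i r).1) hφ hφc)
      (integrable_pair_of_lt_top (fun r => (h₂.boundary_lt_top i r).1) hφ hφc),
    integral_add_measure
      (integrable_pair_of_lt_top (fun r => (h₁.boundary_lt_top i r).2) hφ hφc)
      (integrable_pair_of_lt_top (fun r => (h₂.boundary_lt_top i r).2) hφ hφc)]
  ring

-- Since `V₁` and `V₂` live over disjoint sets of base points, the curvature function may be chosen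
-- piecewise and agrees with each `A_k` almost everywhere for `V_k`. The bounds in `IsTame` make
-- every integral split.
open scoped Classical in
theorem IsTame.add {V₁ V₂ : Measure (GrBundle 3 2)}
    {A₁ A₂ : GrBundle 3 2 → Fin 3 → Fin 3 → Fin 3 → ℝ} {β₁ β₂ : RnMeasure 3 (GrBundle 3 2)}
    (h₁ : IsTame V₁ A₁ β₁) (h₂ : IsTame V₂ A₂ β₂) {B : Set (E 3)}
    (hB₁ : ∀ᵐ p ∂V₁, p.1 ∈ B) (hB₂ : ∀ᵐ p ∂V₂, p.1 ∉ B) :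
    IsTame (V₁ + V₂) (fun p => if p.1 ∈ B then A₁ p else A₂ p) (β₁.add β₂) := by
  set A : GrBundle 3 2 → Fin 3 → Fin 3 → Fin 3 → ℝ := fun p => if p.1 ∈ B then A₁ p else A₂ p with hA
  have e₁ : A =ᵐ[V₁] A₁ := by
    filter_upwards [hB₁] with p hp using by rw [hA]; exact if_pos hp
  have e₂ : A =ᵐ[V₂] A₂ := by
    filter_upwards [hB₂] with p hp using by rw [hA]; exact if_neg hp
  have hlt : ∀ r, (V₁ + V₂) (Prod.fst ⁻¹' Metric.closedBall 0 r) < ⊤ := fun r =>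
    ENNReal.add_lt_top.2 ⟨h₁.lt_top r, h₂.lt_top r⟩
  have hblt : ∀ i r, (β₁.add β₂).pos i (Prod.fst ⁻¹' Metric.closedBall 0 r) < ⊤ ∧
      (β₁.add β₂).neg i (Prod.fst ⁻¹' Metric.closedBall 0 r) < ⊤ := fun i r =>
    ⟨ENNReal.add_lt_top.2 ⟨(h₁.boundary_lt_top i r).1, (h₂.boundary_lt_top i r).1⟩,
      ENNReal.add_lt_top.2 ⟨(h₁.boundary_lt_top i r).2, (h₂.boundary_lt_top i r).2⟩⟩
  have i₁ : ∀ i j k r, IntegrableOn (fun p => A p i j k) (Prod.fst ⁻¹' Metric.closedBall 0 r) V₁ :=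
    fun i j k r => (h₁.integrableOn i j k r).congr_fun_ae
      (ae_restrict_of_ae (e₁.mono fun p hp => by simp only [hp]))
  have i₂ : ∀ i j k r, IntegrableOn (fun p => A p i j k) (Prod.fst ⁻¹' Metric.closedBall 0 r) V₂ :=
    fun i j k r => (h₂.integrableOn i j k r).congr_fun_ae
      (ae_restrict_of_ae (e₂.mono fun p hp => by simp only [hp]))
  have hint : ∀ i j k r, IntegrableOn (fun p => A p i j k) (Prod.fst ⁻¹' Metric.closedBall 0 r)
      (V₁ + V₂) := fun i j k r => (i₁ i j k r).add_measure (i₂ i j k r)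
  refine ⟨⟨isLocallyFiniteMeasure_of_lt_top hlt,
    fun i j k => locallyIntegrable_of_integrableOn (hint i j k),
    fun i => ⟨isLocallyFiniteMeasure_of_lt_top fun r => (hblt i r).1,
      isLocallyFiniteMeasure_of_lt_top fun r => (hblt i r).2⟩, ?_⟩, hlt, hint, hblt⟩
  intro φ hφ hφc i
  obtain ⟨r, hr⟩ := exists_closedBall_of_hasCompactSupport (m := 2) hφc
  have f₁ := integrable_firstVar hφ hφc (h₁.lt_top r) (fun i j k => i₁ i j k r) hr i
  have f₂ := integrable_firstVar hφ hφc (h₂.lt_top r) (fun i j k => i₂ i j k r) hr i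
  have g₁ : ∫ p, firstVar φ A i p ∂V₁ = ∫ p, firstVar φ A₁ i p ∂V₁ :=
    integral_congr_ae (e₁.mono fun p hp => by simp only [firstVar, hp])
  have g₂ : ∫ p, firstVar φ A i p ∂V₂ = ∫ p, firstVar φ A₂ i p ∂V₂ :=
    integral_congr_ae (e₂.mono fun p hp => by simp only [firstVar, hp])
  have k₁ : ∫ p, firstVar φ A₁ i p ∂V₁ = -β₁.integral i (fun p => φ (p.1, p.2.matrix)) :=
    h₁.hasCurvatureAndBoundary.integral_eq φ hφ hφc i
  have k₂ : ∫ p, firstVar φ A₂ i p ∂V₂ = -β₂.integral i (fun p => φ (p.1, p.2.matrix)) :=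
    h₂.hasCurvatureAndBoundary.integral_eq φ hφ hφc i
  have hadd : (β₁.add β₂).integral i (fun p => φ (p.1, p.2.matrix)) =
      β₁.integral i (fun p => φ (p.1, p.2.matrix)) +
      β₂.integral i (fun p => φ (p.1, p.2.matrix)) := IsTame.integral_add_boundary h₁ h₂ hφ.continuous hφc i
  change ∫ p, firstVar φ A i p ∂(V₁ + V₂) = _
  rw [integral_add_measure f₁ f₂, g₁, g₂, k₁, k₂, hadd]
  ring

/-! ### Uniqueness of the boundary away from the varifold -/

/-- A smooth cutoff equal to `1` on the `x₂`-axis and to `0` at distance `n^(-1/2)` from it. -/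
def axisCutoff (n : ℕ) (x : E 3) : ℝ := Real.smoothTransition (1 - n * (x 0 ^ 2 + x 2 ^ 2))

theorem contDiff_axisCutoff (n : ℕ) : ContDiff ℝ 1 (axisCutoff n) := by
  have h : ∀ i : Fin 3, ContDiff ℝ 1 fun x : E 3 => x i := fun i =>
    (EuclideanSpace.proj i : E 3 →L[ℝ] ℝ).contDiff
  exact Real.smoothTransition.contDiff.comp
    (contDiff_const.sub (contDiff_const.mul (((h 0).pow 2).add ((h 2).pow 2))))

theorem fderiv_cutoff_mul_apply {χ : E 3 → ℝ} (hχ : ContDiff ℝ 1 χ) {φ : E 3 × Mat 3 → ℝ}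
    (hφ : ContDiff ℝ 1 φ) (q : E 3 × Mat 3) (m : Mat 3) :
    fderiv ℝ (fun q => χ q.1 * φ q) q (0, m) = χ q.1 * fderiv ℝ φ q (0, m) := by
  have h1 : HasFDerivAt (fun q : E 3 × Mat 3 => χ q.1) _ q :=
    ((hχ.differentiable (by simp)) q.1).hasFDerivAt.comp q
      (ContinuousLinearMap.fst ℝ (E 3) (Mat 3)).hasFDerivAt
  have h2 := h1.mul ((hφ.differentiable (by simp)) q).hasFDerivAt
  have h3 : fderiv ℝ (fun q => χ q.1 * φ q) q = _ := h2.fderiv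
  rw [h3]
  simp

/-- The `x`-derivatives do not involve `A` and cancel in the difference. The remaining terms contain
only matrix derivatives, for which a function of `x` is a constant factor, so no derivative of the
cutoff survives. -/
theorem firstVar_cutoff_sub {χ : E 3 → ℝ} (hχ : ContDiff ℝ 1 χ) {φ : E 3 × Mat 3 → ℝ}
    (hφ : ContDiff ℝ 1 φ) (A A' : GrBundle 3 2 → Fin 3 → Fin 3 → Fin 3 → ℝ) (i : Fin 3)
    (p : GrBundle 3 2) :
    firstVar (fun q => χ q.1 * φ q) A i p - firstVar (fun q => χ q.1 * φ q) A' i p =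
      χ p.1 * (firstVar φ A i p - firstVar φ A' i p) := by
  simp only [firstVar, fderiv_cutoff_mul_apply hχ hφ, mul_assoc, ← Finset.mul_sum]
  ring

/-- The difference of the two integrands is absolutely continuous with respect to `V`, whereas `β₀`
is concentrated over the axis, which `V` does not charge. Cutoffs shrinking to the axis leave the
boundary term unchanged and send the other term to zero. -/
theorem integral_boundary_eq_zero {V : Measure (GrBundle 3 2)}
    {A₀ A : GrBundle 3 2 → Fin 3 → Fin 3 → Fin 3 → ℝ} {β₀ β : RnMeasure 3 (GrBundle 3 2)}
    (h₀ : HasCurvatureAndBoundary V A₀ β₀) (h : HasCurvatureAndBoundary V A β) (hβ : β.IsZero)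
    (hV : ∀ᵐ p ∂V, ¬(p.1 0 = 0 ∧ p.1 2 = 0))
    (hβ₀ : ∀ i, (∀ᵐ p ∂β₀.pos i, p.1 0 = 0 ∧ p.1 2 = 0) ∧
      (∀ᵐ p ∂β₀.neg i, p.1 0 = 0 ∧ p.1 2 = 0)) (p₀ : GrBundle 3 2) :
    ∃ ε, 0 < ε ∧ ∀ φ : E 3 × Mat 3 → ℝ, ContDiff ℝ 1 φ → HasCompactSupport φ →
      tsupport φ ⊆ Metric.ball (p₀.1, p₀.2.matrix) ε → ∀ i,
        β₀.integral i (fun p => φ (p.1, p.2.matrix)) = 0 := by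
  -- Both curvature functions are integrable only near `p₀`; since the bundle carries the topology
  -- induced by the projection matrices, that neighbourhood contains the trace of a ball in `ℝ³ ×
  -- ℝ^(3²)`, and test functions are supported in it.
  have hind : IsInducing fun p : GrBundle 3 2 => (p.1, p.2.matrix) :=
    IsInducing.id.prodMap ⟨rfl⟩
  obtain ⟨S, hS, hSV, hSA₀, hSA⟩ : ∃ S ∈ 𝓝 p₀, V S < ⊤ ∧
      (∀ i j k, IntegrableOn (fun p => A₀ p i j k) S V) ∧
      (∀ i j k, IntegrableOn (fun p => A p i j k) S V) := by
    have := h.isVarifold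
    obtain ⟨S₀, hS₀, hlt⟩ := V.finiteAt_nhds p₀
    choose s hs hsi using fun i j k => h₀.locallyIntegrable i j k p₀
    choose t ht hti using fun i j k => h.locallyIntegrable i j k p₀
    refine ⟨S₀ ∩ ⋂ i, ⋂ j, ⋂ k, (s i j k ∩ t i j k), inter_mem hS₀ ?_, ?_, ?_, ?_⟩
    · simp only [iInter_mem]
      exact fun i j k => inter_mem (hs i j k) (ht i j k)
    · exact (measure_mono inter_subset_left).trans_lt hlt
    · exact fun i j k => (hsi i j k).mono_set fun p hp => (mem_iInter.1 (mem_iInter.1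
        (mem_iInter.1 hp.2 i) j) k).1
    · exact fun i j k => (hti i j k).mono_set fun p hp => (mem_iInter.1 (mem_iInter.1
        (mem_iInter.1 hp.2 i) j) k).2
  rw [hind.nhds_eq_comap] at hS
  obtain ⟨ε, hε, hεS⟩ := (Metric.nhds_basis_ball.comap _).mem_iff.1 hS
  refine ⟨ε, hε, fun φ hφ hφc hsupp i => ?_⟩
  set φn : ℕ → E 3 × Mat 3 → ℝ := fun n q => axisCutoff n q.1 * φ q with hφn
  have hφn1 : ∀ n, ContDiff ℝ 1 (φn n) := fun n =>
    ((contDiff_axisCutoff n).comp contDiff_fst).mul hφ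
  have hφnc : ∀ n, HasCompactSupport (φn n) := fun n => hφc.mul_left
  have hts : ∀ n, tsupport (φn n) ⊆ tsupport φ := fun n =>
    closure_mono (Function.support_mul_subset_right _ _)
  have hSn : ∀ p ∉ S, (p.1, p.2.matrix) ∉ tsupport φ := fun p hp hmem =>
    hp (hεS (hsupp hmem))
  have hD : Integrable (fun p => firstVar φ A i p - firstVar φ A₀ i p) V :=
    (integrable_firstVar hφ hφc hSV hSA hSn i).sub (integrable_firstVar hφ hφc hSV hSA₀ hSn i)
  have hax : ∀ n (x : E 3), x 0 = 0 ∧ x 2 = 0 → axisCutoff n x = 1 := fun n x hx => by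
    simp [axisCutoff, hx.1, hx.2]
  have hb₀ : ∀ n, β₀.integral i (fun p => φn n (p.1, p.2.matrix)) =
      β₀.integral i (fun p => φ (p.1, p.2.matrix)) := fun n => by
    rw [RnMeasure.integral, RnMeasure.integral]
    congr 1
    · exact integral_congr_ae ((hβ₀ i).1.mono fun p hp => by simp [hφn, hax n p.1 hp])
    · exact integral_congr_ae ((hβ₀ i).2.mono fun p hp => by simp [hφn, hax n p.1 hp])
  have hb : ∀ f, β.integral i f = 0 := fun f => by
    rw [RnMeasure.integral, show β.pos = β.neg from hβ, sub_self]
  have key : ∀ n, ∫ p, axisCutoff n p.1 * (firstVar φ A i p - firstVar φ A₀ i p) ∂V =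
      β₀.integral i (fun p => φ (p.1, p.2.matrix)) := fun n => by
    have hSn' : ∀ p ∉ S, (p.1, p.2.matrix) ∉ tsupport (φn n) := fun p hp hmem =>
      hSn p hp (hts n hmem)
    have k₁ : ∫ p, firstVar (φn n) A i p ∂V = -β.integral i (fun p => φn n (p.1, p.2.matrix)) :=
      h.integral_eq (φn n) (hφn1 n) (hφnc n) i
    have k₂ : ∫ p, firstVar (φn n) A₀ i p ∂V = -β₀.integral i (fun p => φn n (p.1, p.2.matrix)) :=
      h₀.integral_eq (φn n) (hφn1 n) (hφnc n) i
    simp only [← firstVar_cutoff_sub (contDiff_axisCutoff n) hφ]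
    rw [integral_sub (integrable_firstVar (hφn1 n) (hφnc n) hSV hSA hSn' i)
      (integrable_firstVar (hφn1 n) (hφnc n) hSV hSA₀ hSn' i), k₁, k₂, hb, hb₀]
    ring
  have hlim : Tendsto (fun n => ∫ p, axisCutoff n p.1 *
      (firstVar φ A i p - firstVar φ A₀ i p) ∂V) atTop (𝓝 (∫ _, 0 ∂V)) := by
    refine tendsto_integral_of_dominated_convergence
      (fun p => ‖firstVar φ A i p - firstVar φ A₀ i p‖) (fun n => ?_) hD.norm (fun n => ?_) ?_
    · exact ((contDiff_axisCutoff n).continuous.comp continuous_fst).aestronglyMeasurable.mul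
        hD.aestronglyMeasurable
    · refine Eventually.of_forall fun p => ?_
      rw [norm_mul]
      refine mul_le_of_le_one_left (norm_nonneg _) ?_
      rw [axisCutoff, Real.norm_of_nonneg (Real.smoothTransition.nonneg _)]
      exact Real.smoothTransition.le_one _
    · filter_upwards [hV] with p hp
      have hpos : 0 < p.1 0 ^ 2 + p.1 2 ^ 2 := by
        by_contra hle
        refine hp ⟨?_, ?_⟩
        · exact pow_eq_zero_iff two_ne_zero |>.1
            (le_antisymm (by nlinarith [sq_nonneg (p.1 2)]) (sq_nonneg _))
        · exact pow_eq_zero_iff two_ne_zero |>.1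
            (le_antisymm (by nlinarith [sq_nonneg (p.1 0)]) (sq_nonneg _))
      refine tendsto_const_nhds.congr' ?_
      -- At a fixed point off the axis the argument of the transition function is nonpositive once
      -- `n` exceeds the inverse squared distance, so the cutoff is eventually zero there.
      obtain ⟨n₀, hn₀⟩ := exists_nat_ge (1 / (p.1 0 ^ 2 + p.1 2 ^ 2))
      filter_upwards [eventually_ge_atTop n₀] with n hn
      have : 1 ≤ n * (p.1 0 ^ 2 + p.1 2 ^ 2) := by
        rw [div_le_iff₀ hpos] at hn₀
        refine hn₀.trans (mul_le_mul_of_nonneg_right (by exact_mod_cast hn) hpos.le)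
      rw [axisCutoff, Real.smoothTransition.zero_of_nonpos (by linarith), zero_mul]
  simp only [key, integral_zero] at hlim
  exact tendsto_nhds_unique tendsto_const_nhds hlim

end CurvVar

end

noncomputable section

namespace CurvVar

open Set Filter Topology

/-! ### The six sheets -/

/-- The rotation `rot` as a linear isometry equivalence. -/
def rotEquiv : E 3 ≃ₗᵢ[ℝ] E 3 :=
  LinearIsometry.toLinearIsometryEquiv
    { toFun := rot
      map_add' := fun x y => by
        ext i; fin_cases i <;> simp [rot] <;> ring
      map_smul' := fun a x => by
        ext i; fin_cases i <;> simp [rot] <;> ring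
      norm_map' := fun x => by
        have h3 : √3 ^ 2 = 3 := Real.sq_sqrt (by norm_num)
        simp only [EuclideanSpace.norm_eq, Fin.sum_univ_three, Real.norm_eq_abs, sq_abs]
        congr 1
        simp [rot]
        linear_combination (x 0 ^ 2 / 4 + x 2 ^ 2 / 4) * h3 } rfl

/-- The iterates of the rotation `rot`. -/
def rotPow : ℕ → E 3 ≃ₗᵢ[ℝ] E 3
  | 0 => LinearIsometryEquiv.refl ℝ (E 3)
  | k + 1 => (rotPow k).trans rotEquiv

theorem rotPow_zero_apply (x : E 3) : rotPow 0 x = x := rfl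

theorem rotPow_succ_apply (k : ℕ) (x : E 3) : rotPow (k + 1) x = rot (rotPow k x) := rfl

theorem rotPow_one_apply (x : E 3) : rotPow 1 x = rot x := rfl

theorem rotPow_two_apply (x : E 3) : rotPow 2 x =
    !₂[-(1 / 2) * x 0 + √3 / 2 * x 2, x 1, -(√3 / 2) * x 0 - 1 / 2 * x 2] := by
  have h3 : √3 * √3 = 3 := Real.mul_self_sqrt (by norm_num)
  change rot (rot x) = _
  ext i
  fin_cases i <;> simp [rot] <;> grind

theorem rotPow_axis (k : ℕ) (v : ℝ) : rotPow k !₂[0, v, 0] = !₂[0, v, 0] := by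
  induction k with
  | zero => rfl
  | succ k ih =>
    rw [rotPow_succ_apply, ih]
    ext i; fin_cases i <;> simp [rot]

variable {Φ : ℝ → ℝ} {c : ℝ}

/-- The image of the graph of `height Φ c` under the `k`-th iterate of the rotation. -/
def sheet (Φ : ℝ → ℝ) (c : ℝ) (k : ℕ) : Set (E 3) := rotPow k '' graphSet Φ c

/-- The conormals of `sheet Φ c k`. -/
def sheetConormal (c : ℝ) (k : ℕ) (s : ℝ) : E 3 := rotPow k !₂[√3 / 2, 0, √3 / 4 * c * s]

theorem sheet_succ (c : ℝ) (k : ℕ) : sheet Φ c (k + 1) = rot '' sheet Φ c k := by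
  rw [sheet, sheet, image_image]
  rfl

theorem IsBump.surface_odd (hΦ : IsBump Φ) (k : ℕ) :
    surface Φ (2 * k + 1) = sheet Φ (2 / √3) k := by
  induction k with
  | zero =>
    ext x
    simp only [sheet, surface, graphSet, mem_image, mem_ofPred_eq, rotPow_zero_apply, exists_eq_right]
    exact and_congr_right fun h => by rw [hΦ.g_eq_height h]
  | succ k ih => rw [sheet_succ, ← ih]; rfl

/-- `height` is odd in `v`, so reflecting the graph in the second coordinate is the same as changing
the sign of `c`. -/
theorem IsBump.surface_even (hΦ : IsBump Φ) (k : ℕ) :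
    surface Φ (2 * k + 2) = sheet Φ (-(2 / √3)) k := by
  induction k with
  | zero =>
    ext x
    simp only [sheet, surface, graphSet, mem_image, mem_ofPred_eq, rotPow_zero_apply, exists_eq_right]
    have hg : ∀ u v, 0 < u → g Φ u v = height Φ (-(2 / √3)) u (-v) := fun u v hu => by
      rw [hΦ.g_eq_height hu, hΦ.height_neg_right, height_neg, neg_neg]
    constructor
    · rintro ⟨y, ⟨h0, h⟩, rfl⟩
      rw [hg _ _ h0] at h
      exact ⟨h0, h⟩
    · rintro ⟨h0, h⟩
      refine ⟨reflect x, ⟨h0, ?_⟩, ?_⟩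
      · rw [hg (reflect x 0) (reflect x 1) h0]
        simpa [reflect] using h
      · ext i; fin_cases i <;> simp [reflect]
  | succ k ih => rw [sheet_succ, ← ih]; rfl

theorem conormal_odd (s : ℝ) (k : ℕ) :
    conormal s (2 * k + 1) = sheetConormal (2 / √3) k s := by
  induction k with
  | zero =>
    have h3 : √3 ≠ 0 := by positivity
    change !₂[√3 / 2, 0, s / 2] = !₂[√3 / 2, 0, √3 / 4 * (2 / √3) * s]
    congr 4
    field_simp
    norm_num
  | succ k ih => rw [sheetConormal, rotPow_succ_apply, ← sheetConormal, ← ih]; rfl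

theorem conormal_even (s : ℝ) (k : ℕ) :
    conormal s (2 * k + 2) = sheetConormal (-(2 / √3)) k s := by
  induction k with
  | zero =>
    have h3 : √3 ≠ 0 := by positivity
    change !₂[√3 / 2, 0, -s / 2] = !₂[√3 / 2, 0, √3 / 4 * -(2 / √3) * s]
    congr 4
    field_simp
    norm_num
  | succ k ih => rw [sheetConormal, rotPow_succ_apply, ← sheetConormal, ← ih]; rfl

theorem IsBump.isTame_sheet (hΦ : IsBump Φ) (hc : c ^ 2 = 4 / 3) (k : ℕ) :
    IsTame (inducedVarifold 2 (sheet Φ c k)) (secondFundamentalForm 2 (sheet Φ c k))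
      (boundaryOf (sheet Φ c k) (sheetConormal c k)) :=
  hΦ.isTame_graph (rotPow k) hc (rotPow_axis k) fun _ _ => rfl

theorem two_div_sqrt_three_sq : (2 / √3) ^ 2 = 4 / 3 := by
  rw [div_pow, Real.sq_sqrt (by norm_num)]
  norm_num

theorem IsBump.hasCurvatureAndBoundary_W_odd (hΦ : IsBump Φ) (k : ℕ) :
    HasCurvatureAndBoundary (W Φ (2 * k + 1)) (secondFundamentalForm 2 (surface Φ (2 * k + 1)))
      (boundaryW Φ (2 * k + 1)) := by
  have h := (hΦ.isTame_sheet two_div_sqrt_three_sq k).hasCurvatureAndBoundary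
  have hν : sheetConormal (2 / √3) k = fun s => conormal s (2 * k + 1) :=
    funext fun s => (conormal_odd s k).symm
  rw [← hΦ.surface_odd, hν] at h
  exact h

theorem IsBump.hasCurvatureAndBoundary_W_even (hΦ : IsBump Φ) (k : ℕ) :
    HasCurvatureAndBoundary (W Φ (2 * k + 2)) (secondFundamentalForm 2 (surface Φ (2 * k + 2)))
      (boundaryW Φ (2 * k + 2)) := by
  have h := (hΦ.isTame_sheet (by rw [neg_sq, two_div_sqrt_three_sq]) k).hasCurvatureAndBoundary
  have hν : sheetConormal (-(2 / √3)) k = fun s => conormal s (2 * k + 2) :=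
    funext fun s => (conormal_even s k).symm
  rw [← hΦ.surface_even, hν] at h
  exact h

/-! ### The union of three sheets -/

/-- The unrotated sheet stays in the closed sector of half-angle `π/6` about `e₁`, because the
primitive is bounded by `1 / 2` and `√3 * |c| = 2`. -/
theorem IsBump.abs_le_of_mem_graphSet (hΦ : IsBump Φ) (hc : c ^ 2 = 4 / 3) {x : E 3}
    (hx : x ∈ graphSet Φ c) : 0 < x 0 ∧ √3 * |x 2| ≤ x 0 := by
  obtain ⟨h0, h⟩ := hx
  refine ⟨h0, ?_⟩
  have h3 : √3 * |c| = 2 := by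
    rw [← sq_eq_sq₀ (by positivity) (by norm_num), mul_pow, sq_abs, hc,
      Real.sq_sqrt (by norm_num)]
    norm_num
  have hp := hΦ.abs_primitive_le (x 1 / x 0)
  rw [h, height, abs_mul, abs_mul, abs_of_pos h0]
  calc √3 * (|c| * x 0 * |primitive Φ (x 1 / x 0)|)
      = 2 * x 0 * |primitive Φ (x 1 / x 0)| := by rw [← h3]; ring
    _ ≤ 2 * x 0 * (1 / 2) := by gcongr
    _ = x 0 := by ring

/-- Rotating the sector of half-angle `π/6` by `±2π/3` moves it into `{x₁ ≤ 0}`. -/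
theorem IsBump.disjoint_graphSet_sheet (hΦ : IsBump Φ) (hc : c ^ 2 = 4 / 3) {k : ℕ}
    (hk : k = 1 ∨ k = 2) : Disjoint (graphSet Φ c) (sheet Φ c k) := by
  rw [Set.disjoint_left]
  rintro _ hx ⟨y, hy, rfl⟩
  have hx0 := hx.1
  obtain ⟨hy0, hy2⟩ := hΦ.abs_le_of_mem_graphSet hc hy
  have h1 := neg_abs_le (y 2)
  have h2 := le_abs_self (y 2)
  have h3 : 0 < √3 := by positivity
  rcases hk with rfl | rfl
  · rw [rotPow_one_apply] at hx0
    simp [rot] at hx0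
    nlinarith
  · rw [rotPow_two_apply] at hx0
    simp at hx0
    nlinarith

theorem IsBump.disjoint_sheet_one_two (hΦ : IsBump Φ) (hc : c ^ 2 = 4 / 3) :
    Disjoint (sheet Φ c 1) (sheet Φ c 2) := by
  have h := hΦ.disjoint_graphSet_sheet hc (Or.inl rfl)
  have h2 : sheet Φ c 1 = rotEquiv '' graphSet Φ c := rfl
  rw [show sheet Φ c 2 = rotEquiv '' sheet Φ c 1 from sheet_succ c 1]
  nth_rw 1 [h2]
  exact (Set.disjoint_image_iff rotEquiv.injective).2 h

theorem sheet_zero (c : ℝ) : sheet Φ c 0 = graphSet Φ c := by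
  ext x
  simp [sheet, rotPow_zero_apply]

theorem IsBump.ae_mem_sheet (hΦ : IsBump Φ) (c : ℝ) (k : ℕ) :
    ∀ᵐ p ∂inducedVarifold 2 (sheet Φ c k), p.1 ∈ sheet Φ c k :=
  hΦ.ae_mem_graphSet (rotPow k) c

/-- The sum of the varifolds induced by three sheets. -/
def tripleVarifold (Φ : ℝ → ℝ) (c : ℝ) : Measure (GrBundle 3 2) :=
  inducedVarifold 2 (sheet Φ c 0) + inducedVarifold 2 (sheet Φ c 1) +
    inducedVarifold 2 (sheet Φ c 2)

/-- The boundary of `tripleVarifold Φ c`. -/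
def tripleBoundary (Φ : ℝ → ℝ) (c : ℝ) : RnMeasure 3 (GrBundle 3 2) :=
  ((boundaryOf (sheet Φ c 0) (sheetConormal c 0)).add
    (boundaryOf (sheet Φ c 1) (sheetConormal c 1))).add
    (boundaryOf (sheet Φ c 2) (sheetConormal c 2))

theorem IsBump.exists_isTame_pair (hΦ : IsBump Φ) (hc : c ^ 2 = 4 / 3) :
    ∃ A, IsTame (inducedVarifold 2 (sheet Φ c 0) + inducedVarifold 2 (sheet Φ c 1)) A
      ((boundaryOf (sheet Φ c 0) (sheetConormal c 0)).add
        (boundaryOf (sheet Φ c 1) (sheetConormal c 1))) := by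
  have d01 := hΦ.disjoint_graphSet_sheet hc (Or.inl rfl)
  rw [← sheet_zero] at d01
  exact ⟨_, (hΦ.isTame_sheet hc 0).add (hΦ.isTame_sheet hc 1) (hΦ.ae_mem_sheet c 0)
    ((hΦ.ae_mem_sheet c 1).mono fun p hp h => Set.disjoint_left.1 d01 h hp)⟩

theorem IsBump.exists_isTame_triple (hΦ : IsBump Φ) (hc : c ^ 2 = 4 / 3) :
    ∃ A, IsTame (tripleVarifold Φ c) A (tripleBoundary Φ c) := by
  have d02 := hΦ.disjoint_graphSet_sheet hc (Or.inr rfl)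
  have d12 := hΦ.disjoint_sheet_one_two hc
  rw [← sheet_zero] at d02
  obtain ⟨A, hA⟩ := hΦ.exists_isTame_pair hc
  -- The first two sheets lie in the complement of the third, so this complement separates the pair
  -- from it.
  refine ⟨_, hA.add (hΦ.isTame_sheet hc 2) (B := (sheet Φ c 2)ᶜ) ?_ ?_⟩
  · rw [ae_add_measure_iff]
    exact ⟨(hΦ.ae_mem_sheet c 0).mono fun p hp h => Set.disjoint_left.1 d02 hp h,
      (hΦ.ae_mem_sheet c 1).mono fun p hp h => Set.disjoint_left.1 d12 hp h⟩
  · exact (hΦ.ae_mem_sheet c 2).mono fun p hp h => h hp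

theorem IsBump.integral_tripleBoundary (hΦ : IsBump Φ) (hc : c ^ 2 = 4 / 3)
    {φ : E 3 × Mat 3 → ℝ} (hφ : Continuous φ) (hφc : HasCompactSupport φ) (i : Fin 3) :
    (tripleBoundary Φ c).integral i (fun p => φ (p.1, p.2.matrix)) =
      ∑ k : Fin 3, ((∫ v in Ioi 0, φ (!₂[0, v, 0], (normalPlane (rotPow k) Φ c 1).matrix)) *
          sheetConormal c k 1 i +
        (∫ v in Iio 0, φ (!₂[0, v, 0], (normalPlane (rotPow k) Φ c (-1)).matrix)) *
          sheetConormal c k (-1) i) := by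
  obtain ⟨A, hA⟩ := hΦ.exists_isTame_pair hc
  have h := fun k => hΦ.integral_boundaryOf (rotPow k) c (rotPow_axis k) (sheetConormal c k) hφ hφc i
  rw [tripleBoundary, hA.integral_add_boundary (hΦ.isTame_sheet hc 2) hφ hφc,
    (hΦ.isTame_sheet hc 0).integral_add_boundary (hΦ.isTame_sheet hc 1) hφ hφc, sheet, h 0,
    sheet, h 1, sheet, h 2, Fin.sum_univ_three]
  rfl

theorem IsBump.isCurvatureVarifoldWithBoundary_triple (hΦ : IsBump Φ) (hc : c ^ 2 = 4 / 3) :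
    IsCurvatureVarifoldWithBoundary (tripleVarifold Φ c) := by
  obtain ⟨A, hA⟩ := hΦ.exists_isTame_triple hc
  exact ⟨A, _, hA.hasCurvatureAndBoundary⟩

theorem eq_axis {x : E 3} (h : x 0 = 0 ∧ x 2 = 0) : x = !₂[0, x 1, 0] := by
  ext i; fin_cases i <;> simp [h.1, h.2]

theorem IsBump.ae_not_axis (hΦ : IsBump Φ) (c : ℝ) (k : ℕ) :
    ∀ᵐ p ∂inducedVarifold 2 (sheet Φ c k), ¬(p.1 0 = 0 ∧ p.1 2 = 0) := by
  refine (hΦ.ae_mem_sheet c k).mono fun p hp h => ?_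
  obtain ⟨y, hy, hyp⟩ := hp
  rw [eq_axis h, ← rotPow_axis k] at hyp
  have := hy.1
  rw [(rotPow k).injective hyp] at this
  simp at this

theorem measurableSet_axis : MeasurableSet {p : GrBundle 3 2 | p.1 0 = 0 ∧ p.1 2 = 0} :=
  (((continuous_apply_E3 0).measurable.comp measurable_fst) (measurableSet_singleton 0)).inter
    (((continuous_apply_E3 2).measurable.comp measurable_fst) (measurableSet_singleton 0))

theorem ae_axisMeasure (Q : E 3 ≃ₗᵢ[ℝ] E 3) (c s : ℝ) :
    ∀ᵐ p ∂axisMeasure Q Φ c s, p.1 0 = 0 ∧ p.1 2 = 0 := by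
  rw [axisMeasure, ae_map_iff (measurable_axis_pair _).aemeasurable measurableSet_axis]
  exact Eventually.of_forall fun v => by simp

theorem IsBump.ae_boundaryOf (hΦ : IsBump Φ) (c : ℝ) (k : ℕ) (ν : ℝ → E 3) (i : Fin 3) :
    (∀ᵐ p ∂(boundaryOf (sheet Φ c k) ν).pos i, p.1 0 = 0 ∧ p.1 2 = 0) ∧
      ∀ᵐ p ∂(boundaryOf (sheet Φ c k) ν).neg i, p.1 0 = 0 ∧ p.1 2 = 0 := by
  rw [sheet, hΦ.boundaryOf_pos _ c (rotPow_axis k), hΦ.boundaryOf_neg _ c (rotPow_axis k),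
    ae_add_measure_iff, ae_add_measure_iff]
  have h := ae_axisMeasure (Φ := Φ) (rotPow k) c
  exact ⟨⟨Measure.ae_smul_measure (h _) _, Measure.ae_smul_measure (h _) _⟩,
    Measure.ae_smul_measure (h _) _, Measure.ae_smul_measure (h _) _⟩

/-- The planes at the half-line `L⁺` of different sheets are different. -/
theorem IsBump.lt_abs_matrix_sub (hΦ : IsBump Φ) (hc : c ^ 2 = 4 / 3) {k : ℕ}
    (hk : k = 1 ∨ k = 2) :
    2 / 5 < |(normalPlane (rotPow k) Φ c 1).matrix 0 2 -
      (normalPlane (rotPow 0) Φ c 1).matrix 0 2| := by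
  have h3 : √3 * √3 = 3 := Real.mul_self_sqrt (by norm_num)
  -- The differences of the entries have absolute value `√3 / 2` or `√3 / 4`; the smaller exceeds
  -- `0.425`, hence `2 / 5`.
  have h3' : 1.7 < √3 := Real.lt_sqrt_of_sq_lt (by norm_num)
  have hcc : c = 2 / 3 * √3 ∨ c = -(2 / 3 * √3) := by
    rw [← sq_eq_sq_iff_eq_or_eq_neg, hc]
    nlinarith
  -- Expanding the rotated normals produces these odd powers of `√3`, which have to be made linear
  -- for the final comparison.
  have h33 : √3 ^ 3 = 3 * √3 := by linear_combination √3 * h3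
  have h35 : √3 ^ 5 = 9 * √3 := by linear_combination (√3 ^ 3 + 3 * √3) * h3
  simp only [normalPlane_matrix, hΦ.normal_eq hc (Or.inl rfl), lt_abs]
  rcases hk with rfl | rfl <;> rcases hcc with rfl | rfl <;>
    simp [rotPow_zero_apply, rotPow_one_apply, rotPow_two_apply, rot] <;>
    first | exact Or.inl (by linarith) | exact Or.inr (by linarith)

/-- A zero boundary would force the explicit boundary to vanish near every point of the bundle. A
bump around a point of `L^+` paired with the plane of the first sheet misses the other two sheets,
hence sees only a conormal with first component `√3 / 2`. -/
theorem IsBump.not_isZero_triple (hΦ : IsBump Φ) (hc : c ^ 2 = 4 / 3)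
    {A : GrBundle 3 2 → Fin 3 → Fin 3 → Fin 3 → ℝ} {β : RnMeasure 3 (GrBundle 3 2)}
    (h : HasCurvatureAndBoundary (tripleVarifold Φ c) A β) : ¬ β.IsZero := by
  intro hβ
  obtain ⟨A₀, hA₀⟩ := hΦ.exists_isTame_triple hc
  set P : Gr 3 2 := normalPlane (rotPow 0) Φ c 1 with hP
  obtain ⟨ε, hε, H⟩ := integral_boundary_eq_zero hA₀.hasCurvatureAndBoundary h hβ (by
      rw [tripleVarifold, ae_add_measure_iff, ae_add_measure_iff]
      exact ⟨⟨hΦ.ae_not_axis c 0, hΦ.ae_not_axis c 1⟩, hΦ.ae_not_axis c 2⟩) (fun i => by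
      have hb := fun k => hΦ.ae_boundaryOf c k (sheetConormal c k) i
      simp only [tripleBoundary, RnMeasure.add, ae_add_measure_iff]
      exact ⟨⟨⟨(hb 0).1, (hb 1).1⟩, (hb 2).1⟩, ⟨(hb 0).2, (hb 1).2⟩, (hb 2).2⟩)
    (!₂[0, 1, 0], P)
  set q : E 3 × Mat 3 := (!₂[0, 1, 0], P.matrix) with hq
  have hr : 0 < min (ε / 2) (2 / 5) := by positivity
  -- The outer radius fits inside the `ε`-ball, and being at most `2 / 5` it excludes the planes of
  -- the two other sheets as well as the base points with `v < 0`, which are at distance more than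
  -- `1`.
  let f : ContDiffBump q := ⟨min (ε / 2) (2 / 5) / 2, min (ε / 2) (2 / 5), by positivity, by linarith⟩
  have hf : tsupport f ⊆ Metric.ball q ε := by
    rw [f.tsupport_eq]
    exact Metric.closedBall_subset_ball ((min_le_left _ _).trans_lt (by linarith))
  have hzero : ∀ x, 2 / 5 ≤ dist x q → f x = 0 := fun x hx =>
    f.zero_of_le_dist ((min_le_right _ _).trans hx)
  have hneg : ∀ (M : Mat 3) (v : ℝ), v < 0 → f (!₂[0, v, 0], M) = 0 := fun M v hv => by
    refine hzero _ (le_trans ?_ (le_max_left _ _))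
    have h1 := PiLp.norm_apply_le (!₂[0, v, 0] - !₂[0, 1, 0] : E 3) 1
    rw [← dist_eq_norm] at h1
    refine le_trans ?_ h1
    simp only [PiLp.sub_apply, Matrix.cons_val_one, Matrix.cons_val_zero,
      Real.norm_eq_abs]
    rw [abs_of_neg (by linarith)]
    linarith
  have hplane : ∀ k : ℕ, k = 1 ∨ k = 2 → ∀ v : ℝ,
      f (!₂[0, v, 0], (normalPlane (rotPow k) Φ c 1).matrix) = 0 := fun k hk v => by
    refine hzero _ (le_trans ?_ (le_max_right _ _))
    refine le_trans ?_ (dist_le_pi_dist _ _ 0)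
    refine le_trans ?_ (dist_le_pi_dist _ _ 2)
    exact (hΦ.lt_abs_matrix_sub hc hk).le
  have h0 := H f f.contDiff f.hasCompactSupport hf 0
  have hI : ∀ k : ℕ, ∫ v in Iio 0, f (!₂[0, v, 0], (normalPlane (rotPow k) Φ c (-1)).matrix) = 0 :=
    fun k => setIntegral_eq_zero_of_forall_eq_zero fun v hv => hneg _ v hv
  have hJ : ∀ k : ℕ, k = 1 ∨ k = 2 →
      ∫ v in Ioi 0, f (!₂[0, v, 0], (normalPlane (rotPow k) Φ c 1).matrix) = 0 := fun k hk =>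
    setIntegral_eq_zero_of_forall_eq_zero fun v _ => hplane k hk v
  rw [hΦ.integral_tripleBoundary hc f.continuous f.hasCompactSupport, Fin.sum_univ_three] at h0
  simp only [Fin.val_zero, Fin.val_one, Fin.val_two, hI, hJ 1 (Or.inl rfl), hJ 2 (Or.inr rfl),
    zero_mul, add_zero] at h0
  have hν : sheetConormal c 0 1 0 = √3 / 2 := by simp [sheetConormal, rotPow_zero_apply]
  have hpos : 0 < ∫ v in Ioi (0 : ℝ), f (!₂[0, v, 0], P.matrix) := by
    have hcont : Continuous fun v : ℝ => f (!₂[0, v, 0], P.matrix) :=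
      f.continuous.comp (isometry_axis.continuous.prodMk continuous_const)
    have heq : ∫ v in Ioi (0 : ℝ), f (!₂[0, v, 0], P.matrix) = ∫ v, f (!₂[0, v, 0], P.matrix) := by
      refine setIntegral_eq_integral_of_ae_compl_eq_zero ?_
      filter_upwards [compl_mem_ae_iff.2 (measure_singleton (0 : ℝ))] with v hv hv'
      exact hneg _ v (lt_of_le_of_ne (not_lt.1 hv') hv)
    rw [heq]
    refine hcont.integral_pos_of_hasCompactSupport_nonneg_nonzero ?_ (fun v => f.nonneg) (x := 1) ?_
    · exact f.hasCompactSupport.comp_isClosedEmbedding (Isometry.isClosedEmbedding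
        (Isometry.of_dist_eq fun v w => by
          rw [Prod.dist_eq, dist_self, isometry_axis.dist_eq, max_eq_left dist_nonneg]))
    · rw [← hq]
      -- At `v = 1` the integrand is the value of the bump at its centre.
      rw [f.one_of_mem_closedBall (Metric.mem_closedBall_self f.rIn_pos.le)]
      exact one_ne_zero
  rw [hν] at h0
  have : 0 < √3 / 2 := by positivity
  exact (mul_pos hpos this).ne' h0

end CurvVar

end

open CurvVar in
theorem mainTheorem3 (Φ : ℝ → ℝ) (hΦ : IsBump Φ) :
    (∀ i : ℕ, 1 ≤ i → i ≤ 6 →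
      HasCurvatureAndBoundary (W Φ i) (secondFundamentalForm 2 (surface Φ i)) (boundaryW Φ i)) ∧
    (IsCurvatureVarifoldWithBoundary (Z₁ Φ) ∧
      ∀ A β, HasCurvatureAndBoundary (Z₁ Φ) A β → ¬ β.IsZero) ∧
    (IsCurvatureVarifoldWithBoundary (Z₂ Φ) ∧
      ∀ A β, HasCurvatureAndBoundary (Z₂ Φ) A β → ¬ β.IsZero) := by
  have hc := two_div_sqrt_three_sq
  have hc' : (-(2 / √3)) ^ 2 = 4 / 3 := by rw [neg_sq, hc]
  have hZ₁ : Z₁ Φ = tripleVarifold Φ (2 / √3) := by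
    rw [tripleVarifold, ← hΦ.surface_odd 0, ← hΦ.surface_odd 1, ← hΦ.surface_odd 2]
    rfl
  have hZ₂ : Z₂ Φ = tripleVarifold Φ (-(2 / √3)) := by
    rw [tripleVarifold, ← hΦ.surface_even 0, ← hΦ.surface_even 1, ← hΦ.surface_even 2]
    rfl
  rw [hZ₁, hZ₂]
  refine ⟨fun i h1 h6 => ?_,
    ⟨hΦ.isCurvatureVarifoldWithBoundary_triple hc, fun A β => hΦ.not_isZero_triple hc⟩,
    ⟨hΦ.isCurvatureVarifoldWithBoundary_triple hc', fun A β => hΦ.not_isZero_triple hc'⟩⟩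
  interval_cases i
  · exact hΦ.hasCurvatureAndBoundary_W_odd 0
  · exact hΦ.hasCurvatureAndBoundary_W_even 0
  · exact hΦ.hasCurvatureAndBoundary_W_odd 1
  · exact hΦ.hasCurvatureAndBoundary_W_even 1
  · exact hΦ.hasCurvatureAndBoundary_W_odd 2
  · exact hΦ.hasCurvatureAndBoundary_W_even 2
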